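/- **Setting.** A matrix $C\in\mathbb C^{m\times m}$ has numerical range $W(C)=\{x^*Cx:\|x\|=1\}$ and is semi-sectorial if its field angle (the angle subtended by the cone $\{x^*Cx:x\ne 0\}$) is at most $\pi$. Such a $C$ has a decomposition $C=T^*\,\mathrm{diag}(0,D,E)\,T$ with $T$ nonsingular, $D=\mathrm{diag}(e^{j\theta_1},\dots,e^{j\theta_p})$, $|\theta_i-\theta_0|\le\pi/2$, and $E$ consisting of $q$ diagonal blocks $e^{j\theta_0}\begin{bmatrix}1&2\\0&1\end{bmatrix}$; its phases are $\theta_1,\dots,\theta_p$ and $q$ copies each of $\theta_0\pm\pi/2$. Their maximum and minimum are $\overline\phi(C),\underline\phi(C)$ ($-\infty$ and $\infty$ if $C=0$), and $\gamma(C)$ is the midpoint of these two. $\mathcal{RH}_\infty^{m\times m}$ is the set of real rational proper stable $m\times m$ transfer matrices. Let $G\in\mathcal{RH}_\infty^{m\times m}$ be frequency-wise semi-sectorial: $G(j\omega)$ is semi-sectorial for all $\omega\in[-\infty,\infty]$, and for all small $\epsilon>0$, $G$ has constant rank and is semi-sectorial along the imaginary axis indented to the right, by half-circles of radius $\epsilon$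 around its finite imaginary-axis zeros and by one of radius $1/\epsilon$ if $\infty$ is a zero. The phases of $G(s)$ are selected so that $\gamma(G(s))$ is continuous along the upper half of the indented axis and the DC phase center ($\gamma(G(0))$, or $\gamma(G(\epsilon))$ if $0$ is a zero of $G$) is $0$. Put $\overline\phi(G)=\sup_{\omega\in[0,\infty]}\overline\phi(G(j\omega))$, $\underline\phi(G)=\inf_{\omega\in[0,\infty]}\underline\phi(G(j\omega))$. $G$ is semi-sectorial if $[\underline\phi(G),\overline\phi(G)]\subset[\alpha,\beta]$ for some real $\alpha,\beta$ with $\beta-\alpha\le\pi$. A real power signal $u:\mathbb R\to\mathbb R^m$ is the sum of an $L_2$ signal and finitely many periodic signals that are square integrable over a period; $\langle u,y\rangle=\lim_{T\to\infty}\frac1{2T}\int_{-T}^{T}u(t)'y(t)\,dt$ and $\|u\|_{\mathcal P}^2=\langle u,u\rangle$. With $y$ the output of $G$ for the input $u$, and $\boldsymbol Hu(t)=\frac1\pi\,\mathrm{p.v.}\!\int\frac{u(\tau)}{t-\tau}d\tau$ the Hilbert transform, the complex power is $S=\langle u,y\rangle-j\langle\boldsymbol Hu,y\rangle$. **Theorem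 (induced phase in power signal space).** Let $G\in\mathcal{RH}_\infty^{m\times m}$ be semi-sectorial. Then $$\mathrm{cl}\{S:\|u\|_{\mathcal P}=1\}=\mathrm{cl}\,\mathrm{conv}\bigcup_{\omega\in[0,\infty]}W(G(j\omega)),$$ and $$\underline\phi(G)=\inf_{\|u\|_{\mathcal P}=1,\ S\ne0}\angle S,\qquad \overline\phi(G)=\sup_{\|u\|_{\mathcal P}=1,\ S\ne0}\angle S,$$ where $\angle S$ is the argument of $S$ taken in any half-open interval $(c,c+2\pi]$ that contains $[\underline\phi(G),\overline\phi(G)]$. -/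

import Mathlib

open MeasureTheory Filter Topology
open scoped Matrix Kronecker OnePoint

noncomputable section

/-! ### Numerical ranges, semi-sectorial matrices and phases of a matrix -/

/-- The numerical range `W(C) = {x* C x : ‖x‖ = 1}`. -/
def numRange {n : ℕ} (C : Matrix (Fin n) (Fin n) ℂ) : Set ℂ :=
  {z | ∃ x : Fin n → ℂ, star x ⬝ᵥ x = 1 ∧ z = star x ⬝ᵥ (C *ᵥ x)}

/-- The angular numerical range `W'(C) = {x* C x : x ≠ 0}`. -/
def angularNumRange {n : ℕ} (C : Matrix (Fin n) (Fin n) ℂ) : Set ℂ :=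
  {z | ∃ x : Fin n → ℂ, x ≠ 0 ∧ z = star x ⬝ᵥ (C *ᵥ x)}

open Classical in
/-- The field angle: `2π` if `W'(C)` is the whole plane, `π` if it contains exactly one line
through the origin, and the angle subtended by the salient cone `W'(C)` otherwise. -/
def fieldAngle {n : ℕ} (C : Matrix (Fin n) (Fin n) ℂ) : ℝ :=
  if angularNumRange C = Set.univ then 2 * Real.pi
  else if ∃ z : ℂ, z ≠ 0 ∧ ∀ t : ℝ, (t : ℂ) * z ∈ angularNumRange C then Real.pi
  else sSup {a : ℝ | ∃ z ∈ angularNumRange C, ∃ w ∈ angularNumRange C,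
    z ≠ 0 ∧ w ≠ 0 ∧ a = InnerProductGeometry.angle z w}

/-- A matrix is semi-sectorial if its field angle is at most `π`. -/
def IsSemiSectorialMatrix {n : ℕ} (C : Matrix (Fin n) (Fin n) ℂ) : Prop :=
  fieldAngle C ≤ Real.pi

/-- The canonical form `diag (0, D, E)` of the generalized sectorial decomposition, where
`D = diag (e^{jθ₁}, …, e^{jθ_p})` and `E` consists of `q` diagonal blocks
`e^{jθ₀} [1 2; 0 1]`. -/
def sectorialForm (k p q : ℕ) (θ : Fin p → ℝ) (θ₀ : ℝ) :
    Matrix (Fin k ⊕ (Fin p ⊕ (Fin q × Fin 2))) (Fin k ⊕ (Fin p ⊕ (Fin q × Fin 2))) ℂ :=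
  Matrix.fromBlocks 0 0 0
    (Matrix.fromBlocks
      (Matrix.diagonal fun i => Complex.exp (θ i * Complex.I)) 0 0
      ((1 : Matrix (Fin q) (Fin q) ℂ) ⊗ₖ
        (Complex.exp (θ₀ * Complex.I) • !![(1 : ℂ), 2; 0, 1])))

/-- `φ` is a list of phases of the semi-sectorial matrix `C`: there is a generalized sectorial
decomposition `C = T* diag (0, D, E) T` with `T` nonsingular and
`θ₀ - π/2 ≤ θ_i ≤ θ₀ + π/2`, and `φ` consists of the `θ_i` and of one copy of `θ₀ + π/2` and of
`θ₀ - π/2` for each block of `E`. Sectorial, quasi-sectorial and rotated Hermitian matrices are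
the cases without `E`. The phases are determined by `C` and by the choice of their centre. -/
def HasPhases {n : ℕ} (C : Matrix (Fin n) (Fin n) ℂ) (φ : Multiset ℝ) : Prop :=
  ∃ (k p q : ℕ) (θ : Fin p → ℝ) (θ₀ : ℝ) (e : Fin n ≃ Fin k ⊕ (Fin p ⊕ (Fin q × Fin 2)))
    (T : Matrix (Fin n) (Fin n) ℂ),
    IsUnit T ∧
    (∀ i, θ i ∈ Set.Icc (θ₀ - Real.pi / 2) (θ₀ + Real.pi / 2)) ∧
    C = Tᴴ * (sectorialForm k p q θ θ₀).submatrix e e * T ∧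
    φ = Finset.univ.val.map θ + Multiset.replicate q (θ₀ + Real.pi / 2)
      + Multiset.replicate q (θ₀ - Real.pi / 2)

/-- The largest phase in a list of phases, `-∞` if there are none. -/
def phaseMax (φ : Multiset ℝ) : EReal := ⨆ x ∈ φ, (x : EReal)

/-- The smallest phase in a list of phases, `∞` if there are none. -/
def phaseMin (φ : Multiset ℝ) : EReal := ⨅ x ∈ φ, (x : EReal)

/-- The phase centre, the midpoint of the largest and the smallest phase (by convention `0` if
there are no phases, which happens for the zero matrix only). -/
def phaseCenter (φ : Multiset ℝ) : ℝ := ((phaseMax φ).toReal + (phaseMin φ).toReal) / 2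

/-! ### Systems -/

/-- `G` belongs to `RH∞`: every entry is a proper real rational function whose poles are all in
the open left half-plane. -/
def IsRHInf {m : ℕ} (G : Matrix (Fin m) (Fin m) (RatFunc ℝ)) : Prop :=
  ∀ i j, (G i j).num.natDegree ≤ (G i j).denom.natDegree ∧
    ∀ s : ℂ, Polynomial.aeval s (G i j).denom = 0 → s.re < 0

/-- The value `G(∞)` of a proper `G` (the denominator of a `RatFunc` is monic). -/
def feedthrough {m : ℕ} (G : Matrix (Fin m) (Fin m) (RatFunc ℝ)) : Matrix (Fin m) (Fin m) ℝ :=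
  Matrix.of fun i j => (G i j).num.coeff (G i j).denom.natDegree

/-- The value `G(s)` for `s ∈ ℂ ∪ {∞}`. -/
def transferValue {m : ℕ} (G : Matrix (Fin m) (Fin m) (RatFunc ℝ)) :
    OnePoint ℂ → Matrix (Fin m) (Fin m) ℂ
  | none => (feedthrough G).map (fun x => (x : ℂ))
  | some s => Matrix.of fun i j => (G i j).eval (algebraMap ℝ ℂ) s

/-- The point `jω`. -/
def jPoint (ω : ℝ) : ℂ := (ω : ℂ) * Complex.I

/-- The frequencies `jω`, `ω ∈ [0, ∞]`. -/
def nonnegFrequencies : Set (OnePoint ℂ) :=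
  {s | s = ∞ ∨ ∃ ω : ℝ, 0 ≤ ω ∧ s = ((jPoint ω : ℂ) : OnePoint ℂ)}

/-- `s` is a zero of `G`: the rank of `G(s)` is smaller than the normal rank of `G`. -/
def IsZeroAt {m : ℕ} (G : Matrix (Fin m) (Fin m) (RatFunc ℝ)) (s : OnePoint ℂ) : Prop :=
  (transferValue G s).rank < G.rank

/-- The indented imaginary axis: right half-circles of radius `ε` around the finite zeros of `G`
on the imaginary axis, and a right half-circle of radius `1/ε` if `∞` is a zero of `G`. -/
def indentedAxis {m : ℕ} (G : Matrix (Fin m) (Fin m) (RatFunc ℝ)) (ε : ℝ) : Set (OnePoint ℂ) :=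
  {s | (∃ ω : ℝ, s = ((jPoint ω : ℂ) : OnePoint ℂ) ∧
          (∀ ω₀ : ℝ, IsZeroAt G (jPoint ω₀ : ℂ) → ε ≤ |ω - ω₀|) ∧
          (IsZeroAt G ∞ → |ω| ≤ 1 / ε)) ∨
       (∃ z : ℂ, s = (z : OnePoint ℂ) ∧ 0 ≤ z.re ∧
          ∃ ω₀ : ℝ, IsZeroAt G (jPoint ω₀ : ℂ) ∧ ‖z - jPoint ω₀‖ = ε) ∨
       (∃ z : ℂ, s = (z : OnePoint ℂ) ∧ 0 ≤ z.re ∧ IsZeroAt G ∞ ∧ ‖z‖ = 1 / ε) ∨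
       (s = ∞ ∧ ¬ IsZeroAt G ∞)}

/-- The half of the indented imaginary axis in the closed upper half-plane. -/
def upperIndentedAxis {m : ℕ} (G : Matrix (Fin m) (Fin m) (RatFunc ℝ)) (ε : ℝ) :
    Set (OnePoint ℂ) :=
  {s | s ∈ indentedAxis G ε ∧ ∀ z : ℂ, s = (z : OnePoint ℂ) → 0 ≤ z.im}

/-- Frequency-wise semi-sectorial systems. -/
def IsFreqwiseSemiSectorial {m : ℕ} (G : Matrix (Fin m) (Fin m) (RatFunc ℝ)) : Prop :=
  (∀ ω : ℝ, IsSemiSectorialMatrix (transferValue G (jPoint ω : ℂ))) ∧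
  IsSemiSectorialMatrix (transferValue G ∞) ∧
  ∃ εmax : ℝ, 0 < εmax ∧ ∀ ε : ℝ, 0 < ε → ε ≤ εmax →
    (∃ r : ℕ, ∀ s ∈ indentedAxis G ε, (transferValue G s).rank = r) ∧
    ∀ s ∈ indentedAxis G ε, IsSemiSectorialMatrix (transferValue G s)

/-- `Φ` is the phase response of `G`: `Φ s` lists the phases of `G(s)` on the upper half of the
indented imaginary axis, selected so that the phase centre is continuous along it and the DC phase
centre (at `0`, or at `ε` if `0` is a zero of `G`) is `0`; at the frequencies `jω`, `ω ∈ [0, ∞]`,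
that the indented axis avoids, `Φ` lists phases of `G(jω)`. -/
def IsPhaseResponse {m : ℕ} (G : Matrix (Fin m) (Fin m) (RatFunc ℝ))
    (Φ : OnePoint ℂ → Multiset ℝ) : Prop :=
  (∃ εmax : ℝ, 0 < εmax ∧ ∀ ε : ℝ, 0 < ε → ε ≤ εmax →
    (∀ s ∈ upperIndentedAxis G ε, HasPhases (transferValue G s) (Φ s)) ∧
    ContinuousOn (fun s => phaseCenter (Φ s)) (upperIndentedAxis G ε) ∧
    (IsZeroAt G ((0 : ℂ) : OnePoint ℂ) → phaseCenter (Φ (((ε : ℂ)) : OnePoint ℂ)) = 0)) ∧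
  (¬ IsZeroAt G ((0 : ℂ) : OnePoint ℂ) → phaseCenter (Φ ((0 : ℂ) : OnePoint ℂ)) = 0) ∧
  ∀ s ∈ nonnegFrequencies, HasPhases (transferValue G s) (Φ s)

/-- The maximum phase of a system, the supremum over `ω ∈ [0, ∞]`. -/
def maxPhase (Φ : OnePoint ℂ → Multiset ℝ) : EReal :=
  ⨆ s ∈ nonnegFrequencies, phaseMax (Φ s)

/-- The minimum phase of a system, the infimum over `ω ∈ [0, ∞]`. -/
def minPhase (Φ : OnePoint ℂ → Multiset ℝ) : EReal :=
  ⨅ s ∈ nonnegFrequencies, phaseMin (Φ s)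

/-- A frequency-wise semi-sectorial `G` with phase response `Φ` is semi-sectorial if its phase
sector is contained in some `[α, β]` with `β - α ≤ π`. -/
def IsSemiSectorial {m : ℕ} (G : Matrix (Fin m) (Fin m) (RatFunc ℝ))
    (Φ : OnePoint ℂ → Multiset ℝ) : Prop :=
  IsFreqwiseSemiSectorial G ∧ IsPhaseResponse G Φ ∧
  ∃ α β : ℝ, β - α ≤ Real.pi ∧
    Set.Icc (minPhase Φ) (maxPhase Φ) ⊆ Set.Icc (α : EReal) (β : EReal)

/-! ### Power signals and complex power -/

/-- Real power signals: an `L₂` signal plus a finite sum of periodic signals with finite power. -/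
def IsPowerSignal {m : ℕ} (u : ℝ → Fin m → ℝ) : Prop :=
  ∃ (v : ℝ → Fin m → ℝ) (n : ℕ) (T : Fin n → ℝ) (p : Fin n → ℝ → Fin m → ℝ),
    MemLp v 2 volume ∧
    (∀ k, 0 < T k ∧ Function.Periodic (p k) (T k) ∧
      MemLp (p k) 2 (volume.restrict (Set.Ioc 0 (T k)))) ∧
    u = fun t => v t + ∑ k, p k t

/-- The time average `lim_{T → ∞} (1 / 2T) ∫_{-T}^{T} f(t) dt` exists and equals `a`. -/
def HasTimeAverage (f : ℝ → ℝ) (a : ℝ) : Prop :=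
  Tendsto (fun T : ℝ => (2 * T)⁻¹ * ∫ t in (-T)..T, f t) atTop (𝓝 a)

/-- `h` is the Hilbert transform of `u`:
`h(t) = (1/π) p.v. ∫ u(τ) / (t - τ) dτ` for almost every `t`. -/
def IsHilbertTransform {m : ℕ} (u h : ℝ → Fin m → ℝ) : Prop :=
  ∀ᵐ t : ℝ, Tendsto
    (fun q : ℝ × ℝ => Real.pi⁻¹ •
      ∫ τ in {τ : ℝ | q.1 < |t - τ| ∧ |t - τ| < q.2}, (t - τ)⁻¹ • u τ)
    (𝓝[>] (0 : ℝ) ×ˢ atTop) (𝓝 (h t))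

/-- `g` is the (integrable, causal) impulse response of `G ∈ RH∞`, apart from the direct
feedthrough: `G(s) = G(∞) + ∫_0^∞ g(t) e^{-st} dt` on the closed right half-plane. -/
def IsImpulseResponse {m : ℕ} (G : Matrix (Fin m) (Fin m) (RatFunc ℝ))
    (g : ℝ → Matrix (Fin m) (Fin m) ℝ) : Prop :=
  ∀ i j, IntegrableOn (fun t => g t i j) (Set.Ioi 0) ∧
    ∀ s : ℂ, 0 ≤ s.re →
      transferValue G (s : OnePoint ℂ) i j = (feedthrough G i j : ℂ) +
        ∫ t in Set.Ioi (0 : ℝ), ((g t i j : ℝ) : ℂ) * Complex.exp (-(s * t))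

/-- `y` is the response of the linear time-invariant system `G` to the input `u`:
`y(t) = G(∞) u(t) + ∫_0^∞ g(τ) u(t - τ) dτ` for almost every `t`. -/
def IsResponse {m : ℕ} (G : Matrix (Fin m) (Fin m) (RatFunc ℝ)) (u y : ℝ → Fin m → ℝ) : Prop :=
  ∃ g : ℝ → Matrix (Fin m) (Fin m) ℝ, IsImpulseResponse G g ∧
    ∀ᵐ t : ℝ, y t = feedthrough G *ᵥ u t + ∫ τ in Set.Ioi (0 : ℝ), g τ *ᵥ u (t - τ)

/-- The set of complex powers `S = P + jQ`, with `P = ⟨u, y⟩` and `Q = -⟨H u, y⟩`, produced by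
`G` for power signals `u` with `‖u‖_P = 1`. -/
def complexPowers {m : ℕ} (G : Matrix (Fin m) (Fin m) (RatFunc ℝ)) : Set ℂ :=
  {S | ∃ u h y : ℝ → Fin m → ℝ,
    IsPowerSignal u ∧ HasTimeAverage (fun t => u t ⬝ᵥ u t) 1 ∧
    IsHilbertTransform u h ∧ IsResponse G u y ∧
    HasTimeAverage (fun t => u t ⬝ᵥ y t) S.re ∧
    HasTimeAverage (fun t => h t ⬝ᵥ y t) (-S.im)}

/-- The argument of `S` in the interval `(c, c + 2π]`. -/
def argFrom (c : ℝ) (S : ℂ) : ℝ := toIocMod Real.two_pi_pos c S.arg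

end

/-!
# The induced phase in the power signal space

For a trigonometric input `u(t) = Re ∑ c(ω) e^{jωt}` over finitely many `ω ≥ 0`, `c(0)` real, the
Hilbert transform is `Im ∑ c(ω) e^{jωt}`, the output is `Re ∑ G(jω) c(ω) e^{jωt}`, and distinct
frequencies are orthogonal. Hence the complex power is `∑ w(ω) c(ω)* G(jω) c(ω)`, with weight `1/2`
for `ω > 0` and `1` for `ω = 0`, while `‖u‖² = ∑ w(ω) ‖c(ω)‖²`. If `‖u‖ = 1` this is a convex
combination of elements of the numerical ranges `W(G(jω))`.

* The inclusion of the complex powers in the closed convex hull (`complexPowers_subset`) follows by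
  approximation. The power seminorm alone does not control limits of signals, so the error is
  measured by bounds `a L + b` for the energy on all windows of length `L` (`WindowBound`). Such
  bounds pass to almost everywhere limits, to convolutions with integrable kernels by Young's
  inequality (`WindowBound.convolution`), and to truncated Hilbert transforms of periodic and of
  `L₂` functions, uniformly in the truncation: by Parseval's identity this amounts to a bound for
  the Fourier transforms of the truncated kernels, which are differences of sine integrals
  (`norm_integral_hilbertKernel_le`). An `L₂` signal satisfies the bound with `a = 0`, and a
  periodic one is approximated by the partial sums of its Fourier series, so that the input, its
  Hilbert transform and the output are simultaneously close to those of a trigonometric signal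
  (`exists_trig_approx`).
* Conversely (`convexHull_subset_closure_complexPowers`), a convex combination of values
  `x_k* G(s_k) x_k` is approximated by the complex power of a sum of sinusoids, with amplitudes
  `√(2 w_k) x_k`, at distinct positive frequencies near the `s_k`. This uses that `G(jω)` is
  continuous up to `ω = ∞`, which holds as a stable proper `G` has an integrable impulse response
  (`IsRHInf.exists_isImpulseResponse`).

The statement about the phases only depends on this identity of closures
(`phase_sector_of_closure_eq`). Indeed a closed sector `[α, β]` with `β - α ≤ π` is a convex cone; it
contains `W(C)` if it contains the phases of `C`, and conversely the directions of the phases of `C`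
belong to every closed cone that contains `W(C)`.
-/

noncomputable section

open scoped NNReal ENNReal


/-! ### Closed sectors of the plane -/

/-- The closed convex cone of the complex numbers `r e^{jθ}` with `r ≥ 0` and `α ≤ θ ≤ β`, for
`β - α ≤ π`, as an intersection of three half-planes. The third one, which is the half-plane around
the bisector, only matters if `α = β`. -/
def phaseCone (α β : ℝ) : Set ℂ :=
  {z | 0 ≤ z.im * Real.cos α - z.re * Real.sin α ∧ z.im * Real.cos β - z.re * Real.sin β ≤ 0 ∧
    0 ≤ z.re * Real.cos ((α + β) / 2) + z.im * Real.sin ((α + β) / 2)}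

theorem isClosed_phaseCone (α β : ℝ) : IsClosed (phaseCone α β) := by
  have h1 : IsClosed {z : ℂ | 0 ≤ z.im * Real.cos α - z.re * Real.sin α} :=
    isClosed_le (by fun_prop) (by fun_prop)
  have h2 : IsClosed {z : ℂ | z.im * Real.cos β - z.re * Real.sin β ≤ 0} :=
    isClosed_le (by fun_prop) (by fun_prop)
  have h3 : IsClosed {z : ℂ |
      0 ≤ z.re * Real.cos ((α + β) / 2) + z.im * Real.sin ((α + β) / 2)} :=
    isClosed_le (by fun_prop) (by fun_prop)
  exact h1.inter (h2.inter h3)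

theorem phaseCone_add {α β : ℝ} {z w : ℂ} (hz : z ∈ phaseCone α β) (hw : w ∈ phaseCone α β) :
    z + w ∈ phaseCone α β := by
  obtain ⟨h1, h2, h3⟩ := hz
  obtain ⟨k1, k2, k3⟩ := hw
  refine ⟨?_, ?_, ?_⟩ <;> simp only [Complex.add_re, Complex.add_im, add_mul] <;> linarith

theorem phaseCone_smul {α β : ℝ} {z : ℂ} {r : ℝ} (hr : 0 ≤ r) (hz : z ∈ phaseCone α β) :
    (r : ℂ) * z ∈ phaseCone α β := by
  obtain ⟨h1, h2, h3⟩ := hz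
  refine ⟨?_, ?_, ?_⟩ <;> simp only [Complex.re_ofReal_mul, Complex.im_ofReal_mul]
  · nlinarith [mul_nonneg hr h1]
  · nlinarith [mul_nonneg hr (neg_nonneg.2 h2)]
  · nlinarith [mul_nonneg hr h3]

theorem zero_mem_phaseCone (α β : ℝ) : (0 : ℂ) ∈ phaseCone α β := by
  simp [phaseCone]

theorem convex_phaseCone (α β : ℝ) : Convex ℝ (phaseCone α β) := by
  intro z hz w hw a b ha hb _
  simpa using phaseCone_add (phaseCone_smul ha hz) (phaseCone_smul hb hw)

theorem phaseCone_sum {α β : ℝ} {ι : Type*} (s : Finset ι) (f : ι → ℂ)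
    (h : ∀ i ∈ s, f i ∈ phaseCone α β) : ∑ i ∈ s, f i ∈ phaseCone α β :=
  Finset.sum_induction _ (· ∈ phaseCone α β) (fun _ _ => phaseCone_add) (zero_mem_phaseCone α β) h

theorem exp_mem_phaseCone_iff {α β θ : ℝ} :
    Complex.exp (θ * Complex.I) ∈ phaseCone α β ↔
      0 ≤ Real.sin (θ - α) ∧ Real.sin (θ - β) ≤ 0 ∧ 0 ≤ Real.cos (θ - (α + β) / 2) := by
  simp only [phaseCone, Set.mem_ofPred_eq, Complex.exp_ofReal_mul_I_re, Complex.exp_ofReal_mul_I_im,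
    Real.sin_sub, Real.cos_sub]

theorem exp_mem_phaseCone {α β θ : ℝ} (h : β - α ≤ Real.pi) (h1 : α ≤ θ) (h2 : θ ≤ β) :
    Complex.exp (θ * Complex.I) ∈ phaseCone α β := by
  rw [exp_mem_phaseCone_iff]
  refine ⟨Real.sin_nonneg_of_nonneg_of_le_pi (by linarith) (by linarith),
    Real.sin_nonpos_of_nonpos_of_neg_pi_le (by linarith) (by linarith),
    Real.cos_nonneg_of_neg_pi_div_two_le_of_le (by linarith) (by linarith)⟩

/-- An angle at most `π` away from the bisector that belongs to the sector lies in `[α, β]`. -/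
theorem mem_Icc_of_exp_mem_phaseCone {α β θ : ℝ} (hab : α ≤ β)
    (h1 : |θ - (α + β) / 2| ≤ Real.pi) (h : Complex.exp (θ * Complex.I) ∈ phaseCone α β) :
    θ ∈ Set.Icc α β := by
  rw [exp_mem_phaseCone_iff] at h
  obtain ⟨k1, k2, k3⟩ := h
  have hpi := Real.pi_pos
  rw [abs_le] at h1
  have h5 : |θ - (α + β) / 2| ≤ Real.pi / 2 := by
    by_contra hcon
    rw [not_le] at hcon
    have : Real.cos |θ - (α + β) / 2| < 0 :=
      Real.cos_neg_of_pi_div_two_lt_of_lt hcon (by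
        have := abs_le.2 h1
        linarith)
    rw [Real.cos_abs] at this
    linarith
  rw [abs_le] at h5
  constructor
  · by_contra hcon
    rw [not_le] at hcon
    have := Real.sin_neg_of_neg_of_neg_pi_lt (x := θ - α) (by linarith) (by linarith)
    linarith
  · by_contra hcon
    rw [not_le] at hcon
    have := Real.sin_pos_of_pos_of_lt_pi (x := θ - β) (by linarith) (by linarith)
    linarith

theorem exists_angle_of_mem_phaseCone {α β : ℝ} (hab : α ≤ β) {z : ℂ} (hz : z ∈ phaseCone α β)
    (hz0 : z ≠ 0) : ∃ θ ∈ Set.Icc α β, z = ‖z‖ * Complex.exp (θ * Complex.I) := by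
  obtain ⟨θ, hθ, hzθ⟩ : ∃ θ : ℝ, |θ - (α + β) / 2| ≤ Real.pi ∧
      z = ‖z‖ * Complex.exp (θ * Complex.I) := by
    obtain ⟨n, hn⟩ : ∃ n : ℤ, toIocMod Real.two_pi_pos ((α + β) / 2 - Real.pi) z.arg =
        z.arg - n * (2 * Real.pi) :=
      ⟨toIocDiv Real.two_pi_pos ((α + β) / 2 - Real.pi) z.arg, by
        rw [← self_sub_toIocDiv_zsmul]; simp⟩
    have hm := toIocMod_mem_Ioc Real.two_pi_pos ((α + β) / 2 - Real.pi) z.arg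
    refine ⟨toIocMod Real.two_pi_pos ((α + β) / 2 - Real.pi) z.arg, ?_, ?_⟩
    · rw [abs_le]; constructor <;> linarith [hm.1, hm.2]
    · rw [hn]
      conv_lhs => rw [← Complex.norm_mul_exp_arg_mul_I z]
      congr 1
      rw [Complex.exp_eq_exp_iff_exists_int]
      exact ⟨n, by push_cast; ring⟩
  refine ⟨θ, mem_Icc_of_exp_mem_phaseCone hab hθ ?_, hzθ⟩
  have hpos : 0 < ‖z‖ := norm_pos_iff.2 hz0
  have : Complex.exp (θ * Complex.I) = ((‖z‖⁻¹ : ℝ) : ℂ) * z := by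
    conv_rhs => rw [hzθ]
    push_cast
    have : (‖z‖ : ℂ) ≠ 0 := by exact_mod_cast hpos.ne'
    rw [← mul_assoc]
    simp [this]
  rw [this]
  exact phaseCone_smul (by positivity) hz

theorem argFrom_eq {c θ r : ℝ} (hr : 0 < r) (h : θ ∈ Set.Ioc c (c + 2 * Real.pi)) :
    argFrom c (r * Complex.exp (θ * Complex.I)) = θ := by
  unfold argFrom
  rw [Complex.arg_real_mul _ hr, Complex.arg_exp_mul_I]
  rw [toIocMod_eq_iff]
  refine ⟨h, -toIocDiv Real.two_pi_pos (-Real.pi) θ, ?_⟩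
  rw [← self_sub_toIocDiv_zsmul, neg_smul]
  ring

theorem argFrom_mem_of_mem_phaseCone {c α β : ℝ} (hab : α ≤ β) (hc : c < α)
    (hc' : β ≤ c + 2 * Real.pi) {z : ℂ} (hz : z ∈ phaseCone α β) (hz0 : z ≠ 0) :
    argFrom c z ∈ Set.Icc α β ∧ z = ‖z‖ * Complex.exp (argFrom c z * Complex.I) := by
  obtain ⟨θ, hθ, h⟩ := exists_angle_of_mem_phaseCone hab hz hz0
  have : argFrom c z = θ := by
    rw [h]
    exact argFrom_eq (norm_pos_iff.2 hz0) ⟨by linarith [hθ.1], by linarith [hθ.2]⟩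
  rw [this]
  exact ⟨hθ, h⟩

/-! ### The numerical range and the phases of a matrix -/

theorem star_dotProduct_self_eq {n : ℕ} (x : Fin n → ℂ) :
    star x ⬝ᵥ x = ((∑ i, ‖x i‖ ^ 2 : ℝ) : ℂ) := by
  simp only [dotProduct, Pi.star_apply, Complex.ofReal_sum]
  exact Finset.sum_congr rfl fun i _ => by
    rw [Complex.star_def, ← Complex.normSq_eq_conj_mul_self, Complex.normSq_eq_norm_sq]

theorem sum_norm_sq_pos {n : ℕ} {x : Fin n → ℂ} (hx : x ≠ 0) : 0 < ∑ i, ‖x i‖ ^ 2 := by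
  obtain ⟨i, hi⟩ := Function.ne_iff.1 hx
  refine Finset.sum_pos' (fun _ _ => by positivity) ⟨i, Finset.mem_univ _, ?_⟩
  have : 0 < ‖x i‖ := norm_pos_iff.2 hi
  positivity

theorem exists_mem_numRange_of_ne_zero {n : ℕ} (C : Matrix (Fin n) (Fin n) ℂ) {x : Fin n → ℂ}
    (hx : x ≠ 0) : ∃ z ∈ numRange C,
      star x ⬝ᵥ (C *ᵥ x) = ((∑ i, ‖x i‖ ^ 2 : ℝ) : ℂ) * z := by
  have hpos := sum_norm_sq_pos hx
  have hnn := star_dotProduct_self_eq x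
  set N := ∑ i, ‖x i‖ ^ 2
  have hs : (Real.sqrt N : ℂ) * (Real.sqrt N : ℂ) = N := by
    rw [← Complex.ofReal_mul, Real.mul_self_sqrt hpos.le]
  have hs0 : (Real.sqrt N : ℂ) ≠ 0 := by
    exact_mod_cast (Real.sqrt_pos.2 hpos).ne'
  refine ⟨_, ⟨((Real.sqrt N)⁻¹ : ℂ) • x, ?_, rfl⟩, ?_⟩
  · rw [star_smul, smul_dotProduct, dotProduct_smul, hnn]
    simp only [smul_eq_mul, Complex.star_def, map_inv₀, Complex.conj_ofReal]
    rw [← hs]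
    field_simp
  · rw [Matrix.mulVec_smul, star_smul, smul_dotProduct, dotProduct_smul]
    simp only [smul_eq_mul, Complex.star_def, map_inv₀, Complex.conj_ofReal]
    rw [← hs]
    field_simp

theorem star_dotProduct_sectorialForm {k p q : ℕ} (θ : Fin p → ℝ) (θ₀ : ℝ)
    (y : Fin k ⊕ (Fin p ⊕ (Fin q × Fin 2)) → ℂ) :
    star y ⬝ᵥ (sectorialForm k p q θ θ₀ *ᵥ y) =
      (∑ i, ((‖y (.inr (.inl i))‖ ^ 2 : ℝ) : ℂ) * Complex.exp (θ i * Complex.I)) +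
      ∑ j, Complex.exp (θ₀ * Complex.I) *
        (star (y (.inr (.inr (j, 0)))) * y (.inr (.inr (j, 0))) +
          star (y (.inr (.inr (j, 1)))) * y (.inr (.inr (j, 1))) +
          2 * (star (y (.inr (.inr (j, 0)))) * y (.inr (.inr (j, 1))))) := by
  have key : ∀ z : ℂ, ((‖z‖ ^ 2 : ℝ) : ℂ) = star z * z := fun z => by
    rw [Complex.star_def, ← Complex.normSq_eq_conj_mul_self, Complex.normSq_eq_norm_sq]
  simp only [dotProduct, Fintype.sum_sum_type, sectorialForm, Matrix.mulVec,
    Matrix.fromBlocks_apply₁₁, Matrix.fromBlocks_apply₁₂, Matrix.fromBlocks_apply₂₁,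
    Matrix.fromBlocks_apply₂₂, Matrix.zero_apply, zero_mul, Finset.sum_const_zero, add_zero,
    zero_add, mul_zero, Matrix.diagonal_apply, ite_mul, Finset.sum_ite_eq, Finset.mem_univ,
    if_true, Fintype.sum_prod_type, Matrix.kroneckerMap_apply, Matrix.one_apply, Fin.sum_univ_two,
    Finset.sum_add_distrib, Pi.star_apply, key]
  congr 1
  · exact Finset.sum_congr rfl fun i _ => by ring
  · simp only [← Finset.sum_add_distrib]
    refine Finset.sum_congr rfl fun j _ => ?_
    simp
    ring

/-- The value of the quadratic form of a block `e^{jθ₀} [1 2; 0 1]` lies in the half-plane around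
`e^{jθ₀}`. -/
theorem re_two_block_nonneg (a b : ℂ) :
    0 ≤ (star a * a + star b * b + 2 * (star a * b)).re := by
  simp only [Complex.star_def, Complex.add_re, Complex.mul_re, Complex.conj_re, Complex.conj_im,
    Complex.re_ofNat, Complex.im_ofNat]
  nlinarith [sq_nonneg (a.re + b.re), sq_nonneg (a.im + b.im)]

/-- The numerical range lies in every sector that contains the phases, since the quadratic form of
`T* diag (0, D, E) T` is a sum of the quadratic forms of the blocks of the canonical form. -/
theorem numRange_subset_phaseCone {n : ℕ} {C : Matrix (Fin n) (Fin n) ℂ} {φ : Multiset ℝ}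
    (hC : HasPhases C φ) {α β : ℝ} (hαβ : β - α ≤ Real.pi) (hφ : ∀ x ∈ φ, x ∈ Set.Icc α β) :
    numRange C ⊆ phaseCone α β := by
  obtain ⟨k, p, q, θ, θ₀, e, T, -, hθ, rfl, rfl⟩ := hC
  rintro _ ⟨x, -, rfl⟩
  have h1 : star x ⬝ᵥ ((Tᴴ * (sectorialForm k p q θ θ₀).submatrix e e * T) *ᵥ x) =
      star ((T *ᵥ x) ∘ e.symm) ⬝ᵥ (sectorialForm k p q θ θ₀ *ᵥ ((T *ᵥ x) ∘ e.symm)) := by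
    rw [← Matrix.mulVec_mulVec, ← Matrix.mulVec_mulVec, Matrix.dotProduct_mulVec,
      ← Matrix.star_mulVec]
    simp only [Matrix.submatrix_mulVec_equiv]
    simp only [dotProduct, Function.comp_apply, Pi.star_apply]
    exact Fintype.sum_equiv e _ _ (fun i => by simp)
  rw [h1, star_dotProduct_sectorialForm]
  refine phaseCone_add (phaseCone_sum _ _ fun i _ => phaseCone_smul (by positivity) ?_)
    (phaseCone_sum _ _ fun j _ => ?_)
  · have := hφ (θ i) (by simp)
    exact exp_mem_phaseCone hαβ this.1 this.2
  · -- a block of `E` forces the sector to be the half-plane around `θ₀`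
    have hq : q ≠ 0 := by rintro rfl; exact j.elim0
    have u1 := hφ (θ₀ + Real.pi / 2) (by simp [Multiset.mem_replicate, hq])
    have u2 := hφ (θ₀ - Real.pi / 2) (by simp [Multiset.mem_replicate, hq])
    have hβ : β = θ₀ + Real.pi / 2 := by linarith [u1.2, u2.1]
    have hα : α = θ₀ - Real.pi / 2 := by linarith [u1.2, u2.1]
    have hre := re_two_block_nonneg (((T *ᵥ x) ∘ e.symm) (.inr (.inr (j, 0))))
      (((T *ᵥ x) ∘ e.symm) (.inr (.inr (j, 1))))
    generalize star (((T *ᵥ x) ∘ e.symm) (.inr (.inr (j, 0)))) *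
      ((T *ᵥ x) ∘ e.symm) (.inr (.inr (j, 0))) +
      star (((T *ᵥ x) ∘ e.symm) (.inr (.inr (j, 1)))) *
      ((T *ᵥ x) ∘ e.symm) (.inr (.inr (j, 1))) +
      2 * (star (((T *ᵥ x) ∘ e.symm) (.inr (.inr (j, 0)))) *
      ((T *ᵥ x) ∘ e.symm) (.inr (.inr (j, 1)))) = z at hre
    have hm : (α + β) / 2 = θ₀ := by rw [hα, hβ]; ring
    have hsc := Real.sin_sq_add_cos_sq θ₀
    have hz : z.re * (Real.sin θ₀ ^ 2 + Real.cos θ₀ ^ 2) = z.re := by rw [hsc, mul_one]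
    refine ⟨?_, ?_, ?_⟩
    · rw [hα, Real.cos_sub_pi_div_two, Real.sin_sub_pi_div_two]
      simp only [Complex.mul_re, Complex.mul_im, Complex.exp_ofReal_mul_I_re,
        Complex.exp_ofReal_mul_I_im]
      nlinarith
    · rw [hβ, Real.cos_add_pi_div_two, Real.sin_add_pi_div_two]
      simp only [Complex.mul_re, Complex.mul_im, Complex.exp_ofReal_mul_I_re,
        Complex.exp_ofReal_mul_I_im]
      nlinarith
    · rw [hm]
      simp only [Complex.mul_re, Complex.mul_im, Complex.exp_ofReal_mul_I_re,
        Complex.exp_ofReal_mul_I_im]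
      nlinarith

/-- A closed cone that contains the numerical range contains the directions of all phases. The
phases `θ₀ ± π/2` of a block `e^{jθ₀} [1 2; 0 1]` are limits of directions `e^{jθ₀} (t ± 2j)`. -/
theorem exp_mem_of_numRange_subset {n : ℕ} {C : Matrix (Fin n) (Fin n) ℂ} {φ : Multiset ℝ}
    (hC : HasPhases C φ) {K : Set ℂ} (hK : IsClosed K)
    (hK' : ∀ (r : ℝ) (z : ℂ), 0 ≤ r → z ∈ K → (r : ℂ) * z ∈ K) (h : numRange C ⊆ K)
    {x : ℝ} (hx : x ∈ φ) : Complex.exp (x * Complex.I) ∈ K := by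
  obtain ⟨k, p, q, θ, θ₀, e, T, hT, hθ, rfl, rfl⟩ := hC
  have hy : ∀ y : Fin k ⊕ (Fin p ⊕ (Fin q × Fin 2)) → ℂ, y ≠ 0 →
      star y ⬝ᵥ (sectorialForm k p q θ θ₀ *ᵥ y) ∈ K := by
    intro y hy
    obtain ⟨x, hx⟩ : ∃ x, T *ᵥ x = y ∘ e := by
      refine ⟨T⁻¹ *ᵥ (y ∘ e), ?_⟩
      rw [Matrix.mulVec_mulVec, Matrix.mul_nonsing_inv _ ((Matrix.isUnit_iff_isUnit_det _).1 hT),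
        Matrix.one_mulVec]
    have hx0 : x ≠ 0 := by
      rintro rfl
      apply hy
      rw [Matrix.mulVec_zero] at hx
      ext i
      have := congrFun hx (e.symm i)
      simpa using this.symm
    have h1 : star x ⬝ᵥ ((Tᴴ * (sectorialForm k p q θ θ₀).submatrix e e * T) *ᵥ x) =
        star y ⬝ᵥ (sectorialForm k p q θ θ₀ *ᵥ y) := by
      rw [← Matrix.mulVec_mulVec, ← Matrix.mulVec_mulVec, Matrix.dotProduct_mulVec,
        ← Matrix.star_mulVec, hx]
      simp only [Matrix.submatrix_mulVec_equiv]
      simp only [dotProduct, Function.comp_apply, Pi.star_apply]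
      exact Fintype.sum_equiv e _ _ (fun i => by simp [Function.comp_def])
    obtain ⟨z, hz, hzx⟩ := exists_mem_numRange_of_ne_zero
      (Tᴴ * (sectorialForm k p q θ θ₀).submatrix e e * T) hx0
    rw [← h1, hzx]
    exact hK' _ z (by positivity) (h hz)
  -- evaluate the form at the vector with entries `1` and `-1 + jt` at a block of `E`
  have hE : ∀ j : Fin q, ∀ t : ℝ,
      Complex.exp (θ₀ * Complex.I) * (t ^ 2 + 2 * t * Complex.I) ∈ K := by
    intro j t
    have := hy (Function.update (Function.update 0 (.inr (.inr (j, 0))) 1)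
      (.inr (.inr (j, 1))) (-1 + t * Complex.I)) (by
        intro h0
        have := congrFun h0 (.inr (.inr (j, 0)))
        simp at this)
    rw [star_dotProduct_sectorialForm] at this
    convert this using 1
    rw [Finset.sum_eq_zero, zero_add, Finset.sum_eq_single j]
    · simp
      ring_nf
      simp
    · intro b _ hb
      simp [hb]
    · simp
    · intro i _
      simp
  have hlim : ∀ j : Fin q, ∀ σ : ℝ, σ ^ 2 = 1 →
      Complex.exp (θ₀ * Complex.I) * (σ * Complex.I) ∈ K := by
    intro j σ hσ
    have ht : Tendsto (fun t : ℝ => Complex.exp (θ₀ * Complex.I) * (t + σ * Complex.I))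
        (𝓝[>] 0) (𝓝 (Complex.exp (θ₀ * Complex.I) * (σ * Complex.I))) := by
      have : Continuous fun t : ℝ => Complex.exp (θ₀ * Complex.I) * (t + σ * Complex.I) := by
        fun_prop
      have h0 := this.tendsto 0
      simp only [Complex.ofReal_zero, zero_add] at h0
      exact h0.mono_left nhdsWithin_le_nhds
    refine hK.mem_of_tendsto ht ?_
    filter_upwards [self_mem_nhdsWithin] with t ht
    have ht : 0 < t := ht
    -- rescaling `(2σt)² + 2 (2σt) j = 4t (t + σj)`
    have := hK' (1 / (4 * t)) _ (by positivity) (hE j (2 * σ * t))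
    convert this using 1
    have htc : (t : ℂ) ≠ 0 := by exact_mod_cast ht.ne'
    have hσc : (σ : ℂ) ^ 2 = 1 := by exact_mod_cast hσ
    push_cast
    field_simp
    linear_combination (-4 * (t : ℂ)) * hσc
  simp only [Multiset.mem_add, Multiset.mem_map, Multiset.mem_replicate] at hx
  rcases hx with (⟨i, -, rfl⟩ | ⟨hq, rfl⟩) | ⟨hq, rfl⟩
  · have := hy (Function.update 0 (.inr (.inl i)) 1) (by
      intro h0
      have := congrFun h0 (.inr (.inl i))
      simp at this)
    rw [star_dotProduct_sectorialForm] at this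
    convert this using 1
    rw [Finset.sum_eq_single i, Finset.sum_eq_zero]
    · simp
    · intro j _
      simp
    · intro b _ hb
      simp [hb]
    · simp
  · have := hlim ⟨0, Nat.pos_of_ne_zero hq⟩ 1 (by norm_num)
    convert this using 1
    push_cast
    rw [add_mul, Complex.exp_add, Complex.exp_pi_div_two_mul_I]
    ring
  · have := hlim ⟨0, Nat.pos_of_ne_zero hq⟩ (-1) (by norm_num)
    convert this using 1
    push_cast
    rw [sub_mul, Complex.exp_sub, Complex.exp_pi_div_two_mul_I, div_eq_mul_inv, Complex.inv_I]
    ring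

/-! ### The phase sector of a set of complex powers -/

/-- If `A` is dense in the closed convex hull of the numerical ranges, then the arguments of its
non-zero elements span exactly the phase sector. Closed convex cones, and hence sectors `[α, β]` with
`β - α ≤ π`, contain `A` if and only if they contain all the numerical ranges, and thus all the
directions of phases. -/
theorem phase_sector_of_closure_eq {m : ℕ} {G : Matrix (Fin m) (Fin m) (RatFunc ℝ)}
    {Φ : OnePoint ℂ → Multiset ℝ}
    (hΦ : ∀ s ∈ nonnegFrequencies, HasPhases (transferValue G s) (Φ s)) {α β : ℝ}
    (hαβ : β - α ≤ Real.pi)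
    (hI : Set.Icc (minPhase Φ) (maxPhase Φ) ⊆ Set.Icc (α : EReal) (β : EReal)) {A : Set ℂ}
    (hA : closure A = closure (convexHull ℝ
      (⋃ s ∈ nonnegFrequencies, numRange (transferValue G s)))) {c : ℝ}
    (hc : Set.Icc (minPhase Φ) (maxPhase Φ) ⊆
      Set.Ioc (c : EReal) ((c + 2 * Real.pi : ℝ) : EReal)) :
    minPhase Φ = (⨅ S ∈ {S : ℂ | S ∈ A ∧ S ≠ 0}, (argFrom c S : EReal)) ∧
    maxPhase Φ = (⨆ S ∈ {S : ℂ | S ∈ A ∧ S ≠ 0}, (argFrom c S : EReal)) := by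
  have hsub : ∀ K : Set ℂ, IsClosed K → Convex ℝ K →
      (∀ s ∈ nonnegFrequencies, numRange (transferValue G s) ⊆ K) → A ⊆ K := by
    intro K hK hK' h
    refine subset_closure.trans (hA.trans_subset ?_)
    exact closure_minimal (convexHull_min (Set.iUnion₂_subset h) hK') hK
  have hsup : ∀ K : Set ℂ, IsClosed K → A ⊆ K →
      ∀ s ∈ nonnegFrequencies, numRange (transferValue G s) ⊆ K := by
    intro K hK h s hs
    refine (Set.subset_biUnion_of_mem (u := fun s => numRange (transferValue G s)) hs).trans ?_
    exact ((subset_convexHull ℝ _).trans subset_closure).trans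
      (hA.symm.trans_subset (closure_minimal h hK))
  have hmax : ∀ s ∈ nonnegFrequencies, ∀ x ∈ Φ s, (x : EReal) ≤ maxPhase Φ := fun s hs x hx =>
    (le_iSup₂ (f := fun (x : ℝ) (_ : x ∈ Φ s) => (x : EReal)) x hx).trans
      (le_iSup₂ (f := fun s (_ : s ∈ nonnegFrequencies) => phaseMax (Φ s)) s hs)
  have hmin : ∀ s ∈ nonnegFrequencies, ∀ x ∈ Φ s, minPhase Φ ≤ (x : EReal) := fun s hs x hx =>
    (iInf₂_le (f := fun s (_ : s ∈ nonnegFrequencies) => phaseMin (Φ s)) s hs).trans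
      (iInf₂_le (f := fun (x : ℝ) (_ : x ∈ Φ s) => (x : EReal)) x hx)
  by_cases hne : ∃ s ∈ nonnegFrequencies, ∃ x, x ∈ Φ s
  · obtain ⟨s₀, hs₀, x₀, hx₀⟩ := hne
    have hle : minPhase Φ ≤ maxPhase Φ := (hmin s₀ hs₀ x₀ hx₀).trans (hmax s₀ hs₀ x₀ hx₀)
    have i1 := hI ⟨le_rfl, hle⟩
    have i2 := hI ⟨hle, le_rfl⟩
    have c1 := hc ⟨le_rfl, hle⟩
    have c2 := hc ⟨hle, le_rfl⟩
    have real_of : ∀ y : EReal, y ∈ Set.Icc (α : EReal) (β : EReal) → ∃ r : ℝ, y = r := by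
      intro y hy
      refine ⟨y.toReal, (EReal.coe_toReal ?_ ?_).symm⟩
      · rintro rfl; exact absurd hy.2 (by simp)
      · rintro rfl; exact absurd hy.1 (by simp)
    obtain ⟨a, ha⟩ := real_of _ i1
    obtain ⟨b, hb⟩ := real_of _ i2
    rw [ha] at i1 c1 hle
    rw [hb] at i2 c2 hle
    rw [ha] at hmin
    rw [hb] at hmax
    simp only [Set.mem_Icc, Set.mem_Ioc, EReal.coe_le_coe_iff, EReal.coe_lt_coe_iff]
      at i1 i2 c1 c2 hle hmin hmax
    have hba : b - a ≤ Real.pi := by linarith [i1.1, i2.2]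
    have hAK : A ⊆ phaseCone a b := hsub _ (isClosed_phaseCone a b) (convex_phaseCone a b)
      fun s hs => numRange_subset_phaseCone (hΦ s hs) hba fun x hx => ⟨hmin s hs x hx, hmax s hs x hx⟩
    have harg : ∀ S ∈ A, S ≠ 0 → argFrom c S ∈ Set.Icc a b ∧
        S = ‖S‖ * Complex.exp (argFrom c S * Complex.I) := fun S hS hS0 =>
      argFrom_mem_of_mem_phaseCone hle c1.1 c2.2 (hAK hS) hS0
    -- directions of phases cannot leave a smaller sector that contains `A`
    have hfin : ∀ a' b' : ℝ, b' - a' ≤ Real.pi → (∀ S ∈ A, S ≠ 0 → argFrom c S ∈ Set.Icc a' b') →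
        ∀ s ∈ nonnegFrequencies, ∀ x ∈ Φ s, a ≤ a' → b' ≤ b → x ∈ Set.Icc a' b' := by
      intro a' b' hab' h s hs x hx haa hbb
      have hAne : ∃ S ∈ A, S ≠ 0 := by
        by_contra! hcon
        have h0 := hsup {0} isClosed_singleton (fun S hS => hcon S hS) s hs
        have := exp_mem_of_numRange_subset (hΦ s hs) isClosed_singleton
          (by rintro r z - rfl; simp) h0 hx
        exact Complex.exp_ne_zero _ this
      obtain ⟨S₀, hS₀, hS₀'⟩ := hAne
      have h1 := h S₀ hS₀ hS₀'
      have hab : a' ≤ b' := h1.1.trans h1.2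
      have hAK' : A ⊆ phaseCone a' b' := by
        intro S hS
        by_cases hS0 : S = 0
        · rw [hS0]; exact zero_mem_phaseCone _ _
        · rw [(harg S hS hS0).2]
          have := h S hS hS0
          exact phaseCone_smul (norm_nonneg _) (exp_mem_phaseCone hab' this.1 this.2)
      have h2 := exp_mem_of_numRange_subset (hΦ s hs) (isClosed_phaseCone a' b')
        (fun r z hr hz => phaseCone_smul hr hz)
        (hsup _ (isClosed_phaseCone a' b') hAK' s hs) hx
      refine mem_Icc_of_exp_mem_phaseCone hab ?_ h2
      have := hmin s hs x hx
      have := hmax s hs x hx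
      rw [abs_le]
      constructor <;> linarith
    constructor
    · refine le_antisymm (le_iInf₂ fun S hS => ?_) (le_iInf₂ fun s hs => le_iInf₂ fun x hx => ?_)
      · rw [ha]
        exact_mod_cast (harg S hS.1 hS.2).1.1
      · by_contra hcon
        rw [not_le, EReal.lt_iff_exists_real_btwn] at hcon
        obtain ⟨a', h1, h2⟩ := hcon
        have h1 : x < a' := by exact_mod_cast h1
        have hxa := hmin s hs x hx
        have := hfin a' b (by linarith) (fun S hS hS0 => ⟨?_, (harg S hS hS0).1.2⟩) s hs x hx
          (by linarith) le_rfl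
        · linarith [this.1]
        · have h3 := h2.le.trans (iInf₂_le (f := fun (S : ℂ) (_ : S ∈ {S : ℂ | S ∈ A ∧ S ≠ 0}) =>
            (argFrom c S : EReal)) S ⟨hS, hS0⟩)
          exact_mod_cast h3
    · refine le_antisymm (iSup₂_le fun s hs => iSup₂_le fun x hx => ?_) (iSup₂_le fun S hS => ?_)
      · by_contra hcon
        rw [not_le, EReal.lt_iff_exists_real_btwn] at hcon
        obtain ⟨b', h1, h2⟩ := hcon
        have h2 : b' < x := by exact_mod_cast h2
        have hxb := hmax s hs x hx
        have := hfin a b' (by linarith) (fun S hS hS0 => ⟨(harg S hS hS0).1.1, ?_⟩) s hs x hx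
          le_rfl (by linarith)
        · linarith [this.2]
        · have h3 := (le_iSup₂ (f := fun (S : ℂ) (_ : S ∈ {S : ℂ | S ∈ A ∧ S ≠ 0}) =>
            (argFrom c S : EReal)) S ⟨hS, hS0⟩).trans h1.le
          exact_mod_cast h3
      · rw [hb]
        exact_mod_cast (harg S hS.1 hS.2).1.2
  · push Not at hne
    -- without phases, all the numerical ranges are contained in `{0}`
    have hA0 : ∀ S : ℂ, S ∈ A → S = 0 := by
      have hK : ∀ γ : ℝ, A ⊆ phaseCone γ γ := fun γ =>
        hsub _ (isClosed_phaseCone γ γ) (convex_phaseCone γ γ) fun s hs =>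
          numRange_subset_phaseCone (hΦ s hs) (by simp [Real.pi_pos.le])
            fun x hx => absurd hx (hne s hs x)
      intro S hS
      obtain ⟨h1, h2, h3⟩ := hK 0 hS
      obtain ⟨-, -, h6⟩ := hK Real.pi hS
      simp at h1 h2 h3 h6
      exact Complex.ext (by simp; linarith) (by simp; linarith)
    have hz : ∀ s ∈ nonnegFrequencies, Φ s = 0 := fun s hs =>
      Multiset.eq_zero_of_forall_notMem (hne s hs)
    have hE : {S : ℂ | S ∈ A ∧ S ≠ 0} = ∅ := by
      ext S
      simp only [Set.mem_ofPred_eq, Set.mem_empty_iff_false, iff_false, not_and, not_not]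
      exact hA0 S
    rw [hE]
    constructor
    · simp only [Set.mem_empty_iff_false, iInf_false, iInf_top, minPhase]
      exact iInf₂_eq_top.2 fun s hs => by simp [hz s hs, phaseMin]
    · simp only [Set.mem_empty_iff_false, iSup_false, iSup_bot, maxPhase]
      exact iSup₂_eq_bot.2 fun s hs => by simp [hz s hs, phaseMax]

/-! ### The sine integral -/

/-- The sine integral `Si x = ∫_0^x sin y / y dy`. -/
def sineIntegral (x : ℝ) : ℝ := ∫ y in (0 : ℝ)..x, Real.sinc y

theorem sineIntegral_neg (x : ℝ) : sineIntegral (-x) = -sineIntegral x := by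
  unfold sineIntegral
  have := intervalIntegral.integral_comp_neg (a := 0) (b := x) Real.sinc
  simp only [Real.sinc_neg, neg_zero] at this
  rw [this, intervalIntegral.integral_symm]

theorem continuous_sineIntegral : Continuous sineIntegral :=
  intervalIntegral.continuous_primitive
    (fun _ _ => Real.continuous_sinc.intervalIntegrable _ _) 0

theorem abs_sineIntegral_le_abs (x : ℝ) : |sineIntegral x| ≤ |x| := by
  have := intervalIntegral.norm_integral_le_of_norm_le_const (a := 0) (b := x) (f := Real.sinc)
    (C := 1) (fun y _ => Real.abs_sinc_le_one y)
  simpa [sineIntegral] using this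

theorem integral_sin_mul_exp (R t : ℝ) :
    ∫ x in (0 : ℝ)..R, Real.sin x * Real.exp (-x * t) =
      (1 + t ^ 2)⁻¹ - (Real.cos R + t * Real.sin R) * Real.exp (-R * t) * (1 + t ^ 2)⁻¹ := by
  have hp : (1 + t ^ 2) ≠ 0 := by positivity
  have hd : ∀ x : ℝ, HasDerivAt
      (fun x => -((Real.cos x + t * Real.sin x) * Real.exp (-x * t) * (1 + t ^ 2)⁻¹))
      (Real.sin x * Real.exp (-x * t)) x := by
    intro x
    have h1 : HasDerivAt (fun x => Real.cos x + t * Real.sin x)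
        (-Real.sin x + t * Real.cos x) x :=
      (Real.hasDerivAt_cos x).add ((Real.hasDerivAt_sin x).const_mul t)
    have h2 : HasDerivAt (fun x => Real.exp (-x * t)) (Real.exp (-x * t) * (-1 * t)) x :=
      (((hasDerivAt_id x).neg).mul_const t).exp
    convert! ((h1.mul h2).mul_const (1 + t ^ 2)⁻¹).neg using 1
    field_simp
    ring
  rw [intervalIntegral.integral_eq_sub_of_hasDerivAt (fun x _ => hd x)
    (by apply Continuous.intervalIntegrable; fun_prop)]
  simp
  ring

/-- The Laplace transform representation of the sine integral: insert `1 / x = ∫_0^∞ e^{-xt} dt` and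
exchange the integrals. -/
theorem sineIntegral_eq {R : ℝ} (hR : 0 < R) :
    sineIntegral R = ∫ t in Set.Ioi (0 : ℝ),
      ((1 + t ^ 2)⁻¹ - (Real.cos R + t * Real.sin R) * Real.exp (-R * t) * (1 + t ^ 2)⁻¹) := by
  have hinner : ∀ x : ℝ, 0 < x →
      ∫ t in Set.Ioi (0 : ℝ), Real.exp (-x * t) = x⁻¹ := by
    intro x hx
    rw [integral_exp_mul_Ioi (by linarith)]
    simp
  have hint : Integrable (Function.uncurry fun x t : ℝ => Real.sin x * Real.exp (-x * t))
      ((volume.restrict (Set.Ioc 0 R)).prod (volume.restrict (Set.Ioi 0))) := by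
    rw [integrable_prod_iff (by
      apply Continuous.aestronglyMeasurable
      unfold Function.uncurry
      fun_prop)]
    constructor
    · filter_upwards [ae_restrict_mem measurableSet_Ioc] with x hx
      exact Integrable.const_mul
        (integrableOn_exp_mul_Ioi (neg_lt_zero.2 hx.1) 0) (Real.sin x)
    · have hb : Integrable (fun _ : ℝ => (1 : ℝ)) (volume.restrict (Set.Ioc 0 R)) := by
        simp
      refine hb.mono' ?_ ?_
      · have : Measurable fun x : ℝ => ∫ t in Set.Ioi (0 : ℝ),
            ‖Function.uncurry (fun x t : ℝ => Real.sin x * Real.exp (-x * t)) (x, t)‖ := by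
          refine (StronglyMeasurable.integral_prod_right ?_).measurable
          apply Continuous.stronglyMeasurable
          unfold Function.uncurry
          fun_prop
        exact this.aestronglyMeasurable
      · filter_upwards [ae_restrict_mem measurableSet_Ioc] with x hx
        simp only [Function.uncurry_apply_pair, norm_mul, Real.norm_eq_abs, Real.abs_exp]
        rw [integral_const_mul, hinner x hx.1, abs_mul, abs_abs, abs_of_pos (inv_pos.2 hx.1)]
        rw [← div_eq_mul_inv, div_le_one hx.1]
        exact (Real.abs_sin_le_abs).trans (abs_of_pos hx.1).le
  have hswap := integral_integral_swap hint
  rw [sineIntegral, intervalIntegral.integral_of_le hR.le]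
  calc ∫ x in Set.Ioc 0 R, Real.sinc x
      = ∫ x in Set.Ioc 0 R, ∫ t in Set.Ioi (0 : ℝ), Real.sin x * Real.exp (-x * t) := by
        refine setIntegral_congr_fun measurableSet_Ioc fun x hx => ?_
        rw [integral_const_mul, hinner x hx.1, Real.sinc_of_ne_zero hx.1.ne', div_eq_mul_inv]
    _ = _ := by
        rw [hswap]
        refine setIntegral_congr_fun measurableSet_Ioi fun t _ => ?_
        rw [← intervalIntegral.integral_of_le hR.le, integral_sin_mul_exp]

theorem abs_sineIntegral_sub_le {R : ℝ} (hR : 0 < R) :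
    |sineIntegral R - Real.pi / 2| ≤ 2 / R := by
  have h1 : IntegrableOn (fun t : ℝ => (1 + t ^ 2)⁻¹) (Set.Ioi 0) :=
    integrable_inv_one_add_sq.integrableOn
  have h2 : IntegrableOn (fun t : ℝ => 2 * Real.exp (-R * t)) (Set.Ioi 0) :=
    (integrableOn_exp_mul_Ioi (by linarith) 0).const_mul 2
  have hb : ∀ t ∈ Set.Ioi (0 : ℝ),
      ‖(Real.cos R + t * Real.sin R) * Real.exp (-R * t) * (1 + t ^ 2)⁻¹‖ ≤
        2 * Real.exp (-R * t) := by
    intro t ht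
    have ht : 0 < t := ht
    rw [norm_mul, norm_mul, Real.norm_eq_abs, Real.norm_eq_abs, Real.norm_eq_abs, Real.abs_exp,
      abs_of_pos (by positivity : (0 : ℝ) < (1 + t ^ 2)⁻¹)]
    have hc : |Real.cos R + t * Real.sin R| ≤ 1 + t := by
      refine (abs_add_le _ _).trans ?_
      rw [abs_mul, abs_of_pos ht]
      nlinarith [Real.abs_cos_le_one R, Real.abs_sin_le_one R]
    have : |Real.cos R + t * Real.sin R| * (1 + t ^ 2)⁻¹ ≤ 2 := by
      rw [← div_eq_mul_inv, div_le_iff₀ (by positivity)]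
      nlinarith [sq_nonneg (t - 1)]
    calc _ = |Real.cos R + t * Real.sin R| * (1 + t ^ 2)⁻¹ * Real.exp (-R * t) := by ring
      _ ≤ _ := by gcongr
  have h3 : IntegrableOn (fun t : ℝ =>
      (Real.cos R + t * Real.sin R) * Real.exp (-R * t) * (1 + t ^ 2)⁻¹) (Set.Ioi 0) := by
    refine Integrable.mono' h2 ?_ ?_
    · refine (Measurable.aestronglyMeasurable ?_)
      fun_prop
    · filter_upwards [ae_restrict_mem measurableSet_Ioi] with t ht using hb t ht
  rw [sineIntegral_eq hR, integral_sub h1 h3, integral_Ioi_inv_one_add_sq, Real.arctan_zero,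
    sub_zero, sub_sub_cancel_left, abs_neg]
  refine (norm_integral_le_of_norm_le h2
    ((ae_restrict_mem measurableSet_Ioi).mono fun t ht => hb t ht)).trans ?_
  rw [integral_const_mul, integral_exp_mul_Ioi (neg_lt_zero.2 hR)]
  simp [div_eq_mul_inv]

/-- The Dirichlet integral: `∫_0^∞ sin x / x dx = π / 2` as an improper integral. -/
theorem tendsto_sineIntegral : Tendsto sineIntegral atTop (𝓝 (Real.pi / 2)) := by
  rw [tendsto_iff_norm_sub_tendsto_zero]
  refine squeeze_zero' (Eventually.of_forall fun _ => norm_nonneg _)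
    ((eventually_gt_atTop 0).mono fun R hR => abs_sineIntegral_sub_le hR) ?_
  exact tendsto_const_nhds.div_atTop tendsto_id

theorem abs_sineIntegral_le (x : ℝ) : |sineIntegral x| ≤ 4 := by
  have key : ∀ x : ℝ, 0 ≤ x → |sineIntegral x| ≤ 4 := by
    intro x hx
    rcases le_or_gt x 1 with h | h
    · have := abs_sineIntegral_le_abs x
      rw [abs_of_nonneg hx] at this
      linarith
    · have h1 := abs_sineIntegral_sub_le (R := x) (by linarith)
      have h2 : 2 / x ≤ 2 := by
        rw [div_le_iff₀ (by linarith)]; linarith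
      have h3 := Real.pi_lt_four
      have h4 := Real.pi_pos
      rw [abs_le] at h1 ⊢
      constructor <;> linarith [h1.1, h1.2]
  rcases le_total 0 x with h | h
  · exact key x h
  · have := key (-x) (by linarith)
    rwa [sineIntegral_neg, abs_neg] at this

/-! ### Truncations of the Hilbert kernel -/

/-- The kernel `1 / (π s)` of the Hilbert transform, truncated to `ε < |s| < R`. -/
def hilbertKernel (ε R s : ℝ) : ℝ :=
  Set.indicator {s : ℝ | ε < |s| ∧ |s| < R} (fun s => (Real.pi * s)⁻¹) s

theorem measurableSet_annulus (ε R : ℝ) : MeasurableSet {s : ℝ | ε < |s| ∧ |s| < R} :=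
  (measurableSet_lt measurable_const measurable_id.abs).inter
    (measurableSet_lt measurable_id.abs measurable_const)

theorem measurable_hilbertKernel (ε R : ℝ) : Measurable (hilbertKernel ε R) :=
  Measurable.indicator (by fun_prop) (measurableSet_annulus ε R)

theorem hilbertKernel_neg (ε R s : ℝ) : hilbertKernel ε R (-s) = -hilbertKernel ε R s := by
  simp only [hilbertKernel, Set.indicator_apply, Set.mem_ofPred_eq, abs_neg]
  split_ifs
  · rw [mul_neg, inv_neg]
  · simp

theorem hilbertKernel_eq_zero {ε R s : ℝ} (h : R ≤ |s|) : hilbertKernel ε R s = 0 := by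
  rw [hilbertKernel, Set.indicator_of_notMem]
  exact fun h' => absurd h'.2 (not_lt.2 h)

theorem abs_hilbertKernel_le {ε : ℝ} (hε : 0 < ε) (R s : ℝ) : |hilbertKernel ε R s| ≤ ε⁻¹ := by
  rw [hilbertKernel, Set.indicator_apply]
  split_ifs with h
  · rw [abs_inv, abs_mul, abs_of_pos Real.pi_pos]
    have h1 : ε < |s| := h.1
    have := Real.pi_gt_three
    gcongr
    nlinarith
  · simpa using hε.le

theorem integrable_hilbertKernel {ε : ℝ} (hε : 0 < ε) (R : ℝ) :
    Integrable (hilbertKernel ε R) := by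
  have h : Integrable (Set.indicator (Set.Ioo (-R) R) fun _ : ℝ => ε⁻¹) :=
    (integrable_indicator_iff measurableSet_Ioo).2 (by simp)
  refine h.mono' (measurable_hilbertKernel ε R).aestronglyMeasurable (ae_of_all _ fun s => ?_)
  by_cases hs : s ∈ Set.Ioo (-R) R
  · rw [Set.indicator_of_mem hs]
    exact abs_hilbertKernel_le hε R s
  · rw [Set.indicator_of_notMem hs, hilbertKernel_eq_zero, norm_zero]
    by_contra hcon
    exact hs (abs_lt.1 (not_le.1 hcon))

/-- The Fourier transform of the truncated Hilbert kernel. -/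
theorem integral_hilbertKernel_mul_exp {ε R : ℝ} (hε : 0 < ε) (hR : ε < R) (ω : ℝ) :
    ∫ s, (hilbertKernel ε R s : ℂ) * Complex.exp (-(ω * s * Complex.I)) =
      -Complex.I * ((2 / Real.pi * (sineIntegral (ω * R) - sineIntegral (ω * ε)) : ℝ) : ℂ) := by
  set f : ℝ → ℂ := fun s => (hilbertKernel ε R s : ℂ) * Complex.exp (-(ω * s * Complex.I)) with hf
  have hfi : Integrable f := by
    refine (integrable_hilbertKernel hε R).ofReal.mul_bdd (c := 1)
      (Continuous.aestronglyMeasurable (by fun_prop)) (ae_of_all _ fun s => ?_)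
    rw [Complex.norm_exp]
    simp
  have h1 : ∫ s, f s = ∫ s in Set.Ioi (0 : ℝ), (f s + f (-s)) := by
    have h0 := integral_comp_neg_Ioi (0 : ℝ) f
    rw [neg_zero] at h0
    rw [← integral_add_compl measurableSet_Ioi hfi (s := Set.Ioi (0 : ℝ)), Set.compl_Ioi,
      ← h0, ← integral_add hfi.integrableOn hfi.comp_neg.integrableOn]
  have h2 : ∀ s : ℝ, f s + f (-s) = Set.indicator (Set.Ioo ε R) (fun s : ℝ =>
      -Complex.I * ((2 / Real.pi * (ω * Real.sinc (ω * s)) : ℝ) : ℂ)) s ∨ s ≤ 0 := by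
    intro s
    rcases le_or_gt s 0 with h | h
    · exact Or.inr h
    left
    simp only [hf, hilbertKernel_neg]
    have hsinc : ω * Real.sinc (ω * s) = Real.sin (ω * s) / s := by
      rcases eq_or_ne ω 0 with h0 | h0
      · simp [h0]
      · rw [Real.sinc_of_ne_zero (by positivity)]
        field_simp
    simp only [hilbertKernel, Set.indicator_apply, hsinc, Set.mem_ofPred_eq, abs_of_pos h,
      Set.mem_Ioo]
    split_ifs
    · have e1 : Complex.exp (-(ω * s * Complex.I)) - Complex.exp (ω * s * Complex.I) =
          -2 * Complex.I * Real.sin (ω * s) := by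
        push_cast
        rw [Complex.sin, neg_mul ((ω : ℂ) * s) Complex.I]
        linear_combination (Complex.exp (-(ω * s * Complex.I)) -
          Complex.exp (ω * s * Complex.I)) * Complex.I_mul_I
      have : (s : ℂ) ≠ 0 := by exact_mod_cast h.ne'
      have hpi : (Real.pi : ℂ) ≠ 0 := by exact_mod_cast Real.pi_ne_zero
      push_cast at e1 ⊢
      simp only [mul_neg, neg_mul, neg_neg] at e1 ⊢
      rw [← sub_eq_add_neg, ← mul_sub, e1]
      field_simp
    · simp
  rw [h1, setIntegral_congr_fun measurableSet_Ioi (fun s hs => (h2 s).resolve_right (not_le.2 hs)),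
    setIntegral_indicator measurableSet_Ioo,
    Set.inter_eq_right.2 (show Set.Ioo ε R ⊆ Set.Ioi 0 from fun s hs => lt_trans hε hs.1),
    integral_const_mul,
    integral_complex_ofReal, integral_const_mul, integral_const_mul,
    ← integral_Ioc_eq_integral_Ioo, ← intervalIntegral.integral_of_le hR.le,
    intervalIntegral.mul_integral_comp_mul_left, sineIntegral, sineIntegral,
    intervalIntegral.integral_interval_sub_left
      (Real.continuous_sinc.intervalIntegrable _ _) (Real.continuous_sinc.intervalIntegrable _ _)]

/-- The Fourier multipliers of the truncated Hilbert transforms are bounded uniformly. -/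
theorem norm_integral_hilbertKernel_le {ε R : ℝ} (hε : 0 < ε) (hR : ε < R) (ω : ℝ) :
    ‖∫ s, (hilbertKernel ε R s : ℂ) * Complex.exp (-(ω * s * Complex.I))‖ ≤ 6 := by
  rw [integral_hilbertKernel_mul_exp hε hR, norm_mul, norm_neg, Complex.norm_I, one_mul,
    Complex.norm_real, norm_mul, Real.norm_eq_abs, Real.norm_eq_abs,
    abs_of_pos (by positivity : 0 < 2 / Real.pi)]
  have h1 : |sineIntegral (ω * R) - sineIntegral (ω * ε)| ≤ 8 := by
    refine (abs_sub _ _).trans ?_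
    linarith [abs_sineIntegral_le (ω * R), abs_sineIntegral_le (ω * ε)]
  have h2 : 2 / Real.pi ≤ 2 / 3 := by
    have := Real.pi_gt_three
    gcongr
  calc _ ≤ (2 / 3 : ℝ) * 8 := by gcongr
    _ ≤ 6 := by norm_num

theorem eventually_truncation : ∀ᶠ q : ℝ × ℝ in 𝓝[>] (0 : ℝ) ×ˢ atTop, 0 < q.1 ∧ q.1 < q.2 := by
  have hA : ∀ᶠ x in 𝓝[>] (0 : ℝ), x ∈ Set.Ioo (0 : ℝ) 1 := Ioo_mem_nhdsGT one_pos
  filter_upwards [hA.prod_mk (eventually_gt_atTop (1 : ℝ))] with q hq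
  exact ⟨hq.1.1, hq.1.2.trans hq.2⟩

/-- The multipliers of the truncated Hilbert transforms converge to `-j` at positive
frequencies. -/
theorem tendsto_integral_hilbertKernel {ω : ℝ} (hω : 0 < ω) :
    Tendsto (fun q : ℝ × ℝ =>
      ∫ s, (hilbertKernel q.1 q.2 s : ℂ) * Complex.exp (-(ω * s * Complex.I)))
      (𝓝[>] (0 : ℝ) ×ˢ atTop) (𝓝 (-Complex.I)) := by
  have h1 : Tendsto (fun q : ℝ × ℝ => sineIntegral (ω * q.2)) (𝓝[>] (0 : ℝ) ×ˢ atTop)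
      (𝓝 (Real.pi / 2)) :=
    tendsto_sineIntegral.comp ((tendsto_id.const_mul_atTop hω).comp tendsto_snd)
  have h2 : Tendsto (fun q : ℝ × ℝ => sineIntegral (ω * q.1)) (𝓝[>] (0 : ℝ) ×ˢ atTop)
      (𝓝 0) := by
    have h0 : Tendsto (fun x => sineIntegral (ω * x)) (𝓝[>] (0 : ℝ)) (𝓝 0) := by
      have := (continuous_sineIntegral.comp (continuous_const_mul ω)).tendsto 0
      simp only [Function.comp_apply, mul_zero] at this
      rw [show sineIntegral 0 = 0 by simp [sineIntegral]] at this
      exact this.mono_left nhdsWithin_le_nhds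
    exact h0.comp tendsto_fst
  have h3 := ((Complex.continuous_ofReal.tendsto _).comp
    ((h1.sub h2).const_mul (2 / Real.pi))).const_mul (-Complex.I)
  have h4 : -Complex.I * ((2 / Real.pi * (Real.pi / 2 - 0) : ℝ) : ℂ) = -Complex.I := by
    rw [sub_zero, div_mul_div_cancel₀ Real.pi_ne_zero]
    simp
  rw [h4] at h3
  refine h3.congr' ?_
  filter_upwards [eventually_truncation] with q hq
  exact (integral_hilbertKernel_mul_exp hq.1 hq.2 ω).symm


/-! ### Square integrals over windows -/

theorem enorm_sq_eq_ofReal (x : ℝ) : ‖x‖ₑ ^ 2 = ENNReal.ofReal (x ^ 2) := by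
  rw [Real.enorm_eq_ofReal_abs, ← ENNReal.ofReal_pow (abs_nonneg x), sq_abs]

theorem enorm_add_sq_le (x y : ℝ) : ‖x + y‖ₑ ^ 2 ≤ 2 * (‖x‖ₑ ^ 2 + ‖y‖ₑ ^ 2) := by
  simp only [enorm_sq_eq_ofReal]
  rw [← ENNReal.ofReal_add (sq_nonneg _) (sq_nonneg _), ← ENNReal.ofReal_ofNat 2,
    ← ENNReal.ofReal_mul (by norm_num)]
  exact ENNReal.ofReal_le_ofReal add_sq_le

theorem memLp_two_iff_lintegral {α : Type*} [MeasurableSpace α] {μ : Measure α} {f : α → ℝ} :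
    MemLp f 2 μ ↔ AEStronglyMeasurable f μ ∧ ∫⁻ t, ‖f t‖ₑ ^ 2 ∂μ < ⊤ := by
  rw [MemLp, and_congr_right_iff]
  intro _
  rw [eLpNorm_lt_top_iff_lintegral_rpow_enorm_lt_top (by norm_num) (by norm_num)]
  simp

/-- `f` is measurable, and its energy on every window of length `L` is at most `a L + b`. The constant
`a` bounds the power of `f`; the constant `b` accommodates `L₂` signals and incomplete periods. -/
structure WindowBound (f : ℝ → ℝ) (a b : ℝ≥0) : Prop where
  aestronglyMeasurable : AEStronglyMeasurable f volume
  lintegral_le : ∀ x L : ℝ, 0 ≤ L →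
    ∫⁻ t in Set.Ioc x (x + L), ‖f t‖ₑ ^ 2 ≤ a * ENNReal.ofReal L + b

namespace WindowBound

variable {f g : ℝ → ℝ} {a b a' b' : ℝ≥0}

theorem mono (h : WindowBound f a b) (ha : a ≤ a') (hb : b ≤ b') : WindowBound f a' b' :=
  ⟨h.1, fun x L hL => (h.2 x L hL).trans (by gcongr)⟩

theorem congr_ae (h : WindowBound f a b) (hfg : f =ᵐ[volume] g) : WindowBound g a b := by
  refine ⟨h.1.congr hfg, fun x L hL => ?_⟩
  rw [← setLIntegral_congr_fun_ae (f := fun t => ‖f t‖ₑ ^ 2) measurableSet_Ioc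
    (hfg.mono fun t ht _ => by rw [ht])]
  exact h.2 x L hL

theorem zero : WindowBound 0 0 0 :=
  ⟨aestronglyMeasurable_const, fun x L _ => by simp⟩

theorem add (hf : WindowBound f a b) (hg : WindowBound g a' b') :
    WindowBound (f + g) (2 * (a + a')) (2 * (b + b')) := by
  refine ⟨hf.1.add hg.1, fun x L hL => ?_⟩
  calc ∫⁻ t in Set.Ioc x (x + L), ‖(f + g) t‖ₑ ^ 2
      ≤ ∫⁻ t in Set.Ioc x (x + L), 2 * (‖f t‖ₑ ^ 2 + ‖g t‖ₑ ^ 2) :=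
        lintegral_mono fun t => enorm_add_sq_le _ _
    _ = 2 * ((∫⁻ t in Set.Ioc x (x + L), ‖f t‖ₑ ^ 2) + ∫⁻ t in Set.Ioc x (x + L), ‖g t‖ₑ ^ 2) := by
        rw [lintegral_const_mul' _ _ (by norm_num),
          lintegral_add_left' (hf.1.restrict.enorm.pow_const 2)]
    _ ≤ 2 * ((a * ENNReal.ofReal L + b) + (a' * ENNReal.ofReal L + b')) := by
        gcongr
        · exact hf.2 x L hL
        · exact hg.2 x L hL
    _ = _ := by push_cast; ring

theorem const_mul (hf : WindowBound f a b) (c : ℝ) :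
    WindowBound (fun t => c * f t) (‖c‖₊ ^ 2 * a) (‖c‖₊ ^ 2 * b) := by
  refine ⟨hf.1.const_mul c, fun x L hL => ?_⟩
  calc ∫⁻ t in Set.Ioc x (x + L), ‖c * f t‖ₑ ^ 2
      = ‖c‖ₑ ^ 2 * ∫⁻ t in Set.Ioc x (x + L), ‖f t‖ₑ ^ 2 := by
        simp only [enorm_mul, mul_pow]
        rw [lintegral_const_mul' _ _ (by finiteness)]
    _ ≤ ‖c‖ₑ ^ 2 * (a * ENNReal.ofReal L + b) := by
        gcongr
        exact hf.2 x L hL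
    _ = _ := by push_cast; rw [← enorm_eq_nnnorm]; ring

theorem memLp_Ioc (h : WindowBound f a b) (x y : ℝ) :
    MemLp f 2 (volume.restrict (Set.Ioc x y)) := by
  rw [memLp_two_iff_lintegral]
  refine ⟨h.1.restrict, ?_⟩
  rcases le_total x y with hxy | hxy
  · have := h.2 x (y - x) (by linarith)
    rw [add_sub_cancel] at this
    exact this.trans_lt (by finiteness)
  · simp [Set.Ioc_eq_empty (not_lt.2 hxy)]

theorem intervalIntegrable (h : WindowBound f a b) (x y : ℝ) :
    IntervalIntegrable f volume x y :=
  ⟨(h.memLp_Ioc x y).integrable one_le_two, (h.memLp_Ioc y x).integrable one_le_two⟩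

theorem intervalIntegrable_mul (hf : WindowBound f a b) (hg : WindowBound g a' b') (x y : ℝ) :
    IntervalIntegrable (fun t => f t * g t) volume x y :=
  ⟨(hf.memLp_Ioc x y).integrable_mul (hg.memLp_Ioc x y),
    (hf.memLp_Ioc y x).integrable_mul (hg.memLp_Ioc y x)⟩

theorem integral_sq_le (h : WindowBound f a b) {x L : ℝ} (hL : 0 ≤ L) :
    ∫ t in x..(x + L), f t ^ 2 ≤ a * L + b := by
  rw [intervalIntegral.integral_of_le (by linarith), integral_eq_lintegral_of_nonneg_ae
    (ae_of_all _ fun t => sq_nonneg _) (h.1.restrict.pow 2)]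
  simp only [← enorm_sq_eq_ofReal]
  refine ENNReal.toReal_le_of_le_ofReal (by positivity) ((h.2 x L hL).trans (le_of_eq ?_))
  rw [ENNReal.ofReal_add (by positivity) (by positivity), ENNReal.ofReal_mul (by positivity)]
  simp

theorem exists_of_memLp (hf : MemLp f 2 volume) : ∃ b, WindowBound f 0 b := by
  obtain ⟨h1, h2⟩ := memLp_two_iff_lintegral.1 hf
  refine ⟨(∫⁻ t, ‖f t‖ₑ ^ 2).toNNReal, h1, fun x L _ => ?_⟩
  rw [ENNReal.coe_toNNReal h2.ne]
  exact (setLIntegral_le_lintegral _ _).trans (by simp)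

/-- Window bounds pass to almost everywhere limits, by Fatou's lemma. -/
theorem of_tendsto {ι : Type*} {l : Filter ι} [l.IsCountablyGenerated] [l.NeBot] {F : ι → ℝ → ℝ}
    (hF : ∀ᶠ n in l, WindowBound (F n) a b)
    (h : ∀ᵐ t, Tendsto (fun n => F n t) l (𝓝 (f t))) : WindowBound f a b := by
  obtain ⟨u, hu⟩ := l.exists_seq_tendsto
  obtain ⟨N, hN⟩ := eventually_atTop.1 (hu.eventually hF)
  set v : ℕ → ℝ → ℝ := fun n => F (u (n + N)) with hv
  have hvB : ∀ n, WindowBound (v n) a b := fun n => hN _ (by omega)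
  have hvt : ∀ᵐ t, Tendsto (fun n => v n t) atTop (𝓝 (f t)) := by
    filter_upwards [h] with t ht
    exact (ht.comp hu).comp (tendsto_add_atTop_nat N)
  refine ⟨aestronglyMeasurable_of_tendsto_ae atTop (fun n => (hvB n).1) hvt, fun x L hL => ?_⟩
  calc ∫⁻ t in Set.Ioc x (x + L), ‖f t‖ₑ ^ 2
      = ∫⁻ t in Set.Ioc x (x + L), liminf (fun n => ‖v n t‖ₑ ^ 2) atTop := by
        refine lintegral_congr_ae (ae_restrict_of_ae ?_)
        filter_upwards [hvt] with t ht
        exact (((ENNReal.continuous_pow 2).tendsto _).comp ht.enorm).liminf_eq.symm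
    _ ≤ liminf (fun n => ∫⁻ t in Set.Ioc x (x + L), ‖v n t‖ₑ ^ 2) atTop :=
        lintegral_liminf_le' fun n => (hvB n).1.restrict.enorm.pow_const 2
    _ ≤ _ := by
        refine liminf_le_of_frequently_le' (Frequently.of_forall fun n => ?_)
        exact (hvB n).2 x L hL

end WindowBound

/-! ### Periodic functions -/

theorem lintegral_Ioc_add_eq_of_periodic {F : ℝ → ℝ≥0∞} {P : ℝ} (hP : 0 < P)
    (hF : Function.Periodic F P) (x y : ℝ) :
    ∫⁻ t in Set.Ioc x (x + P), F t = ∫⁻ t in Set.Ioc y (y + P), F t := by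
  have : VAddInvariantMeasure (AddSubgroup.zmultiples P) ℝ volume :=
    ⟨fun c s _ => measure_preimage_add _ _ _⟩
  apply IsAddFundamentalDomain.setLIntegral_eq (G := AddSubgroup.zmultiples P)
  exacts [isAddFundamentalDomain_Ioc hP x, isAddFundamentalDomain_Ioc hP y,
    hF.map_vadd_zmultiples]

theorem aestronglyMeasurable_of_periodic {f : ℝ → ℝ} {P : ℝ} (hP : 0 < P)
    (hf : Function.Periodic f P) {x : ℝ}
    (h : AEStronglyMeasurable f (volume.restrict (Set.Ioc x (x + P)))) :
    AEStronglyMeasurable f volume := by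
  rw [← Measure.restrict_univ (μ := volume), ← iUnion_Ioc_add_zsmul hP x,
    aestronglyMeasurable_iUnion_iff]
  intro n
  have hmp : MeasurePreserving (fun t : ℝ => t - n • P)
      (volume.restrict (Set.Ioc (x + n • P) (x + (n + 1) • P)))
      (volume.restrict (Set.Ioc x (x + P))) := by
    have := (measurePreserving_sub_right volume (n • P)).restrict_preimage
      (measurableSet_Ioc (a := x) (b := x + P))
    convert this using 2
    ext t
    simp only [Set.mem_Ioc, Set.mem_preimage, zsmul_eq_mul, Int.cast_add, Int.cast_one]
    constructor <;> rintro ⟨h1, h2⟩ <;> constructor <;> linarith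
  have h2 := h.comp_measurePreserving hmp
  refine h2.congr (ae_of_all _ fun t => ?_)
  exact hf.sub_zsmul_eq n

theorem WindowBound.of_periodic {f : ℝ → ℝ} {P x : ℝ} (hP : 0 < P) (hf : Function.Periodic f P)
    (h : AEStronglyMeasurable f (volume.restrict (Set.Ioc x (x + P)))) {A : ℝ≥0}
    (hA : ∫⁻ t in Set.Ioc x (x + P), ‖f t‖ₑ ^ 2 ≤ A) :
    WindowBound f (A / P.toNNReal) A := by
  refine ⟨aestronglyMeasurable_of_periodic hP hf h, fun y L hL => ?_⟩
  have hF : Function.Periodic (fun t => ‖f t‖ₑ ^ 2) P := fun t => by simp only [hf t]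
  have hn : ∀ n : ℕ, ∫⁻ t in Set.Ioc y (y + n * P), ‖f t‖ₑ ^ 2 ≤ n * A := by
    intro n
    induction n with
    | zero => simp
    | succ n ih =>
      have hsplit : Set.Ioc y (y + (n + 1 : ℕ) * P) ⊆
          Set.Ioc y (y + n * P) ∪ Set.Ioc (y + n * P) (y + n * P + P) := by
        rw [Set.Ioc_union_Ioc_eq_Ioc (by nlinarith [n.cast_nonneg (α := ℝ)]) (by linarith)]
        refine Set.Ioc_subset_Ioc_right (le_of_eq ?_)
        push_cast
        ring
      refine (lintegral_mono_set hsplit).trans ((lintegral_union_le _ _ _).trans ?_)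
      rw [lintegral_Ioc_add_eq_of_periodic hP hF (y + n * P) x]
      push_cast
      rw [add_mul, one_mul]
      exact add_le_add ih hA
  have hceil : (⌈L / P⌉₊ : ℝ) ≤ L / P + 1 := (Nat.ceil_lt_add_one (by positivity)).le
  have hsub : Set.Ioc y (y + L) ⊆ Set.Ioc y (y + ⌈L / P⌉₊ * P) := by
    refine Set.Ioc_subset_Ioc_right ?_
    have := (div_le_iff₀ hP).1 (Nat.le_ceil (L / P))
    linarith
  refine (lintegral_mono_set hsub).trans ((hn _).trans ?_)
  have h3 : ((⌈L / P⌉₊ : ℕ) : ℝ≥0∞) ≤ ENNReal.ofReal (L / P + 1) := by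
    rw [← ENNReal.ofReal_natCast]
    exact ENNReal.ofReal_le_ofReal hceil
  refine (mul_le_mul_left h3 _).trans (le_of_eq ?_)
  rw [ENNReal.ofReal_add (by positivity) zero_le_one, ENNReal.ofReal_one, add_mul, one_mul,
    ENNReal.ofReal_div_of_pos hP, ENNReal.coe_div (by simpa using hP), mul_comm, ← mul_div_assoc,
    ENNReal.mul_div_right_comm]
  rfl

theorem WindowBound.exists_of_periodic {f : ℝ → ℝ} {P x : ℝ} (hP : 0 < P)
    (hf : Function.Periodic f P) (h : MemLp f 2 (volume.restrict (Set.Ioc x (x + P)))) :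
    ∃ a b, WindowBound f a b := by
  obtain ⟨h1, h2⟩ := memLp_two_iff_lintegral.1 h
  exact ⟨_, _, WindowBound.of_periodic hP hf h1 (ENNReal.coe_toNNReal h2.ne).ge⟩

/-! ### Truncated Hilbert transforms of signals -/

/-- The truncated Hilbert transform `(1/π) ∫_{ε < |s| < R} f(t - s) / s ds`. -/
def truncHilbert (ε R : ℝ) (f : ℝ → ℝ) (t : ℝ) : ℝ := ∫ s, hilbertKernel ε R s * f (t - s)

theorem truncHilbert_eq_setIntegral (ε R : ℝ) (f : ℝ → ℝ) (t : ℝ) :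
    truncHilbert ε R f t =
      Real.pi⁻¹ * ∫ τ in {τ : ℝ | ε < |t - τ| ∧ |t - τ| < R}, (t - τ)⁻¹ * f τ := by
  have hm : MeasurableSet {τ : ℝ | ε < |t - τ| ∧ |t - τ| < R} :=
    (measurableSet_annulus ε R).preimage (measurable_const.sub measurable_id)
  have h := integral_sub_left_eq_self (fun s => hilbertKernel ε R s * f (t - s)) volume t
  rw [truncHilbert, ← h, ← integral_indicator hm, ← integral_const_mul]
  congr 1
  ext τ
  simp only [hilbertKernel, Set.indicator_apply, Set.mem_ofPred_eq, sub_sub_cancel]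
  split_ifs
  · rw [mul_inv, mul_assoc]
  · simp

/-- The integral over a period of the convolution of an integrable kernel with a periodic function. -/
theorem integral_convolution_of_periodic {κ q : ℝ → ℂ} {P : ℝ} (hP : 0 < P)
    (hκ : Integrable κ) (hq : Function.Periodic q P) (x : ℝ)
    (hqm : AEStronglyMeasurable q) (hqi : IntervalIntegrable q volume x (x + P)) :
    ∫ t in x..(x + P), ∫ s, κ s * q (t - s) = (∫ s, κ s) * ∫ t in x..(x + P), q t := by
  have hloc : ∀ y z, IntervalIntegrable q volume y z := fun y z => hq.intervalIntegrable hP.ne' hqi y z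
  have hnorm : Function.Periodic (fun t => ‖q t‖) P := fun t => by simp only [hq t]
  have hint : Integrable (Function.uncurry fun t s : ℝ => κ s * q (t - s))
      ((volume.restrict (Set.Ioc x (x + P))).prod volume) := by
    have hm : AEStronglyMeasurable (Function.uncurry fun t s : ℝ => κ s * q (t - s))
        ((volume.restrict (Set.Ioc x (x + P))).prod volume) := by
      have := AEStronglyMeasurable.convolution_integrand (μ := volume) (ν := volume)
        (ContinuousLinearMap.mul ℝ ℂ) hκ.1 hqm
      exact this.mono_ac ((Measure.absolutelyContinuous_of_le Measure.restrict_le_self).prod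
        Measure.AbsolutelyContinuous.rfl)
    rw [integrable_prod_iff' hm]
    constructor
    · refine ae_of_all _ fun s => ?_
      have := ((hloc (x - s) (x + P - s)).comp_sub_right s)
      simp only [sub_add_cancel] at this
      exact ((intervalIntegrable_iff_integrableOn_Ioc_of_le (by linarith)).1 this).const_mul (κ s)
    · have : ∀ s, ∫ t in Set.Ioc x (x + P), ‖Function.uncurry (fun t s : ℝ => κ s * q (t - s)) (t, s)‖
          = ‖κ s‖ * ∫ t in x..(x + P), ‖q t‖ := by
        intro s
        simp only [Function.uncurry_apply_pair, norm_mul]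
        rw [integral_const_mul, ← intervalIntegral.integral_of_le (by linarith),
          intervalIntegral.integral_comp_sub_right (fun t => ‖q t‖),
          hnorm.intervalIntegral_add_eq x (x - s), add_sub_right_comm]
      simp only [this]
      exact hκ.norm.mul_const _
  rw [intervalIntegral.integral_of_le (by linarith), integral_integral_swap hint,
    ← integral_mul_const]
  congr 1
  ext s
  rw [integral_const_mul, ← intervalIntegral.integral_of_le (by linarith),
    intervalIntegral.integral_comp_sub_right q, hq.intervalIntegral_add_eq x (x - s),
    add_sub_right_comm]

section

variable {f g : ℝ → ℝ} {a b a' b' : ℝ≥0} {ε : ℝ}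

theorem WindowBound.integrable_hilbertKernel_mul (hf : WindowBound f a b) (hε : 0 < ε) (R t : ℝ) :
    Integrable fun s => hilbertKernel ε R s * f (t - s) := by
  rcases lt_or_ge R 0 with hR | hR
  · have : (fun s => hilbertKernel ε R s * f (t - s)) = fun _ => 0 := by
      ext s
      rw [hilbertKernel_eq_zero (by linarith [abs_nonneg s]), zero_mul]
    rw [this]
    exact integrable_zero _ _ _
  have h1 : IntegrableOn (fun s => f (t - s)) (Set.Ioc (-R) R) := by
    have := (hf.intervalIntegrable (t + R) (t - R)).comp_sub_left t
    simp only [sub_add_cancel_left, sub_sub_cancel] at this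
    exact (intervalIntegrable_iff_integrableOn_Ioc_of_le (by linarith)).1 this
  have h2 : IntegrableOn (fun s => hilbertKernel ε R s * f (t - s)) (Set.Ioc (-R) R) :=
    h1.bdd_mul (c := ε⁻¹) (measurable_hilbertKernel ε R).aestronglyMeasurable
      (ae_of_all _ fun s => abs_hilbertKernel_le hε R s)
  refine h2.integrable_of_forall_notMem_eq_zero fun s hs => ?_
  rw [hilbertKernel_eq_zero, zero_mul]
  by_contra hcon
  have := abs_lt.1 (not_le.1 hcon)
  exact hs ⟨this.1, this.2.le⟩

theorem WindowBound.truncHilbert_add (hf : WindowBound f a b) (hg : WindowBound g a' b')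
    (hε : 0 < ε) (R : ℝ) :
    truncHilbert ε R (f + g) = truncHilbert ε R f + truncHilbert ε R g := by
  ext t
  simp only [truncHilbert, Pi.add_apply, mul_add]
  exact integral_add (hf.integrable_hilbertKernel_mul hε R t) (hg.integrable_hilbertKernel_mul hε R t)

theorem WindowBound.truncHilbert_sub (hf : WindowBound f a b) (hg : WindowBound g a' b')
    (hε : 0 < ε) (R : ℝ) :
    truncHilbert ε R (f - g) = truncHilbert ε R f - truncHilbert ε R g := by
  ext t
  simp only [truncHilbert, Pi.sub_apply, mul_sub]
  exact integral_sub (hf.integrable_hilbertKernel_mul hε R t) (hg.integrable_hilbertKernel_mul hε R t)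

theorem aestronglyMeasurable_truncHilbert (hf : AEStronglyMeasurable f) (ε R : ℝ) :
    AEStronglyMeasurable (truncHilbert ε R f) := by
  have := AEStronglyMeasurable.convolution_integrand (μ := volume) (ν := volume)
    (ContinuousLinearMap.mul ℝ ℝ) (measurable_hilbertKernel ε R).aestronglyMeasurable hf
  exact this.integral_prod_right'

theorem WindowBound.abs_truncHilbert_le (hf : WindowBound f a b) (hε : 0 < ε) {R : ℝ} (hR : 0 ≤ R)
    (t : ℝ) : |truncHilbert ε R f t| ≤ ε⁻¹ * (2 * R + (a * (2 * R) + b)) := by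
  have hi : IntervalIntegrable (fun s => 1 + f s ^ 2) volume (t - R) (t - R + 2 * R) := by
    refine intervalIntegrable_const.add ?_
    simpa only [sq] using hf.intervalIntegrable_mul hf _ _
  have hi' := hi.comp_sub_left t
  have e1 : t - (t - R) = R := by ring
  have e2 : t - (t - R + 2 * R) = -R := by ring
  rw [e1, e2] at hi'
  have hi'' : IntegrableOn (fun s => ε⁻¹ * (1 + f (t - s) ^ 2)) (Set.Ioc (-R) R) :=
    ((intervalIntegrable_iff_integrableOn_Ioc_of_le (by linarith)).1 hi'.symm).const_mul _
  have hle : ∀ s, ‖hilbertKernel ε R s * f (t - s)‖ ≤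
      Set.indicator (Set.Ioc (-R) R) (fun s => ε⁻¹ * (1 + f (t - s) ^ 2)) s := by
    intro s
    by_cases hs : s ∈ Set.Ioc (-R) R
    · rw [Set.indicator_of_mem hs, norm_mul]
      have h1 := abs_hilbertKernel_le hε R s
      have h2 : |f (t - s)| ≤ 1 + f (t - s) ^ 2 := by
        nlinarith [sq_abs (f (t - s)), sq_nonneg (|f (t - s)| - 1), abs_nonneg (f (t - s))]
      simp only [Real.norm_eq_abs]
      gcongr
    · rw [Set.indicator_of_notMem hs, hilbertKernel_eq_zero, zero_mul, norm_zero]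
      by_contra hcon
      have := abs_lt.1 (not_le.1 hcon)
      exact hs ⟨this.1, this.2.le⟩
  have h3 := norm_integral_le_of_norm_le ((integrable_indicator_iff measurableSet_Ioc).2 hi'')
    (ae_of_all _ hle)
  rw [integral_indicator measurableSet_Ioc, integral_const_mul,
    ← intervalIntegral.integral_of_le (by linarith)] at h3
  have h4 := intervalIntegral.integral_comp_sub_left (a := -R) (b := R) (fun s => 1 + f s ^ 2) t
  rw [h4, sub_neg_eq_add, show t + R = t - R + 2 * R by ring] at h3
  refine h3.trans ?_
  gcongr
  rw [intervalIntegral.integral_add intervalIntegrable_const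
    (by simpa only [sq] using hf.intervalIntegrable_mul hf _ _)]
  have h5 := hf.integral_sq_le (x := t - R) (L := 2 * R) (by linarith)
  simp only [intervalIntegral.integral_const, smul_eq_mul, mul_one]
  linarith

theorem truncHilbert_periodic {P : ℝ} (hf : Function.Periodic f P) (ε R : ℝ) :
    Function.Periodic (truncHilbert ε R f) P := by
  intro t
  simp only [truncHilbert]
  congr 1
  ext s
  rw [show t + P - s = t - s + P by ring, hf]

/-- Parseval's identity bounds the truncated Hilbert transform of a periodic function. -/
theorem lintegral_truncHilbert_le_of_periodic {P x R : ℝ} (hP : 0 < P)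
    (hf : Function.Periodic f P)
    (h : MemLp f 2 (volume.restrict (Set.Ioc x (x + P)))) (hε : 0 < ε) (hR : ε < R) :
    ∫⁻ t in Set.Ioc x (x + P), ‖truncHilbert ε R f t‖ₑ ^ 2 ≤
      36 * ∫⁻ t in Set.Ioc x (x + P), ‖f t‖ₑ ^ 2 := by
  obtain ⟨a, b, hw⟩ := WindowBound.exists_of_periodic hP hf h
  have hab : x < x + P := by linarith
  have hT : MemLp (truncHilbert ε R f) 2 (volume.restrict (Set.Ioc x (x + P))) := by
    have hb := hw.abs_truncHilbert_le hε (R := R) (by linarith)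
    exact MemLp.of_bound (aestronglyMeasurable_truncHilbert hw.1 ε R).restrict _ (ae_of_all _ hb)
  have p1 := hasSum_sq_fourierCoeffOn hab h.ofReal
  have p2 := hasSum_sq_fourierCoeffOn hab hT.ofReal
  -- convolution multiplies the Fourier coefficients by the Fourier transform of the kernel
  have hcoef : ∀ n : ℤ, ‖fourierCoeffOn hab (fun t => (truncHilbert ε R f t : ℂ)) n‖ ≤
      6 * ‖fourierCoeffOn hab (fun t => (f t : ℂ)) n‖ := by
    intro n
    set ω : ℝ := 2 * Real.pi * n / P with hω
    have hexp : ∀ t : ℝ, fourier (-n) (t : AddCircle (x + P - x)) =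
        Complex.exp (-(ω * t * Complex.I)) := by
      intro t
      rw [fourier_coe_apply, hω]
      congr 1
      push_cast
      rw [add_sub_cancel_left]
      ring
    rw [fourierCoeffOn_eq_integral, fourierCoeffOn_eq_integral]
    simp only [hexp, norm_smul, smul_eq_mul]
    rw [← mul_assoc, mul_comm (6 : ℝ), mul_assoc]
    refine mul_le_mul_of_nonneg_left ?_ (norm_nonneg _)
    set κ : ℝ → ℂ := fun s => (hilbertKernel ε R s : ℂ) * Complex.exp (-(ω * s * Complex.I))
    set q : ℝ → ℂ := fun t => Complex.exp (-(ω * t * Complex.I)) * (f t : ℂ) with hq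
    have hκ : Integrable κ := by
      refine (integrable_hilbertKernel hε R).ofReal.mul_bdd (c := 1)
        (Continuous.aestronglyMeasurable (by fun_prop)) (ae_of_all _ fun s => ?_)
      rw [Complex.norm_exp]
      simp
    have hqp : Function.Periodic q P := by
      intro t
      simp only [hq, hf t]
      congr 1
      rw [Complex.exp_eq_exp_iff_exists_int]
      refine ⟨-n, ?_⟩
      have : (P : ℂ) ≠ 0 := by exact_mod_cast hP.ne'
      rw [hω]
      push_cast
      field_simp
      ring
    have hqm : AEStronglyMeasurable q :=
      (Continuous.aestronglyMeasurable (by fun_prop)).mul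
        (Complex.continuous_ofReal.comp_aestronglyMeasurable hw.1)
    have hqi : IntervalIntegrable q volume x (x + P) := by
      have hi := hw.intervalIntegrable x (x + P)
      have : IntervalIntegrable (fun t => (f t : ℂ)) volume x (x + P) := ⟨hi.1.ofReal, hi.2.ofReal⟩
      exact this.continuousOn_mul (by fun_prop)
    have hconv := integral_convolution_of_periodic hP hκ hqp x hqm hqi
    have hL : ∀ t : ℝ, Complex.exp (-(ω * t * Complex.I)) * (truncHilbert ε R f t : ℂ) =
        ∫ s, κ s * q (t - s) := by
      intro t
      rw [truncHilbert, ← integral_complex_ofReal, ← integral_const_mul]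
      congr 1
      ext s
      simp only [κ, q]
      have : Complex.exp (-(ω * t * Complex.I)) = Complex.exp (-(ω * s * Complex.I)) *
          Complex.exp (-(ω * (t - s : ℝ) * Complex.I)) := by
        rw [← Complex.exp_add]
        congr 1
        push_cast
        ring
      rw [this]
      push_cast
      ring
    simp only [hL]
    rw [hconv, norm_mul]
    exact mul_le_mul_of_nonneg_right (norm_integral_hilbertKernel_le hε hR ω) (norm_nonneg _)
  have hsum : (x + P - x)⁻¹ • ∫ t in x..(x + P), ‖(truncHilbert ε R f t : ℂ)‖ ^ 2 ≤
      36 * ((x + P - x)⁻¹ • ∫ t in x..(x + P), ‖(f t : ℂ)‖ ^ 2) := by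
    refine hasSum_le (fun n => ?_) p2 (p1.mul_left 36)
    have := pow_le_pow_left₀ (norm_nonneg _) (hcoef n) 2
    rw [mul_pow] at this
    norm_num at this
    exact this
  rw [add_sub_cancel_left, smul_eq_mul, smul_eq_mul, mul_left_comm,
    mul_le_mul_iff_of_pos_left (inv_pos.2 hP)] at hsum
  simp only [Complex.norm_real, Real.norm_eq_abs, sq_abs] at hsum
  rw [intervalIntegral.integral_of_le hab.le, intervalIntegral.integral_of_le hab.le] at hsum
  simp only [enorm_sq_eq_ofReal]
  rw [← ofReal_integral_eq_lintegral_ofReal hT.integrable_sq (ae_of_all _ fun t => sq_nonneg _),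
    ← ofReal_integral_eq_lintegral_ofReal h.integrable_sq (ae_of_all _ fun t => sq_nonneg _),
    ← ENNReal.ofReal_ofNat 36, ← ENNReal.ofReal_mul (by norm_num)]
  exact ENNReal.ofReal_le_ofReal hsum

theorem WindowBound.truncHilbert_of_periodic {P x R : ℝ} (hP : 0 < P)
    (hf : Function.Periodic f P)
    (h : MemLp f 2 (volume.restrict (Set.Ioc x (x + P)))) {A : ℝ≥0}
    (hA : ∫⁻ t in Set.Ioc x (x + P), ‖f t‖ₑ ^ 2 ≤ A) (hε : 0 < ε) (hR : ε < R) :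
    WindowBound (truncHilbert ε R f) (36 * A / P.toNNReal) (36 * A) := by
  refine WindowBound.of_periodic (x := x) hP (truncHilbert_periodic hf ε R)
    (aestronglyMeasurable_truncHilbert ?_ ε R).restrict ?_
  · exact aestronglyMeasurable_of_periodic hP hf h.1
  · refine (lintegral_truncHilbert_le_of_periodic hP hf h hε hR).trans ?_
    push_cast
    gcongr

/-- On a window, the truncated Hilbert transform only depends on a larger window, outside of which
the function can be replaced by a periodic one. -/
theorem WindowBound.truncHilbert_of_memLp (hf : MemLp f 2 volume) {A : ℝ≥0}
    (hA : ∫⁻ t, ‖f t‖ₑ ^ 2 ≤ A) {R : ℝ} (hε : 0 < ε) (hR : ε < R) :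
    WindowBound (truncHilbert ε R f) 0 (36 * A) := by
  refine ⟨aestronglyMeasurable_truncHilbert hf.1 ε R, fun x L hL => ?_⟩
  set P : ℝ := L + 2 * R with hP'
  have hP : 0 < P := by linarith
  set q : ℝ → ℝ := fun t => f (toIocMod hP (x - R) t) with hq
  have hqp : Function.Periodic q P := fun t => by simp only [hq, toIocMod_add_right]
  have hqf : ∀ t ∈ Set.Ioc (x - R) (x - R + P), q t = f t := fun t ht => by
    simp only [hq]
    rw [(toIocMod_eq_self hP).2 ht]
  have hqL : MemLp q 2 (volume.restrict (Set.Ioc (x - R) (x - R + P))) := by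
    refine (memLp_congr_ae ?_).2 (hf.restrict _)
    filter_upwards [ae_restrict_mem measurableSet_Ioc] with t ht using hqf t ht
  have hT : ∀ t ∈ Set.Ioc x (x + L), truncHilbert ε R f t = truncHilbert ε R q t := by
    intro t ht
    simp only [truncHilbert]
    congr 1
    ext s
    rcases le_or_gt R |s| with hs | hs
    · rw [hilbertKernel_eq_zero hs, zero_mul, zero_mul]
    · rw [abs_lt] at hs
      rw [hqf (t - s) ⟨by linarith [ht.1, hs.2], by linarith [ht.2, hs.1]⟩]
  calc ∫⁻ t in Set.Ioc x (x + L), ‖truncHilbert ε R f t‖ₑ ^ 2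
      = ∫⁻ t in Set.Ioc x (x + L), ‖truncHilbert ε R q t‖ₑ ^ 2 :=
        setLIntegral_congr_fun measurableSet_Ioc fun t ht => by simp only [hT t ht]
    _ ≤ ∫⁻ t in Set.Ioc (x - R) (x - R + P), ‖truncHilbert ε R q t‖ₑ ^ 2 :=
        lintegral_mono_set (Set.Ioc_subset_Ioc (by linarith) (by linarith))
    _ ≤ 36 * ∫⁻ t in Set.Ioc (x - R) (x - R + P), ‖q t‖ₑ ^ 2 :=
        lintegral_truncHilbert_le_of_periodic hP hqp hqL hε hR
    _ = 36 * ∫⁻ t in Set.Ioc (x - R) (x - R + P), ‖f t‖ₑ ^ 2 := by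
        congr 1
        exact setLIntegral_congr_fun measurableSet_Ioc fun t ht => by simp only [hqf t ht]
    _ ≤ 36 * A := by
        gcongr
        exact (setLIntegral_le_lintegral _ _).trans hA
    _ = _ := by push_cast; simp

end

/-! ### Convolution with integrable causal kernels -/

/-- The Cauchy-Schwarz inequality with respect to the measure with density `g`. -/
theorem sq_lintegral_mul_le {α : Type*} [MeasurableSpace α] {μ : Measure α} {g h : α → ℝ≥0∞}
    (hg : AEMeasurable g μ) (hh : AEMeasurable h μ) :
    (∫⁻ t, g t * h t ∂μ) ^ 2 ≤ (∫⁻ t, g t ∂μ) * ∫⁻ t, g t * h t ^ 2 ∂μ := by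
  have key := ENNReal.lintegral_mul_le_Lp_mul_Lq μ Real.HolderConjugate.two_two
    (hg.pow_const (1 / 2 : ℝ)) ((hg.pow_const (1 / 2 : ℝ)).mul hh)
  have e1 : ∀ t, g t ^ (1 / 2 : ℝ) * (g t ^ (1 / 2 : ℝ) * h t) = g t * h t := fun t => by
    rw [← mul_assoc, ← ENNReal.rpow_add_of_nonneg _ _ (by norm_num) (by norm_num)]
    norm_num
  have e2 : ∀ t, (g t ^ (1 / 2 : ℝ)) ^ (2 : ℝ) = g t := fun t => by
    rw [← ENNReal.rpow_mul]; norm_num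
  have e3 : ∀ t, (g t ^ (1 / 2 : ℝ) * h t) ^ (2 : ℝ) = g t * h t ^ 2 := fun t => by
    rw [ENNReal.mul_rpow_of_nonneg _ _ (by norm_num), e2, ENNReal.rpow_two]
  simp only [Pi.mul_apply, e1, e2, e3] at key
  refine (pow_le_pow_left' key 2).trans (le_of_eq ?_)
  rw [mul_pow, ← ENNReal.rpow_two, ← ENNReal.rpow_two, ← ENNReal.rpow_mul, ← ENNReal.rpow_mul]
  norm_num

section

variable {f g : ℝ → ℝ} {a b : ℝ≥0}

theorem WindowBound.lintegral_comp_sub_le (hf : WindowBound f a b) (τ x : ℝ) {L : ℝ}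
    (hL : 0 ≤ L) :
    ∫⁻ t in Set.Ioc x (x + L), ‖f (t - τ)‖ₑ ^ 2 ≤ a * ENNReal.ofReal L + b := by
  have h := (measurePreserving_sub_right volume τ).setLIntegral_comp_preimage_emb
    (MeasurableEquiv.subRight τ).measurableEmbedding (fun t => ‖f t‖ₑ ^ 2)
    (Set.Ioc (x - τ) (x - τ + L))
  have hs : (fun t => t - τ) ⁻¹' Set.Ioc (x - τ) (x - τ + L) = Set.Ioc x (x + L) := by
    ext t
    simp only [Set.mem_preimage, Set.mem_Ioc]
    constructor <;> rintro ⟨h1, h2⟩ <;> constructor <;> linarith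
  rw [hs] at h
  rw [h]
  exact hf.2 _ _ hL

theorem WindowBound.aestronglyMeasurable_convolution_integrand (hf : WindowBound f a b)
    (hg : IntegrableOn g (Set.Ioi 0)) :
    AEStronglyMeasurable (fun p : ℝ × ℝ => g p.2 * f (p.1 - p.2))
      (volume.prod (volume.restrict (Set.Ioi 0))) :=
  AEStronglyMeasurable.convolution_integrand (μ := volume) (ν := volume.restrict (Set.Ioi 0))
    (ContinuousLinearMap.mul ℝ ℝ) hg.1 hf.1

theorem WindowBound.lintegral_convolution_le (hf : WindowBound f a b)
    (hg : IntegrableOn g (Set.Ioi 0)) (x : ℝ) {L : ℝ} (hL : 0 ≤ L) :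
    ∫⁻ t in Set.Ioc x (x + L), (∫⁻ τ in Set.Ioi (0 : ℝ), ‖g τ‖ₑ * ‖f (t - τ)‖ₑ) ^ 2 ≤
      (∫⁻ τ in Set.Ioi (0 : ℝ), ‖g τ‖ₑ) ^ 2 * (a * ENNReal.ofReal L + b) := by
  set N := ∫⁻ τ in Set.Ioi (0 : ℝ), ‖g τ‖ₑ with hN
  have hNt : N ≠ ⊤ := hg.2.ne
  have hfτ : ∀ t, AEStronglyMeasurable (fun τ => f (t - τ)) (volume.restrict (Set.Ioi 0)) :=
    fun t => (hf.1.comp_quasiMeasurePreserving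
      (quasiMeasurePreserving_sub_left_of_right_invariant volume t)).restrict
  have hgm : AEMeasurable (fun p : ℝ × ℝ => ‖g p.2‖ₑ)
      ((volume.restrict (Set.Ioc x (x + L))).prod (volume.restrict (Set.Ioi 0))) :=
    hg.1.enorm.comp_quasiMeasurePreserving Measure.quasiMeasurePreserving_snd
  have hfm : AEMeasurable (fun p : ℝ × ℝ => ‖f (p.1 - p.2)‖ₑ ^ 2)
      ((volume.restrict (Set.Ioc x (x + L))).prod (volume.restrict (Set.Ioi 0))) := by
    have h := hf.1.comp_quasiMeasurePreserving
      (quasiMeasurePreserving_sub_of_right_invariant volume (volume.restrict (Set.Ioi (0 : ℝ))))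
    have := h.mono_ac ((Measure.absolutelyContinuous_of_le
      (Measure.restrict_le_self (s := Set.Ioc x (x + L)))).prod Measure.AbsolutelyContinuous.rfl)
    exact this.enorm.pow_const 2
  calc ∫⁻ t in Set.Ioc x (x + L), (∫⁻ τ in Set.Ioi (0 : ℝ), ‖g τ‖ₑ * ‖f (t - τ)‖ₑ) ^ 2
      ≤ ∫⁻ t in Set.Ioc x (x + L), N * ∫⁻ τ in Set.Ioi (0 : ℝ), ‖g τ‖ₑ * ‖f (t - τ)‖ₑ ^ 2 :=
        lintegral_mono fun t => sq_lintegral_mul_le hg.1.enorm (hfτ t).enorm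
    _ = N * ∫⁻ τ in Set.Ioi (0 : ℝ), ‖g τ‖ₑ * ∫⁻ t in Set.Ioc x (x + L), ‖f (t - τ)‖ₑ ^ 2 := by
        rw [lintegral_const_mul' _ _ hNt, lintegral_lintegral_swap (hgm.mul hfm)]
        congr 1
        refine lintegral_congr fun τ => ?_
        rw [lintegral_const_mul' _ _ (by finiteness)]
    _ ≤ N * ∫⁻ τ in Set.Ioi (0 : ℝ), ‖g τ‖ₑ * (a * ENNReal.ofReal L + b) := by
        gcongr
        exact hf.lintegral_comp_sub_le _ x hL
    _ = _ := by
        rw [lintegral_mul_const' _ _ (by finiteness), ← mul_assoc, sq]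

theorem WindowBound.ae_integrable_convolution (hf : WindowBound f a b)
    (hg : IntegrableOn g (Set.Ioi 0)) :
    ∀ᵐ t, IntegrableOn (fun τ => g τ * f (t - τ)) (Set.Ioi 0) := by
  have hm := hf.aestronglyMeasurable_convolution_integrand hg
  have hm' : AEMeasurable (fun t => ∫⁻ τ in Set.Ioi (0 : ℝ), ‖g τ‖ₑ * ‖f (t - τ)‖ₑ) := by
    have := hm.enorm.lintegral_prod_right'
    simpa only [enorm_mul] using this
  have hN : (∫⁻ τ in Set.Ioi (0 : ℝ), ‖g τ‖ₑ) ≠ ⊤ := hg.2.ne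
  have hwin : ∀ n : ℕ, ∀ᵐ t, t ∈ Set.Ioc (-(n : ℝ)) (-n + 2 * n) →
      ∫⁻ τ in Set.Ioi (0 : ℝ), ‖g τ‖ₑ * ‖f (t - τ)‖ₑ < ⊤ := by
    intro n
    have h := hf.lintegral_convolution_le hg (-(n : ℝ)) (L := 2 * n) (by positivity)
    have h2 := ae_lt_top' (hm'.restrict.pow_const 2) (h.trans_lt (by finiteness)).ne
    rw [ae_restrict_iff' measurableSet_Ioc] at h2
    filter_upwards [h2] with t ht htm
    have := ht htm
    contrapose! this
    rw [top_le_iff] at this ⊢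
    rw [this]
    rfl
  filter_upwards [ae_all_iff.2 hwin, hm.prodMk_left] with t ht htm
  refine ⟨htm, ?_⟩
  obtain ⟨n, hn⟩ := exists_nat_gt |t|
  rw [abs_lt] at hn
  have := ht n ⟨hn.1, by linarith [hn.2]⟩
  simpa only [HasFiniteIntegral, enorm_mul] using this

/-- Young's inequality: convolution with an integrable causal kernel preserves window bounds. -/
theorem WindowBound.convolution (hf : WindowBound f a b) (hg : IntegrableOn g (Set.Ioi 0)) :
    WindowBound (fun t => ∫ τ in Set.Ioi (0 : ℝ), g τ * f (t - τ))
      ((∫⁻ τ in Set.Ioi (0 : ℝ), ‖g τ‖ₑ).toNNReal ^ 2 * a)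
      ((∫⁻ τ in Set.Ioi (0 : ℝ), ‖g τ‖ₑ).toNNReal ^ 2 * b) := by
  have hN : (∫⁻ τ in Set.Ioi (0 : ℝ), ‖g τ‖ₑ) ≠ ⊤ := hg.2.ne
  refine ⟨(hf.aestronglyMeasurable_convolution_integrand hg).integral_prod_right', fun x L hL => ?_⟩
  calc ∫⁻ t in Set.Ioc x (x + L), ‖∫ τ in Set.Ioi (0 : ℝ), g τ * f (t - τ)‖ₑ ^ 2
      ≤ ∫⁻ t in Set.Ioc x (x + L), (∫⁻ τ in Set.Ioi (0 : ℝ), ‖g τ‖ₑ * ‖f (t - τ)‖ₑ) ^ 2 := by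
        refine lintegral_mono fun t => ?_
        simp only [← enorm_mul]
        gcongr
        exact enorm_integral_le_lintegral_enorm _
    _ ≤ _ := hf.lintegral_convolution_le hg x hL
    _ = _ := by
        push_cast
        rw [ENNReal.coe_toNNReal hN]
        ring

end

/-! ### Time averages -/

theorem HasTimeAverage.add {f g : ℝ → ℝ} {a b : ℝ} (hf : HasTimeAverage f a)
    (hg : HasTimeAverage g b) (hfi : ∀ T, IntervalIntegrable f volume (-T) T)
    (hgi : ∀ T, IntervalIntegrable g volume (-T) T) :
    HasTimeAverage (fun t => f t + g t) (a + b) := by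
  refine (Tendsto.add hf hg).congr fun T => ?_
  rw [intervalIntegral.integral_add (hfi T) (hgi T)]
  ring

theorem HasTimeAverage.sub {f g : ℝ → ℝ} {a b : ℝ} (hf : HasTimeAverage f a)
    (hg : HasTimeAverage g b) (hfi : ∀ T, IntervalIntegrable f volume (-T) T)
    (hgi : ∀ T, IntervalIntegrable g volume (-T) T) :
    HasTimeAverage (fun t => f t - g t) (a - b) := by
  refine (Tendsto.sub hf hg).congr fun T => ?_
  rw [intervalIntegral.integral_sub (hfi T) (hgi T)]
  ring

theorem HasTimeAverage.const_mul {f : ℝ → ℝ} {a : ℝ} (hf : HasTimeAverage f a) (c : ℝ) :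
    HasTimeAverage (fun t => c * f t) (c * a) := by
  refine (Tendsto.const_mul c hf).congr fun T => ?_
  rw [intervalIntegral.integral_const_mul]
  ring

theorem HasTimeAverage.sum {ι : Type*} {s : Finset ι} {f : ι → ℝ → ℝ} {a : ι → ℝ}
    (hf : ∀ i ∈ s, HasTimeAverage (f i) (a i))
    (hfi : ∀ i ∈ s, ∀ T, IntervalIntegrable (f i) volume (-T) T) :
    HasTimeAverage (fun t => ∑ i ∈ s, f i t) (∑ i ∈ s, a i) := by
  refine (tendsto_finsetSum s hf).congr fun T => ?_
  rw [intervalIntegral.integral_finsetSum fun i hi => hfi i hi T, Finset.mul_sum]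

/-- The time average of a complex exponential vanishes unless its frequency is zero. -/
theorem hasTimeAverage_exp (ν : ℝ) (c : ℂ) :
    HasTimeAverage (fun t => (c * Complex.exp (ν * t * Complex.I)).re)
      (if ν = 0 then c.re else 0) := by
  split_ifs with h
  · subst h
    simp only [HasTimeAverage, Complex.ofReal_zero, zero_mul, Complex.exp_zero, mul_one,
      intervalIntegral.integral_const, smul_eq_mul, sub_neg_eq_add]
    refine tendsto_const_nhds.congr' ?_
    filter_upwards [eventually_gt_atTop 0] with T hT
    field_simp
    ring
  · have hI : ∀ T : ℝ, ∫ t in (-T)..T, (c * Complex.exp (ν * t * Complex.I)).re =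
        (c * ((Complex.exp (ν * Complex.I * T) - Complex.exp (ν * Complex.I * (-T : ℝ))) /
          (ν * Complex.I))).re := by
      intro T
      have hν : (ν : ℂ) * Complex.I ≠ 0 := by simpa using h
      rw [← integral_exp_mul_complex hν, ← intervalIntegral.integral_const_mul]
      have := intervalIntegral.intervalIntegral_re (𝕜 := ℂ) (a := -T) (b := T) (μ := volume)
        (f := fun t : ℝ => c * Complex.exp (ν * Complex.I * t))
        (Continuous.intervalIntegrable (by fun_prop) _ _)
      simp only [RCLike.re_eq_complex_re] at this
      rw [← this]
      congr 1
      ext t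
      congr 3
      ring
    have hb : ∀ T : ℝ, ‖∫ t in (-T)..T, (c * Complex.exp (ν * t * Complex.I)).re‖ ≤
        ‖c‖ * (2 / |ν|) := by
      intro T
      rw [hI]
      refine (Complex.abs_re_le_norm _).trans ?_
      rw [norm_mul, norm_div, norm_mul, Complex.norm_I, mul_one, Complex.norm_real,
        Real.norm_eq_abs]
      gcongr
      refine (norm_sub_le _ _).trans (le_of_eq ?_)
      rw [Complex.norm_exp, Complex.norm_exp]
      norm_num
    have h0 : Tendsto (fun T : ℝ => (2 * T)⁻¹) atTop (𝓝 0) :=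
      (tendsto_id.const_mul_atTop two_pos).inv_tendsto_atTop
    unfold HasTimeAverage
    refine squeeze_zero_norm' (a := fun T : ℝ => (2 * T)⁻¹ * (‖c‖ * (2 / |ν|))) ?_ ?_
    · filter_upwards [eventually_gt_atTop 0] with T hT
      rw [norm_mul, Real.norm_of_nonneg (by positivity : 0 ≤ (2 * T)⁻¹)]
      gcongr
      exact hb T
    · simpa using h0.mul_const (‖c‖ * (2 / |ν|))

/-! ### Trigonometric polynomials -/

/-- The exponential sum `∑ c(ω) e^{jωt}` over a finite set of frequencies. -/
def expSum (s : Finset ℝ) (c : ℝ → ℂ) (t : ℝ) : ℂ :=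
  ∑ ω ∈ s, c ω * Complex.exp (ω * t * Complex.I)

@[fun_prop]
theorem continuous_expSum (s : Finset ℝ) (c : ℝ → ℂ) : Continuous (expSum s c) := by
  unfold expSum
  fun_prop

theorem norm_expSum_le (s : Finset ℝ) (c : ℝ → ℂ) (t : ℝ) : ‖expSum s c t‖ ≤ ∑ ω ∈ s, ‖c ω‖ := by
  refine (norm_sum_le _ _).trans (Finset.sum_le_sum fun ω _ => ?_)
  rw [norm_mul, Complex.norm_exp]
  simp

theorem expSum_subset {s s' : Finset ℝ} {c : ℝ → ℂ} (h : s ⊆ s')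
    (hc : ∀ ω ∈ s', ω ∉ s → c ω = 0) : expSum s c = expSum s' c := by
  ext t
  exact Finset.sum_subset h fun ω h1 h2 => by rw [hc ω h1 h2, zero_mul]

theorem expSum_support_add (A B : ℝ →₀ ℂ) (t : ℝ) :
    expSum (A + B).support (⇑(A + B)) t = expSum A.support A t + expSum B.support B t :=
  Finsupp.sum_add_index' (h := fun (ω : ℝ) x => x * Complex.exp (ω * t * Complex.I))
    (fun _ => zero_mul _) (fun _ _ _ => add_mul _ _ _)

theorem windowBound_of_abs_le {f : ℝ → ℝ} (hf : AEStronglyMeasurable f) {B : ℝ}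
    (hB : ∀ t, |f t| ≤ B) : ∃ a, WindowBound f a 0 := by
  have h0 : 0 ≤ B := (abs_nonneg _).trans (hB 0)
  refine ⟨B.toNNReal ^ 2, hf, fun x L hL => ?_⟩
  calc ∫⁻ t in Set.Ioc x (x + L), ‖f t‖ₑ ^ 2
      ≤ ∫⁻ _ in Set.Ioc x (x + L), ENNReal.ofReal B ^ 2 := by
        refine lintegral_mono fun t => ?_
        rw [Real.enorm_eq_ofReal_abs]
        gcongr
        exact hB t
    _ = _ := by
        rw [setLIntegral_const, Real.volume_Ioc, add_sub_cancel_left]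
        simp [ENNReal.ofReal]

theorem exists_windowBound_re_expSum (s : Finset ℝ) (c : ℝ → ℂ) :
    ∃ a, WindowBound (fun t => (expSum s c t).re) a 0 :=
  windowBound_of_abs_le (Continuous.aestronglyMeasurable (by fun_prop))
    fun t => (Complex.abs_re_le_norm _).trans (norm_expSum_le s c t)

theorem exists_windowBound_im_expSum (s : Finset ℝ) (c : ℝ → ℂ) :
    ∃ a, WindowBound (fun t => (expSum s c t).im) a 0 :=
  windowBound_of_abs_le (Continuous.aestronglyMeasurable (by fun_prop))
    fun t => (Complex.abs_im_le_norm _).trans (norm_expSum_le s c t)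

/-- Products of terms with non-negative frequencies average to zero, except for the constant ones. -/
theorem hasTimeAverage_mul_expSum {s : Finset ℝ} (hs : ∀ ω ∈ s, 0 ≤ ω) (z : ℂ) (c d : ℝ → ℂ) :
    HasTimeAverage (fun t => (z * (expSum s c t * expSum s d t)).re)
      (∑ ω ∈ s, if ω = 0 then (z * (c ω * d ω)).re else 0) := by
  have h1 : ∀ ω ∈ s, ∀ ν ∈ s, HasTimeAverage
      (fun t => (z * (c ω * d ν) * Complex.exp ((ω + ν : ℝ) * t * Complex.I)).re)
      (if ω + ν = 0 then (z * (c ω * d ν)).re else 0) := fun ω _ ν _ =>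
    hasTimeAverage_exp _ _
  have h2 := HasTimeAverage.sum (s := s) (fun ω hω => HasTimeAverage.sum (h1 ω hω)
    fun ν _ T => Continuous.intervalIntegrable (by fun_prop) _ _)
    fun ω _ T => Continuous.intervalIntegrable (by fun_prop) _ _
  convert h2 using 1
  · ext t
    simp only [← Complex.re_sum]
    congr 1
    rw [expSum, expSum, Finset.sum_mul_sum, Finset.mul_sum]
    refine Finset.sum_congr rfl fun ω _ => ?_
    rw [Finset.mul_sum]
    refine Finset.sum_congr rfl fun ν _ => ?_
    have : Complex.exp ((ω + ν : ℝ) * t * Complex.I) =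
        Complex.exp (ω * t * Complex.I) * Complex.exp (ν * t * Complex.I) := by
      rw [← Complex.exp_add]
      congr 1
      push_cast
      ring
    rw [this]
    ring
  · refine Finset.sum_congr rfl fun ω hω => ?_
    by_cases h0 : ω = 0
    · subst h0
      rw [Finset.sum_eq_single_of_mem (0 : ℝ) hω fun ν _ hν => by simp [hν]]
      simp
    · rw [if_neg h0]
      refine (Finset.sum_eq_zero fun ν hν => if_neg ?_).symm
      have := hs ν hν
      have := lt_of_le_of_ne (hs ω hω) (Ne.symm h0)
      exact (by linarith : 0 < ω + ν).ne'

/-- Terms with distinct frequencies are orthogonal. -/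
theorem hasTimeAverage_conj_mul_expSum (s : Finset ℝ) (z : ℂ) (c d : ℝ → ℂ) :
    HasTimeAverage (fun t => (z * (star (expSum s c t) * expSum s d t)).re)
      (∑ ω ∈ s, (z * (star (c ω) * d ω)).re) := by
  have h1 : ∀ ω ∈ s, ∀ ν ∈ s, HasTimeAverage
      (fun t => (z * (star (c ω) * d ν) * Complex.exp ((ν - ω : ℝ) * t * Complex.I)).re)
      (if ν - ω = 0 then (z * (star (c ω) * d ν)).re else 0) := fun ω _ ν _ =>
    hasTimeAverage_exp _ _
  have h2 := HasTimeAverage.sum (s := s) (fun ω hω => HasTimeAverage.sum (h1 ω hω)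
    fun ν _ T => Continuous.intervalIntegrable (by fun_prop) _ _)
    fun ω _ T => Continuous.intervalIntegrable (by fun_prop) _ _
  convert h2 using 1
  · ext t
    simp only [← Complex.re_sum]
    congr 1
    rw [expSum, expSum, star_sum, Finset.sum_mul_sum, Finset.mul_sum]
    refine Finset.sum_congr rfl fun ω _ => ?_
    rw [Finset.mul_sum]
    refine Finset.sum_congr rfl fun ν _ => ?_
    have : Complex.exp ((ν - ω : ℝ) * t * Complex.I) =
        star (Complex.exp (ω * t * Complex.I)) * Complex.exp (ν * t * Complex.I) := by
      rw [Complex.star_def, ← Complex.exp_conj, ← Complex.exp_add]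
      congr 1
      simp only [map_mul, Complex.conj_ofReal, Complex.conj_I]
      push_cast
      ring
    rw [this, star_mul']
    ring
  · refine Finset.sum_congr rfl fun ω hω => ?_
    rw [Finset.sum_eq_single_of_mem ω hω fun ν _ hν => by simp [sub_eq_zero, hν]]
    simp

/-- The weight of a frequency in the averages of products of the real parts of exponential sums
over non-negative frequencies. -/
def freqWeight (ω : ℝ) : ℝ := if ω = 0 then 1 else 1 / 2

theorem freqWeight_pos (ω : ℝ) : 0 < freqWeight ω := by
  unfold freqWeight
  split_ifs <;> norm_num

theorem hasTimeAverage_re_mul_re {s : Finset ℝ} (hs : ∀ ω ∈ s, 0 ≤ ω) {c d : ℝ → ℂ}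
    (hc : (c 0).im = 0) :
    HasTimeAverage (fun t => (expSum s c t).re * (expSum s d t).re)
      (∑ ω ∈ s, freqWeight ω * (star (c ω) * d ω).re) := by
  have h := ((hasTimeAverage_mul_expSum hs 1 c d).const_mul (1 / 2)).add
    ((hasTimeAverage_conj_mul_expSum s 1 c d).const_mul (1 / 2))
    (fun T => Continuous.intervalIntegrable (by fun_prop) _ _)
    (fun T => Continuous.intervalIntegrable (by fun_prop) _ _)
  convert h using 1
  · ext t
    simp
    ring
  · rw [Finset.mul_sum, Finset.mul_sum, ← Finset.sum_add_distrib]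
    refine Finset.sum_congr rfl fun ω _ => ?_
    unfold freqWeight
    split_ifs with h0
    · subst h0
      simp [hc]
      ring
    · simp

theorem hasTimeAverage_im_mul_re {s : Finset ℝ} (hs : ∀ ω ∈ s, 0 ≤ ω) {c d : ℝ → ℂ}
    (hc : (c 0).im = 0) (hd : (d 0).im = 0) :
    HasTimeAverage (fun t => (expSum s c t).im * (expSum s d t).re)
      (-∑ ω ∈ s, freqWeight ω * (star (c ω) * d ω).im) := by
  have h := ((hasTimeAverage_mul_expSum hs (-Complex.I) c d).const_mul (1 / 2)).sub
    ((hasTimeAverage_conj_mul_expSum s (-Complex.I) c d).const_mul (1 / 2))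
    (fun T => Continuous.intervalIntegrable (by fun_prop) _ _)
    (fun T => Continuous.intervalIntegrable (by fun_prop) _ _)
  convert h using 1
  · ext t
    simp
    ring
  · rw [Finset.mul_sum, Finset.mul_sum, ← Finset.sum_sub_distrib, ← Finset.sum_neg_distrib]
    refine Finset.sum_congr rfl fun ω _ => ?_
    unfold freqWeight
    split_ifs with h0
    · subst h0
      simp [hc, hd]
    · simp

/-- Convolution with an integrable kernel multiplies the coefficients of an exponential sum. -/
theorem integral_mul_re_expSum {μ : Measure ℝ} {κ : ℝ → ℝ} (hκ : Integrable κ μ) (s : Finset ℝ)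
    (c : ℝ → ℂ) (t : ℝ) :
    ∫ τ, κ τ * (expSum s c (t - τ)).re ∂μ =
      (expSum s (fun ω => (∫ τ, (κ τ : ℂ) * Complex.exp (-(ω * τ * Complex.I)) ∂μ) * c ω) t).re := by
  have hi : ∀ ω : ℝ, Integrable (fun τ => (κ τ : ℂ) * Complex.exp (-(ω * τ * Complex.I))) μ := by
    intro ω
    refine hκ.ofReal.mul_bdd (c := 1) (Continuous.aestronglyMeasurable (by fun_prop))
      (ae_of_all _ fun s => ?_)
    rw [Complex.norm_exp]
    simp
  have h1 : ∀ τ, κ τ * (expSum s c (t - τ)).re =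
      RCLike.re (∑ ω ∈ s, (κ τ : ℂ) * Complex.exp (-(ω * τ * Complex.I)) *
        (c ω * Complex.exp (ω * t * Complex.I))) := by
    intro τ
    rw [RCLike.re_eq_complex_re, ← Complex.re_ofReal_mul, expSum, Finset.mul_sum]
    congr 1
    refine Finset.sum_congr rfl fun ω _ => ?_
    have : Complex.exp (ω * (t - τ : ℝ) * Complex.I) =
        Complex.exp (-(ω * τ * Complex.I)) * Complex.exp (ω * t * Complex.I) := by
      rw [← Complex.exp_add]
      congr 1
      push_cast
      ring
    rw [this]
    ring
  simp only [h1]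
  rw [integral_re (integrable_finsetSum _ fun ω _ => (hi ω).mul_const _),
    integral_finsetSum _ fun ω _ => (hi ω).mul_const _]
  simp only [integral_mul_const, RCLike.re_eq_complex_re, expSum]
  simp only [mul_assoc]

theorem truncHilbert_re_expSum {ε R : ℝ} (hε : 0 < ε) (s : Finset ℝ) (c : ℝ → ℂ) (t : ℝ) :
    truncHilbert ε R (fun t => (expSum s c t).re) t =
      (expSum s (fun ω => (∫ τ, (hilbertKernel ε R τ : ℂ) *
        Complex.exp (-(ω * τ * Complex.I))) * c ω) t).re :=
  integral_mul_re_expSum (integrable_hilbertKernel hε R) s c t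

/-- The Hilbert transform of the real part of an exponential sum over non-negative frequencies with
a real constant term is its imaginary part. -/
theorem tendsto_truncHilbert_re_expSum {s : Finset ℝ} (hs : ∀ ω ∈ s, 0 ≤ ω) {c : ℝ → ℂ}
    (hc : (c 0).im = 0) (t : ℝ) :
    Tendsto (fun q : ℝ × ℝ => truncHilbert q.1 q.2 (fun t => (expSum s c t).re) t)
      (𝓝[>] (0 : ℝ) ×ˢ atTop) (𝓝 (expSum s c t).im) := by
  have hlim : Tendsto (fun q : ℝ × ℝ => ∑ ω ∈ s, ((∫ τ, (hilbertKernel q.1 q.2 τ : ℂ) *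
        Complex.exp (-(ω * τ * Complex.I))) * c ω * Complex.exp (ω * t * Complex.I)).re)
      (𝓝[>] (0 : ℝ) ×ˢ atTop)
      (𝓝 (∑ ω ∈ s, (c ω * Complex.exp (ω * t * Complex.I)).im)) := by
    refine tendsto_finsetSum _ fun ω hω => ?_
    rcases (hs ω hω).eq_or_lt with h0 | h0
    · subst h0
      refine tendsto_const_nhds.congr' ?_
      filter_upwards [eventually_truncation] with q hq
      rw [integral_hilbertKernel_mul_exp hq.1 hq.2]
      simp [hc]
    · have h1 := ((tendsto_integral_hilbertKernel h0).mul_const (c ω)).mul_const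
        (Complex.exp (ω * t * Complex.I))
      have h2 := (Complex.continuous_re.tendsto _).comp h1
      have e : (c ω * Complex.exp (ω * t * Complex.I)).im =
          (-Complex.I * c ω * Complex.exp (ω * t * Complex.I)).re := by
        rw [mul_assoc, Complex.mul_re, Complex.mul_im]
        simp [add_comm]
      rw [e]
      exact h2
  rw [expSum, Complex.im_sum]
  refine hlim.congr' ?_
  filter_upwards [eventually_truncation] with q hq
  rw [truncHilbert_re_expSum hq.1, expSum, Complex.re_sum]

/-- Every real trigonometric monomial is the real part of an exponential sum over non-negative
frequencies with a real constant term. -/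
theorem exists_analytic_monomial (ω : ℝ) (z : ℂ) :
    ∃ A : ℝ →₀ ℂ, (∀ ν, A ν ≠ 0 → 0 ≤ ν) ∧ (A 0).im = 0 ∧
      ∀ t : ℝ, (expSum A.support A t).re = (z * Complex.exp (ω * t * Complex.I)).re := by
  have hsingle : ∀ (ν : ℝ) (w : ℂ) (t : ℝ), expSum (Finsupp.single ν w).support
      (Finsupp.single ν w) t = w * Complex.exp (ν * t * Complex.I) := fun ν w t =>
    Finsupp.sum_single_index (h := fun (ω : ℝ) x => x * Complex.exp (ω * t * Complex.I)) (zero_mul _)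
  have hsupp : ∀ (ν : ℝ) (w : ℂ), 0 ≤ ν → ∀ μ, Finsupp.single ν w μ ≠ 0 → 0 ≤ μ := by
    intro ν w hν μ hμ
    rw [Finsupp.single_apply_ne_zero] at hμ
    rw [hμ.1]; exact hν
  rcases lt_trichotomy ω 0 with h | h | h
  · refine ⟨Finsupp.single (-ω) (star z), hsupp _ _ (by linarith), ?_, fun t => ?_⟩
    · rw [Finsupp.single_eq_of_ne (by linarith)]
      simp
    · rw [hsingle, ← Complex.conj_re]
      congr 1
      rw [map_mul, Complex.star_def, Complex.conj_conj, ← Complex.exp_conj]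
      simp
  · subst h
    refine ⟨Finsupp.single 0 (z.re : ℂ), hsupp _ _ le_rfl, by simp, fun t => ?_⟩
    rw [hsingle]
    simp
  · refine ⟨Finsupp.single ω z, hsupp _ _ h.le, ?_, fun t => hsingle _ _ _ ▸ rfl⟩
    rw [Finsupp.single_eq_of_ne h.ne]
    simp

theorem exists_analytic_sum {ι : Type*} (s : Finset ι) (ω : ι → ℝ) (z : ι → ℂ) :
    ∃ A : ℝ →₀ ℂ, (∀ ν, A ν ≠ 0 → 0 ≤ ν) ∧ (A 0).im = 0 ∧
      ∀ t : ℝ, (expSum A.support A t).re =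
        (∑ n ∈ s, z n * Complex.exp (ω n * t * Complex.I)).re := by
  classical
  induction s using Finset.induction_on with
  | empty => exact ⟨0, by simp, by simp, by simp [expSum]⟩
  | insert n s hn ih =>
    obtain ⟨A, h1, h2, h3⟩ := ih
    obtain ⟨B, k1, k2, k3⟩ := exists_analytic_monomial (ω n) (z n)
    refine ⟨A + B, fun ν hν => ?_, ?_, fun t => ?_⟩
    · by_cases hA : A ν = 0
      · refine k1 ν fun hB => hν ?_
        simp [hA, hB]
      · exact h1 ν hA
    · simp [h2, k2]
    · rw [expSum_support_add, Complex.add_re, h3, k3, Finset.sum_insert hn, Complex.add_re, add_comm]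

/-- Density of the trigonometric polynomials in the square integrable periodic functions. -/
theorem exists_expSum_approx_periodic {p : ℝ → ℝ} {P : ℝ} (hP : 0 < P)
    (hp : Function.Periodic p P) (hL : MemLp p 2 (volume.restrict (Set.Ioc 0 (0 + P))))
    {η : ℝ≥0} (hη : 0 < η) :
    ∃ A : ℝ →₀ ℂ, (∀ ν, A ν ≠ 0 → 0 ≤ ν) ∧ (A 0).im = 0 ∧
      Function.Periodic (fun t => p t - (expSum A.support A t).re) P ∧
      ∫⁻ t in Set.Ioc 0 (0 + P), ‖p t - (expSum A.support A t).re‖ₑ ^ 2 ≤ η := by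
  have : Fact (0 < P) := ⟨hP⟩
  set f := AddCircle.liftIoc P 0 (fun t => (p t : ℂ)) with hf
  have hLc : MemLp f 2 AddCircle.haarAddCircle := (hL.ofReal (K := ℂ)).memLp_liftIoc.haarAddCircle
  set δ : ℝ := Real.sqrt (η / P) with hδ
  have hδ0 : 0 < δ := Real.sqrt_pos.2 (div_pos (by exact_mod_cast hη) hP)
  obtain ⟨F, hF⟩ : ∃ F : Finset ℤ, ‖∑ n ∈ F, fourierCoeff (hLc.toLp f) n • fourierLp 2 n -
      hLc.toLp f‖ < δ := by
    have h := hasSum_fourier_series_L2 (hLc.toLp f)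
    obtain ⟨F, hF⟩ := (Metric.tendsto_atTop.1 h δ hδ0)
    exact ⟨F, by simpa [dist_eq_norm] using hF F le_rfl⟩
  set c : ℤ → ℂ := fun n => fourierCoeff (hLc.toLp f) n
  set q : C(AddCircle P, ℂ) := ∑ n ∈ F, c n • fourier n with hq
  have hq' : ∑ n ∈ F, fourierCoeff (hLc.toLp f) n • fourierLp 2 n =
      ContinuousMap.toLp 2 AddCircle.haarAddCircle ℂ q := by
    rw [hq, map_sum]
    simp only [map_smul]
    rfl
  rw [hq', Lp.norm_def] at hF
  have hae : (ContinuousMap.toLp 2 AddCircle.haarAddCircle ℂ q - hLc.toLp f : Lp ℂ 2 _)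
      =ᵐ[AddCircle.haarAddCircle] fun x => q x - f x := by
    filter_upwards [Lp.coeFn_sub (ContinuousMap.toLp 2 AddCircle.haarAddCircle ℂ q) (hLc.toLp f),
      ContinuousMap.coeFn_toLp (p := 2) (𝕜 := ℂ) AddCircle.haarAddCircle q, hLc.coeFn_toLp]
      with x h1 h2 h3
    rw [h1, Pi.sub_apply, h2, h3]
  rw [eLpNorm_congr_ae hae] at hF
  have hfin : eLpNorm (fun x => q x - f x) 2 AddCircle.haarAddCircle < ENNReal.ofReal δ := by
    rw [← eLpNorm_congr_ae hae] at hF ⊢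
    exact (ENNReal.lt_ofReal_iff_toReal_lt (Lp.eLpNorm_ne_top _)).2 hF
  have hint : ∫⁻ x : AddCircle P, ‖q x - f x‖ₑ ^ 2 ∂AddCircle.haarAddCircle ≤
      ENNReal.ofReal (η / P) := by
    rw [eLpNorm_eq_lintegral_rpow_enorm_toReal (by norm_num) (by norm_num)] at hfin
    have := pow_le_pow_left' hfin.le 2
    rw [← ENNReal.ofReal_pow hδ0.le, hδ, Real.sq_sqrt (by positivity), ← ENNReal.rpow_two,
      ← ENNReal.rpow_mul] at this
    simpa using this
  have hvol : ∫⁻ t in Set.Ioc 0 (0 + P), ‖q t - f t‖ₑ ^ 2 ≤ η := by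
    rw [AddCircle.lintegral_preimage P 0 (fun x => ‖q x - f x‖ₑ ^ 2),
      AddCircle.volume_eq_smul_haarAddCircle, lintegral_smul_measure, smul_eq_mul]
    refine (mul_le_mul_right hint _).trans (le_of_eq ?_)
    rw [← ENNReal.ofReal_mul hP.le, mul_div_cancel₀ _ hP.ne']
    simp
  obtain ⟨A, h1, h2, h3⟩ := exists_analytic_sum F (fun n : ℤ => 2 * Real.pi * n / P) c
  have h4 : ∀ t : ℝ, (expSum A.support A t).re = (q t).re := by
    intro t
    rw [h3, hq]
    simp only [ContinuousMap.coe_sum, Finset.sum_apply, ContinuousMap.coe_smul, Pi.smul_apply,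
      smul_eq_mul, fourier_coe_apply]
    congr 1
    refine Finset.sum_congr rfl fun n _ => ?_
    congr 2
    push_cast
    ring
  refine ⟨A, h1, h2, fun t => ?_, ?_⟩
  · simp only [h4, hp t]
    rw [AddCircle.coe_add_period]
  · refine le_trans (setLIntegral_mono' measurableSet_Ioc fun t ht => ?_) hvol
    rw [h4]
    have hft : f (t : AddCircle P) = (p t : ℂ) := by
      rw [hf, AddCircle.liftIoc_coe_apply ht]
    rw [hft]
    have : p t - (q t).re = -(q t - (p t : ℂ)).re := by simp
    rw [this, enorm_neg]
    gcongr
    rw [enorm_le_iff_norm_le]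
    exact Complex.abs_re_le_norm _

/-! ### Power signals are approximable by trigonometric polynomials -/

/-- `f` can be approximated by the real parts of exponential sums over non-negative frequencies with
real constant terms, such that the remainder and all its truncated Hilbert transforms have
arbitrarily small power, uniformly on windows. -/
def HasTrigApprox (f : ℝ → ℝ) : Prop :=
  ∀ η : ℝ≥0, 0 < η → ∃ A : ℝ →₀ ℂ, (∀ ν, A ν ≠ 0 → 0 ≤ ν) ∧ (A 0).im = 0 ∧ ∃ b : ℝ≥0,
    WindowBound (fun t => f t - (expSum A.support A t).re) η b ∧
    ∀ ε R : ℝ, 0 < ε → ε < R →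
      WindowBound (truncHilbert ε R fun t => f t - (expSum A.support A t).re) η b

theorem HasTrigApprox.add {f g : ℝ → ℝ} (hf : HasTrigApprox f) (hg : HasTrigApprox g) :
    HasTrigApprox (fun t => f t + g t) := by
  intro η hη
  obtain ⟨A, h1, h2, b, h3, h4⟩ := hf (η / 4) (by positivity)
  obtain ⟨B, k1, k2, b', k3, k4⟩ := hg (η / 4) (by positivity)
  have hη4 : 2 * (η / 4 + η / 4) = η := by
    rw [← add_div, mul_div_assoc', div_eq_iff (by norm_num)]
    ring
  have hsum : (fun t => f t + g t - (expSum (A + B).support (⇑(A + B)) t).re) =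
      (fun t => f t - (expSum A.support A t).re) + fun t => g t - (expSum B.support B t).re := by
    ext t
    rw [expSum_support_add, Complex.add_re, Pi.add_apply]
    ring
  refine ⟨A + B, fun ν hν => ?_, by simp [h2, k2], 2 * (b + b'), ?_, fun ε R hε hR => ?_⟩
  · by_cases hA : A ν = 0
    · refine k1 ν fun hB => hν ?_
      simp [hA, hB]
    · exact h1 ν hA
  · rw [hsum]
    exact (h3.add k3).mono hη4.le le_rfl
  · rw [hsum, h3.truncHilbert_add k3 hε R]
    exact ((h4 ε R hε hR).add (k4 ε R hε hR)).mono hη4.le le_rfl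

/-- An `L₂` signal has zero power, and so have its truncated Hilbert transforms: it is approximated
by zero. -/
theorem HasTrigApprox.of_memLp {f : ℝ → ℝ} (hf : MemLp f 2 volume) : HasTrigApprox f := by
  intro η _
  obtain ⟨b, hb⟩ := WindowBound.exists_of_memLp hf
  have h2 := (memLp_two_iff_lintegral.1 hf).2
  have hzero : (fun t => f t - (expSum (0 : ℝ →₀ ℂ).support (0 : ℝ →₀ ℂ) t).re) = f := by
    ext t
    simp [expSum]
  refine ⟨0, by simp, by simp, b + 36 * (∫⁻ t, ‖f t‖ₑ ^ 2).toNNReal, ?_, fun ε R hε hR => ?_⟩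
  · rw [hzero]
    exact hb.mono zero_le le_self_add
  · rw [hzero]
    exact (WindowBound.truncHilbert_of_memLp hf (ENNReal.coe_toNNReal h2.ne).ge hε hR).mono
      zero_le le_add_self

theorem HasTrigApprox.of_periodic {f : ℝ → ℝ} {P : ℝ} (hP : 0 < P) (hf : Function.Periodic f P)
    (h : MemLp f 2 (volume.restrict (Set.Ioc 0 P))) : HasTrigApprox f := by
  intro η hη
  have h' : MemLp f 2 (volume.restrict (Set.Ioc 0 (0 + P))) := by rwa [zero_add]
  have hP' : 0 < P.toNNReal := Real.toNNReal_pos.2 hP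
  set ζ : ℝ≥0 := η * P.toNNReal / 36 with hζ
  have hζ0 : 0 < ζ := by positivity
  have e1 : 36 * ζ / P.toNNReal = η := by
    rw [hζ]
    field_simp
  obtain ⟨A, h1, h2, h3, h4⟩ := exists_expSum_approx_periodic hP hf h' hζ0
  have hL : MemLp (fun t => f t - (expSum A.support A t).re) 2
      (volume.restrict (Set.Ioc 0 (0 + P))) := by
    obtain ⟨a, ha⟩ := exists_windowBound_re_expSum A.support A
    exact h'.sub (ha.memLp_Ioc _ _)
  refine ⟨A, h1, h2, 36 * ζ, ?_, fun ε R hε hR => ?_⟩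
  · refine (WindowBound.of_periodic hP h3 hL.1 h4).mono ?_ ?_
    · rw [← e1]
      gcongr
      exact le_mul_of_one_le_left zero_le (by norm_num)
    · exact le_mul_of_one_le_left zero_le (by norm_num)
  · have := WindowBound.truncHilbert_of_periodic hP h3 hL h4 hε hR
    rwa [e1] at this

theorem IsPowerSignal.hasTrigApprox {m : ℕ} {u : ℝ → Fin m → ℝ} (hu : IsPowerSignal u)
    (i : Fin m) : HasTrigApprox (fun t => u t i) := by
  obtain ⟨v, n, T, p, hv, hp, rfl⟩ := hu
  simp only [Pi.add_apply, Finset.sum_apply]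
  refine HasTrigApprox.add (.of_memLp (hv.eval i)) ?_
  refine Finset.sum_induction (fun k t => p k t i) HasTrigApprox (fun f g hf hg => hf.add hg)
    (.of_memLp MemLp.zero) (fun k _ => ?_) |> fun h => by simpa only [Finset.sum_fn] using h
  obtain ⟨h1, h2, h3⟩ := hp k
  exact .of_periodic h1 (fun t => by simp only [h2 t]) (h3.eval i)

theorem WindowBound.sum {ι : Type*} {s : Finset ι} {f : ι → ℝ → ℝ} {a b : ι → ℝ≥0}
    (h : ∀ i ∈ s, WindowBound (f i) (a i) (b i)) :
    WindowBound (fun t => ∑ i ∈ s, f i t) (2 ^ s.card * ∑ i ∈ s, a i)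
      (2 ^ s.card * ∑ i ∈ s, b i) := by
  classical
  induction s using Finset.induction_on with
  | empty => simpa [Pi.zero_def] using WindowBound.zero
  | insert j s hj ih =>
    have h1 := (h j (Finset.mem_insert_self j s)).add
      (ih fun i hi => h i (Finset.mem_insert_of_mem hi))
    have h2 : (fun t => ∑ i ∈ insert j s, f i t) = f j + fun t => ∑ i ∈ s, f i t := by
      ext t
      rw [Finset.sum_insert hj]
      rfl
    have key : ∀ x y : ℝ≥0, 2 * (x + 2 ^ s.card * y) ≤ 2 ^ (s.card + 1) * (x + y) := by
      intro x y
      rw [pow_succ', mul_assoc, mul_add (2 ^ s.card)]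
      gcongr
      exact le_mul_of_one_le_left zero_le (one_le_pow₀ one_le_two)
    rw [h2, Finset.card_insert_of_notMem hj, Finset.sum_insert hj, Finset.sum_insert hj]
    exact h1.mono (key _ _) (key _ _)

/-! ### Comparison of time averages -/

/-- A Cauchy-Schwarz inequality for window bounds, in the form `|xy| ≤ (δ⁻¹ x² + δ y²) / 2`. -/
theorem WindowBound.abs_integral_mul_le {f g : ℝ → ℝ} {a b a' b' : ℝ≥0} (hf : WindowBound f a b)
    (hg : WindowBound g a' b') {δ T : ℝ} (hδ : 0 < δ) (hT : 0 ≤ T) :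
    |∫ t in (-T)..T, f t * g t| ≤
      1 / 2 * (δ⁻¹ * (a * (2 * T) + b) + δ * (a' * (2 * T) + b')) := by
  have e : -T + 2 * T = T := by ring
  have h1 := hf.integral_sq_le (x := -T) (L := 2 * T) (by linarith)
  have h2 := hg.integral_sq_le (x := -T) (L := 2 * T) (by linarith)
  rw [e] at h1 h2
  have i1 := hf.intervalIntegrable_mul hf (-T) T
  have i2 := hg.intervalIntegrable_mul hg (-T) T
  simp only [← sq] at i1 i2
  have hle : |∫ t in (-T)..T, f t * g t| ≤
      ∫ t in (-T)..T, 1 / 2 * (δ⁻¹ * f t ^ 2 + δ * g t ^ 2) := by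
    rw [← Real.norm_eq_abs]
    refine intervalIntegral.norm_integral_le_of_norm_le (by linarith) (ae_of_all _ fun t _ => ?_)
      (((i1.const_mul _).add (i2.const_mul _)).const_mul _)
    rw [Real.norm_eq_abs, abs_mul]
    have hsq : 0 ≤ δ⁻¹ * (|f t| - δ * |g t|) ^ 2 := by positivity
    have : δ⁻¹ * (|f t| - δ * |g t|) ^ 2 =
        δ⁻¹ * f t ^ 2 + δ * g t ^ 2 - 2 * (|f t| * |g t|) := by
      rw [sub_sq, mul_pow, sq_abs, sq_abs]
      field_simp
      ring
    linarith
  refine hle.trans ?_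
  rw [intervalIntegral.integral_const_mul,
    intervalIntegral.integral_add (i1.const_mul _) (i2.const_mul _),
    intervalIntegral.integral_const_mul, intervalIntegral.integral_const_mul]
  gcongr

/-- The time average of an inner product depends continuously on the signals, with respect to the
power: the constants `b` and `b₀` drop out in the limit. -/
theorem abs_timeAverage_sub_le {m : ℕ} {x x' z z' : Fin m → ℝ → ℝ} {δ K b b₀ : ℝ≥0} (hδ : 0 < δ)
    (hδ' : δ ≤ 1) (hx : ∀ i, WindowBound (x i) K b₀) (hz : ∀ i, WindowBound (z i) K b₀)
    (hxx : ∀ i, WindowBound (fun t => x i t - x' i t) (δ ^ 2) b)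
    (hzz : ∀ i, WindowBound (fun t => z i t - z' i t) (δ ^ 2) b) {A A' : ℝ}
    (hA : HasTimeAverage (fun t => ∑ i, x i t * z i t) A)
    (hA' : HasTimeAverage (fun t => ∑ i, x' i t * z' i t) A') :
    |A - A'| ≤ m * (δ * (K + 2)) := by
  have hδr : (0 : ℝ) < δ := hδ
  have hδr' : (δ : ℝ) ≤ 1 := hδ'
  set p : Fin m → ℝ → ℝ := fun i t => x i t - x' i t with hp
  set q : Fin m → ℝ → ℝ := fun i t => z i t - z' i t with hq
  set B : ℝ := m * ((δ : ℝ)⁻¹ * b + δ * b₀ + b) with hB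
  have hid : ∀ i, (fun t => x' i t * z' i t) =
      fun t => x i t * z i t - (p i t * z i t + q i t * x i t - p i t * q i t) := by
    intro i
    ext t
    simp only [hp, hq]
    ring
  have hbound : ∀ T : ℝ, 0 < T → |(2 * T)⁻¹ * (∫ t in (-T)..T, ∑ i, x i t * z i t) -
      (2 * T)⁻¹ * ∫ t in (-T)..T, ∑ i, x' i t * z' i t| ≤
      m * (δ * (K + 2)) + (2 * T)⁻¹ * B := by
    intro T hT
    have hpz := fun i => (hxx i).intervalIntegrable_mul (hz i) (-T) T
    have hqx := fun i => (hzz i).intervalIntegrable_mul (hx i) (-T) T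
    have hpq := fun i => (hxx i).intervalIntegrable_mul (hzz i) (-T) T
    have hxz := fun i => (hx i).intervalIntegrable_mul (hz i) (-T) T
    have hdiff : ∀ i, IntervalIntegrable
        (fun t => p i t * z i t + q i t * x i t - p i t * q i t) volume (-T) T := fun i =>
      ((hpz i).add (hqx i)).sub (hpq i)
    have hx'z' : ∀ i, IntervalIntegrable (fun t => x' i t * z' i t) volume (-T) T := fun i => by
      rw [hid]
      exact (hxz i).sub (hdiff i)
    rw [intervalIntegral.integral_finsetSum fun i _ => hxz i,
      intervalIntegral.integral_finsetSum fun i _ => hx'z' i, ← mul_sub, ← Finset.sum_sub_distrib,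
      abs_mul, abs_of_pos (by positivity : 0 < (2 * T)⁻¹)]
    have hterm : ∀ i, |(∫ t in (-T)..T, x i t * z i t) - ∫ t in (-T)..T, x' i t * z' i t| ≤
        2 * T * (δ * (K + 2)) + ((δ : ℝ)⁻¹ * b + δ * b₀ + b) := by
      intro i
      rw [hid, intervalIntegral.integral_sub (hxz i) (hdiff i), sub_sub_cancel,
        intervalIntegral.integral_sub ((hpz i).add (hqx i)) (hpq i),
        intervalIntegral.integral_add (hpz i) (hqx i)]
      have k1 := (hxx i).abs_integral_mul_le (hz i) hδr hT.le
      have k2 := (hzz i).abs_integral_mul_le (hx i) hδr hT.le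
      have k3 := (hxx i).abs_integral_mul_le (hzz i) one_pos hT.le
      refine (abs_sub _ _).trans ((add_le_add_left (abs_add_le _ _) _).trans ?_)
      refine (add_le_add (add_le_add k1 k2) k3).trans (le_of_sub_nonneg ?_)
      have hc : (δ : ℝ)⁻¹ * (δ ^ 2 * (2 * T) + b) = δ * (2 * T) + (δ : ℝ)⁻¹ * b := by
        field_simp
      push_cast
      rw [hc]
      have : 0 ≤ 2 * T * (δ : ℝ) * (1 - δ) := by
        have : 0 ≤ 1 - (δ : ℝ) := by linarith
        positivity
      nlinarith
    calc (2 * T)⁻¹ * |∑ i, ((∫ t in (-T)..T, x i t * z i t) - ∫ t in (-T)..T, x' i t * z' i t)|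
        ≤ (2 * T)⁻¹ * ∑ _i : Fin m, (2 * T * (δ * (K + 2)) + ((δ : ℝ)⁻¹ * b + δ * b₀ + b)) := by
          gcongr
          exact (Finset.abs_sum_le_sum_abs _ _).trans (Finset.sum_le_sum fun i _ => hterm i)
      _ = _ := by
          rw [Finset.sum_const, Finset.card_univ, Fintype.card_fin, nsmul_eq_mul, hB]
          field_simp
  have h0 : Tendsto (fun T : ℝ => (2 * T)⁻¹) atTop (𝓝 0) :=
    (tendsto_id.const_mul_atTop two_pos).inv_tendsto_atTop
  have hlim := (h0.mul_const B).const_add (m * (δ * (K + 2)) : ℝ)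
  rw [zero_mul, add_zero] at hlim
  refine le_of_tendsto_of_tendsto (Tendsto.sub hA hA').abs hlim ?_
  filter_upwards [eventually_gt_atTop 0] with T hT using hbound T hT

/-! ### Responses and Hilbert transforms of approximated signals -/

section

variable {m : ℕ} {G : Matrix (Fin m) (Fin m) (RatFunc ℝ)}

/-- The power `∑ w(ω) c(ω)* G(jω) c(ω)` of a trigonometric input signal. -/
def trigPower (G : Matrix (Fin m) (Fin m) (RatFunc ℝ)) (s : Finset ℝ) (c : ℝ → Fin m → ℂ) : ℂ :=
  ∑ ω ∈ s, (freqWeight ω : ℂ) *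
    (star (c ω) ⬝ᵥ (transferValue G ((jPoint ω : ℂ) : OnePoint ℂ) *ᵥ c ω))

/-- The squared power seminorm of a trigonometric signal. -/
def trigEnergy (s : Finset ℝ) (c : ℝ → Fin m → ℂ) : ℝ :=
  ∑ ω ∈ s, freqWeight ω * ∑ i, ‖c ω i‖ ^ 2

theorem jPoint_mem_nonnegFrequencies {ω : ℝ} (h : 0 ≤ ω) :
    ((jPoint ω : ℂ) : OnePoint ℂ) ∈ nonnegFrequencies :=
  Or.inr ⟨ω, h, rfl⟩

/-- The normalized power of a trigonometric input is a convex combination of elements of the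
numerical ranges, with the energies of the frequencies as weights. -/
theorem exists_trigPower_eq (G : Matrix (Fin m) (Fin m) (RatFunc ℝ)) {s : Finset ℝ}
    (hs : ∀ ω ∈ s, 0 ≤ ω) {c : ℝ → Fin m → ℂ} (hE : 0 < trigEnergy s c) :
    trigPower G s c / trigEnergy s c ∈
      convexHull ℝ (⋃ s ∈ nonnegFrequencies, numRange (transferValue G s)) := by
  classical
  set s' := s.filter fun ω => c ω ≠ 0 with hs'
  have hE' : trigEnergy s c = ∑ ω ∈ s', freqWeight ω * ∑ i, ‖c ω i‖ ^ 2 := by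
    rw [trigEnergy, hs', Finset.sum_filter_of_ne]
    intro ω _ h h0
    apply h
    simp [h0]
  have hP' : trigPower G s c = ∑ ω ∈ s', (freqWeight ω : ℂ) *
      (star (c ω) ⬝ᵥ (transferValue G ((jPoint ω : ℂ) : OnePoint ℂ) *ᵥ c ω)) := by
    rw [trigPower, hs', Finset.sum_filter_of_ne]
    intro ω _ h h0
    apply h
    simp [h0]
  have hz : ∀ ω, ∃ z : ℂ, c ω ≠ 0 → z ∈ numRange (transferValue G ((jPoint ω : ℂ) : OnePoint ℂ)) ∧
      star (c ω) ⬝ᵥ (transferValue G ((jPoint ω : ℂ) : OnePoint ℂ) *ᵥ c ω) =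
        ((∑ i, ‖c ω i‖ ^ 2 : ℝ) : ℂ) * z := by
    intro ω
    by_cases h : c ω = 0
    · exact ⟨0, fun h' => absurd h h'⟩
    · obtain ⟨z, hz, hz'⟩ := exists_mem_numRange_of_ne_zero
        (transferValue G ((jPoint ω : ℂ) : OnePoint ℂ)) h
      exact ⟨z, fun _ => ⟨hz, hz'⟩⟩
  choose z hz using hz
  have hmem := Finset.centerMass_mem_convexHull (R := ℝ)
    (s := ⋃ s ∈ nonnegFrequencies, numRange (transferValue G s)) s'
    (w := fun ω => freqWeight ω * ∑ i, ‖c ω i‖ ^ 2) (z := z)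
    (fun ω _ => mul_nonneg (freqWeight_pos ω).le (Finset.sum_nonneg fun i _ => by positivity))
    (by rw [← hE']; exact hE) (fun ω hω => by
      rw [hs', Finset.mem_filter] at hω
      exact Set.mem_biUnion (jPoint_mem_nonnegFrequencies (hs ω hω.1)) (hz ω hω.2).1)
  convert hmem using 1
  rw [Finset.centerMass, ← hE', hP', div_eq_inv_mul, Complex.real_smul, Complex.ofReal_inv]
  congr 1
  refine Finset.sum_congr rfl fun ω hω => ?_
  rw [hs', Finset.mem_filter] at hω
  rw [(hz ω hω.2).2, Complex.real_smul]
  push_cast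
  ring

theorem hasTimeAverage_trig_energy {s : Finset ℝ} (hs : ∀ ω ∈ s, 0 ≤ ω) {c : ℝ → Fin m → ℂ}
    (hc : ∀ i, (c 0 i).im = 0) :
    HasTimeAverage (fun t => ∑ i, (expSum s (fun ω => c ω i) t).re *
      (expSum s (fun ω => c ω i) t).re) (trigEnergy s c) := by
  have h := HasTimeAverage.sum (s := Finset.univ) (fun i _ =>
    hasTimeAverage_re_mul_re hs (c := fun ω => c ω i) (d := fun ω => c ω i) (hc i))
    (fun i _ T => Continuous.intervalIntegrable (by fun_prop) _ _)
  convert h using 1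
  rw [Finset.sum_comm, trigEnergy]
  refine Finset.sum_congr rfl fun ω _ => ?_
  rw [Finset.mul_sum]
  refine Finset.sum_congr rfl fun i _ => ?_
  rw [Complex.star_def, ← Complex.normSq_eq_conj_mul_self, Complex.normSq_eq_norm_sq,
    Complex.ofReal_re]

theorem hasTimeAverage_trig_re (G : Matrix (Fin m) (Fin m) (RatFunc ℝ)) {s : Finset ℝ}
    (hs : ∀ ω ∈ s, 0 ≤ ω) {c : ℝ → Fin m → ℂ} (hc : ∀ i, (c 0 i).im = 0) :
    HasTimeAverage (fun t => ∑ i, (expSum s (fun ω => c ω i) t).re *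
      (expSum s (fun ω => (transferValue G ((jPoint ω : ℂ) : OnePoint ℂ) *ᵥ c ω) i) t).re)
      (trigPower G s c).re := by
  have h := HasTimeAverage.sum (s := Finset.univ) (fun i _ =>
    hasTimeAverage_re_mul_re hs (c := fun ω => c ω i)
      (d := fun ω => (transferValue G ((jPoint ω : ℂ) : OnePoint ℂ) *ᵥ c ω) i) (hc i))
    (fun i _ T => Continuous.intervalIntegrable (by fun_prop) _ _)
  convert h using 1
  rw [Finset.sum_comm, trigPower, Complex.re_sum]
  refine Finset.sum_congr rfl fun ω _ => ?_
  rw [Complex.re_ofReal_mul, dotProduct, Complex.re_sum, Finset.mul_sum]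
  rfl

theorem hasTimeAverage_trig_im (G : Matrix (Fin m) (Fin m) (RatFunc ℝ)) {s : Finset ℝ}
    (hs : ∀ ω ∈ s, 0 ≤ ω) {c : ℝ → Fin m → ℂ} (hc : ∀ i, (c 0 i).im = 0)
    (hd : ∀ i, ((transferValue G ((jPoint 0 : ℂ) : OnePoint ℂ) *ᵥ c 0) i).im = 0) :
    HasTimeAverage (fun t => ∑ i, (expSum s (fun ω => c ω i) t).im *
      (expSum s (fun ω => (transferValue G ((jPoint ω : ℂ) : OnePoint ℂ) *ᵥ c ω) i) t).re)
      (-(trigPower G s c).im) := by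
  have h := HasTimeAverage.sum (s := Finset.univ) (fun i _ =>
    hasTimeAverage_im_mul_re hs (c := fun ω => c ω i)
      (d := fun ω => (transferValue G ((jPoint ω : ℂ) : OnePoint ℂ) *ᵥ c ω) i) (hc i) (hd i))
    (fun i _ T => Continuous.intervalIntegrable (by fun_prop) _ _)
  convert h using 1
  rw [Finset.sum_neg_distrib, Finset.sum_comm, trigPower, Complex.im_sum]
  congr 1
  refine Finset.sum_congr rfl fun ω _ => ?_
  rw [Complex.im_ofReal_mul, dotProduct, Complex.im_sum, Finset.mul_sum]
  rfl

theorem IsImpulseResponse.transferValue_jPoint {g : ℝ → Matrix (Fin m) (Fin m) ℝ}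
    (hg : IsImpulseResponse G g) (ω : ℝ) (i j : Fin m) :
    transferValue G ((jPoint ω : ℂ) : OnePoint ℂ) i j = (feedthrough G i j : ℂ) +
      ∫ t in Set.Ioi (0 : ℝ), ((g t i j : ℝ) : ℂ) * Complex.exp (-(ω * t * Complex.I)) := by
  rw [(hg i j).2 (jPoint ω) (by simp [jPoint])]
  congr 2
  ext t
  congr 3
  rw [jPoint]
  ring

/-- `G(0)` is a real matrix. -/
theorem IsImpulseResponse.im_transferValue_zero {g : ℝ → Matrix (Fin m) (Fin m) ℝ}
    (hg : IsImpulseResponse G g) {x : Fin m → ℂ} (hx : ∀ i, (x i).im = 0) (i : Fin m) :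
    ((transferValue G ((jPoint 0 : ℂ) : OnePoint ℂ) *ᵥ x) i).im = 0 := by
  rw [Matrix.mulVec, dotProduct, Complex.im_sum]
  refine Finset.sum_eq_zero fun j _ => ?_
  have h : (transferValue G ((jPoint 0 : ℂ) : OnePoint ℂ) i j).im = 0 := by
    rw [hg.transferValue_jPoint]
    simp only [Complex.ofReal_zero, zero_mul, neg_zero, Complex.exp_zero, mul_one]
    rw [integral_complex_ofReal]
    simp
  rw [Complex.mul_im, h, hx j]
  ring

/-- The output of `G` for an exponential sum. -/
theorem IsImpulseResponse.response_expSum {g : ℝ → Matrix (Fin m) (Fin m) ℝ}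
    (hg : IsImpulseResponse G g) (s : Finset ℝ) (c : ℝ → Fin m → ℂ) (i : Fin m) (t : ℝ) :
    ∑ j, (feedthrough G i j * (expSum s (fun ω => c ω j) t).re +
      ∫ τ in Set.Ioi (0 : ℝ), g τ i j * (expSum s (fun ω => c ω j) (t - τ)).re) =
    (expSum s (fun ω => (transferValue G ((jPoint ω : ℂ) : OnePoint ℂ) *ᵥ c ω) i) t).re := by
  have h : ∀ j, feedthrough G i j * (expSum s (fun ω => c ω j) t).re +
      ∫ τ in Set.Ioi (0 : ℝ), g τ i j * (expSum s (fun ω => c ω j) (t - τ)).re =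
      (∑ ω ∈ s, transferValue G ((jPoint ω : ℂ) : OnePoint ℂ) i j * c ω j *
        Complex.exp (ω * t * Complex.I)).re := by
    intro j
    rw [integral_mul_re_expSum (hg i j).1, ← Complex.re_ofReal_mul, ← Complex.add_re, expSum,
      expSum, Finset.mul_sum, ← Finset.sum_add_distrib]
    congr 1
    refine Finset.sum_congr rfl fun ω _ => ?_
    rw [hg.transferValue_jPoint]
    ring
  simp only [h, ← Complex.re_sum]
  congr 1
  rw [Finset.sum_comm, expSum]
  refine Finset.sum_congr rfl fun ω _ => ?_
  rw [← Finset.sum_mul]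
  rfl

/-- The coordinates of the response. The vector-valued convolution integral is meaningful since the
scalar ones converge absolutely for almost every `t`. -/
theorem isResponse_apply {g : ℝ → Matrix (Fin m) (Fin m) ℝ} (hg : IsImpulseResponse G g)
    {u : ℝ → Fin m → ℝ} {a b : Fin m → ℝ≥0}
    (hu : ∀ j, WindowBound (fun t => u t j) (a j) (b j)) :
    ∀ᵐ t, ∀ i, (feedthrough G *ᵥ u t + ∫ τ in Set.Ioi (0 : ℝ), g τ *ᵥ u (t - τ)) i =
      ∑ j, (feedthrough G i j * u t j + ∫ τ in Set.Ioi (0 : ℝ), g τ i j * u (t - τ) j) := by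
  have h := fun i j => (hu j).ae_integrable_convolution (hg i j).1
  filter_upwards [ae_all_iff.2 fun i => ae_all_iff.2 fun j => h i j] with t ht i
  have h1 : ∀ i, IntegrableOn (fun τ => (g τ *ᵥ u (t - τ)) i) (Set.Ioi 0) := fun i =>
    integrable_finsetSum Finset.univ fun j _ => ht i j
  rw [Pi.add_apply, eval_integral h1, Finset.sum_add_distrib]
  congr 1
  exact integral_finsetSum Finset.univ fun j _ => ht i j

/-- The coordinates of the truncated Hilbert transform of a vector-valued signal. -/
theorem setIntegral_hilbert_apply {u : ℝ → Fin m → ℝ} {a b : Fin m → ℝ≥0}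
    (hu : ∀ j, WindowBound (fun t => u t j) (a j) (b j)) {ε : ℝ} (hε : 0 < ε) (R t : ℝ)
    (i : Fin m) :
    (Real.pi⁻¹ • ∫ τ in {τ : ℝ | ε < |t - τ| ∧ |t - τ| < R}, (t - τ)⁻¹ • u τ) i =
      truncHilbert ε R (fun t => u t i) t := by
  have hm : MeasurableSet {τ : ℝ | ε < |t - τ| ∧ |t - τ| < R} :=
    (measurableSet_annulus ε R).preimage (measurable_const.sub measurable_id)
  have h1 : ∀ i, IntegrableOn (fun τ => ((t - τ)⁻¹ • u τ) i)
      {τ : ℝ | ε < |t - τ| ∧ |t - τ| < R} := by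
    intro i
    have h2 := ((hu i).integrable_hilbertKernel_mul hε R t).comp_sub_left t
    have h3 := (h2.const_mul Real.pi).integrableOn (s := {τ : ℝ | ε < |t - τ| ∧ |t - τ| < R})
    refine h3.congr_fun (fun τ hτ => ?_) hm
    simp only [sub_sub_cancel, Pi.smul_apply, smul_eq_mul]
    rw [hilbertKernel, Set.indicator_of_mem (show t - τ ∈ _ from hτ), mul_inv, ← mul_assoc,
      ← mul_assoc, mul_inv_cancel₀ Real.pi_ne_zero, one_mul]
  rw [Pi.smul_apply, eval_integral h1, truncHilbert_eq_setIntegral, smul_eq_mul]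
  rfl

/-- Approximation of the input, of its Hilbert transform and of the output by the trigonometric
signals with the same coefficients. -/
theorem exists_trig_approx {u h y : ℝ → Fin m → ℝ} (hu : IsPowerSignal u)
    (hh : IsHilbertTransform u h) (hy : IsResponse G u y) {δ : ℝ≥0} (hδ : 0 < δ) :
    ∃ (s : Finset ℝ) (c : ℝ → Fin m → ℂ) (b : ℝ≥0), (∀ ω ∈ s, 0 ≤ ω) ∧ (∀ i, (c 0 i).im = 0) ∧
      (∀ i, ((transferValue G ((jPoint 0 : ℂ) : OnePoint ℂ) *ᵥ c 0) i).im = 0) ∧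
      (∀ i, WindowBound (fun t => u t i - (expSum s (fun ω => c ω i) t).re) δ b) ∧
      (∀ i, WindowBound (fun t => h t i - (expSum s (fun ω => c ω i) t).im) δ b) ∧
      ∀ i, WindowBound (fun t => y t i - (expSum s
        (fun ω => (transferValue G ((jPoint ω : ℂ) : OnePoint ℂ) *ᵥ c ω) i) t).re) δ b := by
  classical
  obtain ⟨g, hg, hy⟩ := hy
  -- the gain of the response, for the remainders
  set N : Fin m → Fin m → ℝ≥0 := fun i j => 2 * (‖feedthrough G i j‖₊ ^ 2 +
    (∫⁻ τ in Set.Ioi (0 : ℝ), ‖g τ i j‖ₑ).toNNReal ^ 2) with hN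
  set M : ℝ≥0 := 2 ^ m * ∑ i, ∑ j, N i j with hM
  set η : ℝ≥0 := δ / (1 + M) with hη
  have hη0 : 0 < η := by positivity
  have hηδ : η ≤ δ := div_le_self zero_le le_self_add
  have hηM : M * η ≤ δ := by
    rw [hη, mul_div_assoc', div_le_iff₀ (by positivity), mul_comm]
    gcongr
    exact le_add_self
  choose A hA0 hA1 b hb hbT using fun i => hu.hasTrigApprox i η hη0
  set s : Finset ℝ := Finset.univ.biUnion fun i => (A i).support with hs
  set c : ℝ → Fin m → ℂ := fun ω i => A i ω with hc
  have hexp : ∀ i, expSum (A i).support (A i) = expSum s (fun ω => c ω i) := fun i =>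
    expSum_subset (Finset.subset_biUnion_of_mem (fun i => (A i).support) (Finset.mem_univ i))
      fun ω _ h => Finsupp.notMem_support_iff.1 h
  simp only [hexp] at hb hbT
  have hs0 : ∀ ω ∈ s, 0 ≤ ω := by
    intro ω hω
    obtain ⟨i, -, hi⟩ := Finset.mem_biUnion.1 hω
    exact hA0 i ω (Finsupp.mem_support_iff.1 hi)
  have hU : ∀ i, ∃ a, WindowBound (fun t => (expSum s (fun ω => c ω i) t).re) a 0 := fun i =>
    exists_windowBound_re_expSum _ _
  choose aU haU using hU
  have huW : ∀ i, WindowBound (fun t => u t i) (2 * (η + aU i)) (2 * (b i + 0)) := by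
    intro i
    have := (hb i).add (haU i)
    convert this using 1
    ext t
    simp
  set b' : ℝ≥0 := ∑ i, b i with hb'
  have hbb : ∀ i, b i ≤ b' := fun i => Finset.single_le_sum (fun _ _ => zero_le) (Finset.mem_univ i)
  have hMb : ∀ i : Fin m, ∀ x : ℝ≥0, 2 ^ m * ∑ j, N i j * x ≤ M * x := by
    intro i x
    rw [hM, ← Finset.sum_mul, ← mul_assoc]
    refine mul_le_mul_left (mul_le_mul_right ?_ _) _
    exact Finset.single_le_sum (f := fun i => ∑ j, N i j) (fun _ _ => zero_le) (Finset.mem_univ i)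
  refine ⟨s, c, b' + M * b', hs0, hA1, hg.im_transferValue_zero hA1, fun i => ?_, fun i => ?_,
    fun i => ?_⟩
  · exact (hb i).mono hηδ ((hbb i).trans le_self_add)
  · -- the truncated Hilbert transforms of the remainder converge to the asserted remainder
    have hW : WindowBound (fun t => h t i - (expSum s (fun ω => c ω i) t).im) η (b i) := by
      refine WindowBound.of_tendsto (l := 𝓝[>] (0 : ℝ) ×ˢ (atTop : Filter ℝ))
        (F := fun q => truncHilbert q.1 q.2 fun t => u t i - (expSum s (fun ω => c ω i) t).re)
        (eventually_truncation.mono fun q hq => hbT i q.1 q.2 hq.1 hq.2) ?_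
      filter_upwards [hh] with t ht
      have h1 := (tendsto_pi_nhds.1 ht i).sub
        (tendsto_truncHilbert_re_expSum hs0 (c := fun ω => c ω i) (hA1 i) t)
      refine h1.congr' ?_
      filter_upwards [eventually_truncation] with q hq
      rw [setIntegral_hilbert_apply huW hq.1]
      exact (congrFun ((huW i).truncHilbert_sub (haU i) hq.1 q.2) t).symm
    exact hW.mono hηδ ((hbb i).trans le_self_add)
  · have hF : WindowBound (fun t => ∑ j, (feedthrough G i j *
        (u t j - (expSum s (fun ω => c ω j) t).re) + ∫ τ in Set.Ioi (0 : ℝ), g τ i j *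
          (u (t - τ) j - (expSum s (fun ω => c ω j) (t - τ)).re)))
        (2 ^ m * ∑ j, N i j * η) (2 ^ m * ∑ j, N i j * b') := by
      have := WindowBound.sum (s := Finset.univ) fun j (_ : j ∈ Finset.univ) =>
        ((((hb j).const_mul (feedthrough G i j)).add ((hb j).convolution (hg i j).1)).mono
          (a' := N i j * η) (b' := N i j * b') (le_of_eq (by rw [hN]; ring)) (by
            rw [hN, ← add_mul, ← mul_assoc]
            gcongr
            exact hbb j))
      simpa only [Finset.card_univ, Fintype.card_fin, Pi.add_apply] using this
    refine ((hF.mono ((hMb i η).trans hηM) (hMb i b')).congr_ae ?_).mono le_rfl le_add_self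
    filter_upwards [hy, isResponse_apply hg huW,
      ae_all_iff.2 fun j => (huW j).ae_integrable_convolution (hg i j).1,
      ae_all_iff.2 fun j => (haU j).ae_integrable_convolution (hg i j).1] with t h1 h2 h3 h4
    rw [h1, h2 i, ← hg.response_expSum s c i t, ← Finset.sum_sub_distrib]
    refine Finset.sum_congr rfl fun j _ => ?_
    simp only [mul_sub]
    rw [integral_sub (h3 j) (h4 j)]
    ring

/-- The complex powers lie in the closed convex hull of the numerical ranges. -/
theorem complexPowers_subset :
    complexPowers G ⊆ closure (convexHull ℝ
      (⋃ s ∈ nonnegFrequencies, numRange (transferValue G s))) := by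
  rintro S ⟨u, h, y, hu, huu, hh, hy, huy, hhy⟩
  -- a common bound for the power of the three signals, from any of their approximations
  obtain ⟨K, b₀, hKu, hKh, hKy⟩ : ∃ K b₀ : ℝ≥0, (∀ i, WindowBound (fun t => u t i) K b₀) ∧
      (∀ i, WindowBound (fun t => h t i) K b₀) ∧ ∀ i, WindowBound (fun t => y t i) K b₀ := by
    obtain ⟨s, c, b, -, -, -, h1, h2, h3⟩ := exists_trig_approx hu hh hy one_pos
    choose k1 e1 using fun i => exists_windowBound_re_expSum s (fun ω => c ω i)
    choose k2 e2 using fun i => exists_windowBound_im_expSum s (fun ω => c ω i)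
    choose k3 e3 using fun i => exists_windowBound_re_expSum s
      (fun ω => (transferValue G ((jPoint ω : ℂ) : OnePoint ℂ) *ᵥ c ω) i)
    have hk : ∀ (k : Fin m → ℝ≥0) (i : Fin m), k i ≤ ∑ i, k i := fun k i =>
      Finset.single_le_sum (fun _ _ => zero_le) (Finset.mem_univ i)
    have hle : ∀ (k : Fin m → ℝ≥0) (i : Fin m),
        (∑ i, k i) ≤ (∑ i, k1 i) + (∑ i, k2 i) + ∑ i, k3 i →
        2 * (1 + k i) ≤ 2 * (1 + ((∑ i, k1 i) + (∑ i, k2 i) + ∑ i, k3 i)) := by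
      intro k i hk'
      gcongr
      exact (hk k i).trans hk'
    refine ⟨2 * (1 + ((∑ i, k1 i) + (∑ i, k2 i) + ∑ i, k3 i)), 2 * (b + 0), fun i => ?_,
      fun i => ?_, fun i => ?_⟩
    · refine WindowBound.mono (a := 2 * (1 + k1 i)) (b := 2 * (b + 0)) ?_ (hle k1 i ?_) le_rfl
      · convert (h1 i).add (e1 i) using 1
        ext t
        simp
      · rw [add_assoc]
        exact le_self_add
    · refine WindowBound.mono (a := 2 * (1 + k2 i)) (b := 2 * (b + 0)) ?_ (hle k2 i ?_) le_rfl
      · convert (h2 i).add (e2 i) using 1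
        ext t
        simp
      · exact le_add_self.trans le_self_add
    · refine WindowBound.mono (a := 2 * (1 + k3 i)) (b := 2 * (b + 0)) ?_ (hle k3 i ?_) le_rfl
      · convert (h3 i).add (e3 i) using 1
        ext t
        simp
      · exact le_add_self
  -- remainders of power `δ²`, with `δ = 1 / (n + 1)`, change the time averages by `O(δ)`
  have happ : ∀ n : ℕ, ∃ (s : Finset ℝ) (c : ℝ → Fin m → ℂ), (∀ ω ∈ s, 0 ≤ ω) ∧
      |1 - trigEnergy s c| ≤ m * (K + 2) * (1 / (n + 1)) ∧
      |S.re - (trigPower G s c).re| ≤ m * (K + 2) * (1 / (n + 1)) ∧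
      |-S.im - -(trigPower G s c).im| ≤ m * (K + 2) * (1 / (n + 1)) := by
    intro n
    set δ : ℝ≥0 := 1 / (n + 1) with hδ
    have hδ0 : 0 < δ := by positivity
    have hδ1 : δ ≤ 1 := div_le_self zero_le le_add_self
    obtain ⟨s, c, b, hs, hc, hd, h1, h2, h3⟩ := exists_trig_approx hu hh hy
      (δ := δ ^ 2) (by positivity)
    have hδr : (m * (K + 2) * (1 / (n + 1)) : ℝ) = m * (δ * (K + 2)) := by
      rw [hδ]
      push_cast
      ring
    refine ⟨s, c, hs, ?_, ?_, ?_⟩ <;> rw [hδr]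
    · exact abs_timeAverage_sub_le hδ0 hδ1 hKu hKu h1 h1 huu (hasTimeAverage_trig_energy hs hc)
    · exact abs_timeAverage_sub_le hδ0 hδ1 hKu hKy h1 h3 huy (hasTimeAverage_trig_re G hs hc)
    · exact abs_timeAverage_sub_le hδ0 hδ1 hKh hKy h2 h3 hhy (hasTimeAverage_trig_im G hs hc hd)
  choose s c hs hE hre him using happ
  have h0 : Tendsto (fun n : ℕ => (m * (K + 2) * (1 / (n + 1)) : ℝ)) atTop (𝓝 0) := by
    simpa using tendsto_one_div_add_atTop_nhds_zero_nat.const_mul (m * (K + 2) : ℝ)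
  have hlim : ∀ (f : ℕ → ℝ) (x : ℝ), (∀ n, |x - f n| ≤ m * (K + 2) * (1 / (n + 1))) →
      Tendsto f atTop (𝓝 x) := by
    intro f x hf
    rw [tendsto_iff_dist_tendsto_zero]
    refine squeeze_zero (fun _ => dist_nonneg) (fun n => ?_) h0
    rw [dist_comm, Real.dist_eq]
    exact hf n
  have hElim := hlim _ _ hE
  have hSlim : Tendsto (fun n => trigPower G (s n) (c n)) atTop (𝓝 S) := by
    have l1 := hlim _ _ hre
    have l2 := (hlim _ _ him).neg
    simp only [neg_neg] at l2
    have := ((Complex.continuous_ofReal.tendsto _).comp l1).add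
      (((Complex.continuous_ofReal.tendsto _).comp l2).mul_const Complex.I)
    simpa only [Function.comp_apply, Complex.re_add_im] using this
  have hq : Tendsto (fun n => trigPower G (s n) (c n) / trigEnergy (s n) (c n)) atTop (𝓝 S) := by
    have := hSlim.div ((Complex.continuous_ofReal.tendsto _).comp hElim) (by simp)
    simpa [Pi.div_def] using this
  refine mem_closure_of_tendsto hq ?_
  filter_upwards [hElim.eventually (lt_mem_nhds (zero_lt_one))] with n hn
  exact exists_trigPower_eq G (hs n) hn

end

/-! ### Impulse responses of stable rational functions -/

/-- `F` is, on the closed right half-plane, the Laplace transform of an integrable function on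
`(0, ∞)`. -/
def IsLaplaceTransform (F : ℂ → ℂ) : Prop :=
  ∃ g : ℝ → ℂ, IntegrableOn g (Set.Ioi 0) ∧
    ∀ s : ℂ, 0 ≤ s.re → F s = ∫ t in Set.Ioi (0 : ℝ), g t * Complex.exp (-(s * t))

theorem integrableOn_mul_exp_neg {g : ℝ → ℂ} (hg : IntegrableOn g (Set.Ioi 0)) {s : ℂ}
    (hs : 0 ≤ s.re) : IntegrableOn (fun t : ℝ => g t * Complex.exp (-(s * t))) (Set.Ioi 0) := by
  refine Integrable.mul_bdd (c := 1) hg (Continuous.aestronglyMeasurable (by fun_prop)) ?_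
  filter_upwards [ae_restrict_mem measurableSet_Ioi] with t ht
  rw [Complex.norm_exp, Real.exp_le_one_iff]
  have ht : 0 < t := ht
  simp only [Complex.neg_re, Complex.mul_re, Complex.ofReal_re, Complex.ofReal_im, mul_zero,
    sub_zero]
  nlinarith

namespace IsLaplaceTransform

variable {F H : ℂ → ℂ}

theorem congr (hF : IsLaplaceTransform F) (h : ∀ s : ℂ, 0 ≤ s.re → H s = F s) :
    IsLaplaceTransform H := by
  obtain ⟨g, hg, hgF⟩ := hF
  exact ⟨g, hg, fun s hs => (h s hs).trans (hgF s hs)⟩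

theorem zero : IsLaplaceTransform fun _ => 0 :=
  ⟨0, integrableOn_zero, fun s _ => by simp⟩

theorem add (hF : IsLaplaceTransform F) (hH : IsLaplaceTransform H) :
    IsLaplaceTransform fun s => F s + H s := by
  obtain ⟨g, hg, hgF⟩ := hF
  obtain ⟨k, hk, hkH⟩ := hH
  refine ⟨g + k, hg.add hk, fun s hs => ?_⟩
  simp only [Pi.add_apply, add_mul]
  rw [integral_add (integrableOn_mul_exp_neg hg hs) (integrableOn_mul_exp_neg hk hs),
    hgF s hs, hkH s hs]

theorem const_mul (hF : IsLaplaceTransform F) (c : ℂ) : IsLaplaceTransform fun s => c * F s := by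
  obtain ⟨g, hg, hgF⟩ := hF
  refine ⟨fun t => c * g t, hg.const_mul c, fun s hs => ?_⟩
  simp only [mul_assoc]
  rw [integral_const_mul, hgF s hs]

/-- The product of Laplace transforms is the Laplace transform of the convolution. -/
theorem mul (hF : IsLaplaceTransform F) (hH : IsLaplaceTransform H) :
    IsLaplaceTransform fun s => F s * H s := by
  obtain ⟨g, hg, hgF⟩ := hF
  obtain ⟨k, hk, hkH⟩ := hH
  set g₀ := Set.indicator (Set.Ioi (0 : ℝ)) g with hg₀
  set k₀ := Set.indicator (Set.Ioi (0 : ℝ)) k with hk₀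
  have hgi : Integrable g₀ := (integrable_indicator_iff measurableSet_Ioi).2 hg
  have hki : Integrable k₀ := (integrable_indicator_iff measurableSet_Ioi).2 hk
  set L := ContinuousLinearMap.mul ℂ ℂ with hL
  refine ⟨convolution g₀ k₀ L volume, (hgi.integrable_convolution L hki).integrableOn,
    fun s hs => ?_⟩
  have hexp : ∀ f : ℝ → ℂ, (fun t => Set.indicator (Set.Ioi (0 : ℝ)) f t *
      Complex.exp (-(s * t))) = Set.indicator (Set.Ioi (0 : ℝ))
        fun t => f t * Complex.exp (-(s * t)) := by
    intro f
    ext t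
    simp only [Set.indicator_apply]
    split_ifs <;> simp
  have hgs : Integrable fun t => g₀ t * Complex.exp (-(s * t)) := by
    rw [hg₀, hexp]
    exact (integrable_indicator_iff measurableSet_Ioi).2 (integrableOn_mul_exp_neg hg hs)
  have hks : Integrable fun t => k₀ t * Complex.exp (-(s * t)) := by
    rw [hk₀, hexp]
    exact (integrable_indicator_iff measurableSet_Ioi).2 (integrableOn_mul_exp_neg hk hs)
  have h1 := integral_convolution L hgs hks
  have h2 : ∀ t, convolution (fun t => g₀ t * Complex.exp (-(s * t)))
      (fun t => k₀ t * Complex.exp (-(s * t))) L volume t =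
      convolution g₀ k₀ L volume t * Complex.exp (-(s * t)) := by
    intro t
    simp only [convolution, hL, ContinuousLinearMap.mul_apply']
    rw [← integral_mul_const]
    congr 1
    ext τ
    have : Complex.exp (-(s * t)) =
        Complex.exp (-(s * τ)) * Complex.exp (-(s * (t - τ : ℝ))) := by
      rw [← Complex.exp_add]
      congr 1
      push_cast
      ring
    rw [this]
    ring
  have h3 : ∀ t ∉ Set.Ioi (0 : ℝ), convolution g₀ k₀ L volume t * Complex.exp (-(s * t)) = 0 := by
    intro t ht
    have ht : t ≤ 0 := not_lt.1 ht
    have : convolution g₀ k₀ L volume t = 0 := by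
      simp only [convolution, hL, ContinuousLinearMap.mul_apply']
      refine integral_eq_zero_of_ae (ae_of_all _ fun τ => ?_)
      simp only [hg₀, hk₀, Set.indicator_apply, Set.mem_Ioi, Pi.zero_apply]
      split_ifs <;> first | (exfalso; linarith) | simp
    rw [this, zero_mul]
  simp only [h2] at h1
  rw [setIntegral_eq_integral_of_forall_compl_eq_zero h3, h1]
  simp only [hL, ContinuousLinearMap.mul_apply', hg₀, hk₀, hexp]
  rw [integral_indicator measurableSet_Ioi, integral_indicator measurableSet_Ioi, hgF s hs,
    hkH s hs]

theorem inv_sub {a : ℂ} (ha : a.re < 0) : IsLaplaceTransform fun s => (s - a)⁻¹ := by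
  have hint : ∀ s : ℂ, 0 ≤ s.re → (a - s).re < 0 := fun s hs => by
    simp only [Complex.sub_re]
    linarith
  refine ⟨fun t => Complex.exp (a * t), integrableOn_exp_mul_complex_Ioi ha 0, fun s hs => ?_⟩
  have : ∀ t : ℝ, Complex.exp (a * t) * Complex.exp (-(s * t)) = Complex.exp ((a - s) * t) := by
    intro t
    rw [← Complex.exp_add]
    congr 1
    ring
  simp only [this]
  rw [integral_exp_mul_complex_Ioi (hint s hs)]
  rw [Complex.ofReal_zero, mul_zero, Complex.exp_zero, ← neg_sub, inv_neg, neg_div, one_div]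

theorem inv_prod {r : Multiset ℂ} (hr : ∀ a ∈ r, a.re < 0) (h0 : r ≠ 0) :
    IsLaplaceTransform fun s => ((r.map fun a => s - a).prod)⁻¹ := by
  induction r using Multiset.induction_on with
  | empty => exact absurd rfl h0
  | cons a r ih =>
    have ha := inv_sub (hr a (Multiset.mem_cons_self a r))
    by_cases hr0 : r = 0
    · subst hr0
      simpa using ha
    · refine (ha.mul (ih (fun b hb => hr b (Multiset.mem_cons_of_mem hb)) hr0)).congr fun s _ => ?_
      rw [Multiset.map_cons, Multiset.prod_cons, mul_inv]

/-- A strictly proper rational function with poles in the open left half-plane is a Laplace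
transform, by division of the numerator by the linear factors of the denominator. -/
theorem of_rational {r : Multiset ℂ} (hr : ∀ a ∈ r, a.re < 0) {N : Polynomial ℂ}
    (hN : N.degree < r.card) :
    IsLaplaceTransform fun s => N.eval s / (r.map fun a => s - a).prod := by
  induction r using Multiset.induction_on generalizing N with
  | empty =>
    have : N = 0 := by
      rw [← Polynomial.degree_eq_bot]
      rw [Multiset.card_zero, Nat.cast_zero] at hN
      exact Nat.WithBot.lt_zero_iff.1 hN
    subst this
    simpa using zero
  | cons a r ih =>
    by_cases hN0 : N = 0
    · subst hN0
      simpa using zero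
    have hdeg : (N /ₘ (Polynomial.X - Polynomial.C a)).degree < r.card := by
      refine (Polynomial.degree_lt_iff_coeff_zero _ _).2 fun n hn => ?_
      refine Polynomial.coeff_eq_zero_of_degree_lt ?_
      refine (Polynomial.degree_divByMonic_lt N (Polynomial.X - Polynomial.C a) hN0 (by
        rw [Polynomial.degree_X_sub_C]; exact zero_lt_one)).trans_le ?_
      rw [Multiset.card_cons] at hN
      have hn' : N.natDegree ≤ n := by
        have := (Polynomial.natDegree_lt_iff_degree_lt hN0).2 hN
        omega
      exact Polynomial.degree_le_natDegree.trans (WithBot.coe_le_coe.2 hn')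
    have h1 := ih (fun b hb => hr b (Multiset.mem_cons_of_mem hb)) hdeg
    have h2 := (inv_prod hr (Multiset.cons_ne_zero)).const_mul (N.eval a)
    refine (h1.add h2).congr fun s hs => ?_
    have hne : s - a ≠ 0 := by
      intro h0
      have h3 := hr a (Multiset.mem_cons_self a r)
      rw [sub_eq_zero] at h0
      rw [h0] at hs
      linarith
    have hdiv : N.eval s =
        (s - a) * (N /ₘ (Polynomial.X - Polynomial.C a)).eval s + N.eval a := by
      have := congrArg (Polynomial.eval s)
        (Polynomial.modByMonic_add_div N (Polynomial.X - Polynomial.C a))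
      rw [Polynomial.modByMonic_X_sub_C_eq_C_eval] at this
      simp only [Polynomial.eval_add, Polynomial.eval_mul, Polynomial.eval_sub, Polynomial.eval_X,
        Polynomial.eval_C] at this
      rw [← this]
      ring
    rw [hdiv, Multiset.map_cons, Multiset.prod_cons, add_div, mul_div_mul_left _ _ hne,
      div_eq_mul_inv (N.eval a)]

end IsLaplaceTransform

/-- A stable proper rational function is, up to its value at infinity, the Laplace transform of a
real integrable function: since `f` has real coefficients, the complex conjugate of a complex
impulse response is one as well, and so is the real part. -/
theorem exists_real_impulse_response {f : RatFunc ℝ} (hf : f.num.natDegree ≤ f.denom.natDegree)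
    (hf' : ∀ s : ℂ, Polynomial.aeval s f.denom = 0 → s.re < 0) :
    ∃ g : ℝ → ℝ, IntegrableOn g (Set.Ioi 0) ∧ ∀ s : ℂ, 0 ≤ s.re →
      f.eval (algebraMap ℝ ℂ) s = (f.num.coeff f.denom.natDegree : ℂ) +
        ∫ t in Set.Ioi (0 : ℝ), ((g t : ℝ) : ℂ) * Complex.exp (-(s * t)) := by
  set d := f.num.coeff f.denom.natDegree with hd
  set D := f.denom with hD
  set N := f.num - Polynomial.C d * D with hN
  have hDm : D.Monic := RatFunc.monic_denom f
  have hNdeg : N.degree < D.natDegree := by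
    rw [Polynomial.degree_lt_iff_coeff_zero]
    intro n hn
    rw [hN, Polynomial.coeff_sub, Polynomial.coeff_C_mul]
    rcases hn.eq_or_lt with h | h
    · rw [← h, hDm.coeff_natDegree, mul_one, sub_eq_zero]
    · rw [Polynomial.coeff_eq_zero_of_natDegree_lt h,
        Polynomial.coeff_eq_zero_of_natDegree_lt (hf.trans_lt h), mul_zero, sub_zero]
  set Dc := D.map (algebraMap ℝ ℂ) with hDc
  set Nc := N.map (algebraMap ℝ ℂ) with hNc
  have hsplit : Dc.Splits := IsAlgClosed.splits Dc
  have hDcm : Dc.Monic := hDm.map _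
  have hroots : ∀ a ∈ Dc.roots, a.re < 0 := by
    intro a ha
    refine hf' a ?_
    rw [Polynomial.mem_roots hDcm.ne_zero, Polynomial.IsRoot, hDc, Polynomial.eval_map] at ha
    rwa [Polynomial.aeval_def]
  have hcard : Dc.roots.card = D.natDegree := by
    rw [← hsplit.natDegree_eq_card_roots, hDc, Polynomial.natDegree_map]
  have hLT := IsLaplaceTransform.of_rational hroots (N := Nc) (by
    rw [hcard, hNc, Polynomial.degree_map]
    exact hNdeg)
  have hDeval : ∀ s : ℂ, (Dc.roots.map fun a => s - a).prod = D.eval₂ (algebraMap ℝ ℂ) s := by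
    intro s
    rw [← Polynomial.eval_map, ← hDc]
    conv_rhs => rw [hsplit.eq_prod_roots_of_monic hDcm]
    rw [Polynomial.eval_multiset_prod, Multiset.map_map]
    simp
  have hF : ∀ s : ℂ, 0 ≤ s.re → f.eval (algebraMap ℝ ℂ) s - d =
      Nc.eval s / (Dc.roots.map fun a => s - a).prod := by
    intro s hs
    have hne : D.eval₂ (algebraMap ℝ ℂ) s ≠ 0 := fun h0 =>
      absurd (hf' s (by rwa [Polynomial.aeval_def])) (not_lt.2 hs)
    rw [hDeval, RatFunc.eval, hNc, Polynomial.eval_map, hN, Polynomial.eval₂_sub,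
      Polynomial.eval₂_mul, Polynomial.eval₂_C, ← hD]
    field_simp
    simp
  have hconj : ∀ s : ℂ, f.eval (algebraMap ℝ ℂ) (star s) = star (f.eval (algebraMap ℝ ℂ) s) := by
    have hp : ∀ (p : Polynomial ℝ) (s : ℂ), p.eval₂ (algebraMap ℝ ℂ) (star s) =
        star (p.eval₂ (algebraMap ℝ ℂ) s) := by
      intro p s
      have := Polynomial.aeval_conj p s
      simpa only [Polynomial.aeval_def, Complex.star_def] using this
    intro s
    rw [RatFunc.eval, RatFunc.eval, hp, hp, star_div₀]
  obtain ⟨g, hg, hgF⟩ := hLT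
  refine ⟨fun t => (g t).re, hg.re, fun s hs => ?_⟩
  have e1 : f.eval (algebraMap ℝ ℂ) s - d =
      ∫ t in Set.Ioi (0 : ℝ), g t * Complex.exp (-(s * t)) := (hF s hs).trans (hgF s hs)
  have e2 : f.eval (algebraMap ℝ ℂ) s - d =
      ∫ t in Set.Ioi (0 : ℝ), star (g t) * Complex.exp (-(s * t)) := by
    have hs' : 0 ≤ (star s).re := by simpa using hs
    have h3 := congrArg star ((hF (star s) hs').trans (hgF (star s) hs'))
    rw [hconj, star_sub, star_star] at h3
    simp only [Complex.star_def, Complex.conj_ofReal] at h3 ⊢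
    rw [h3, ← integral_conj]
    congr 1
    ext t
    rw [map_mul, ← Complex.exp_conj]
    simp
  have hi2 : IntegrableOn (fun t => star (g t)) (Set.Ioi 0) :=
    (LinearIsometryEquiv.integrable_comp_iff (Complex.conjLIE)).2 hg
  have e3 : ∫ t in Set.Ioi (0 : ℝ), (((g t).re : ℝ) : ℂ) * Complex.exp (-(s * t)) =
      1 / 2 * ((∫ t in Set.Ioi (0 : ℝ), g t * Complex.exp (-(s * t))) +
        ∫ t in Set.Ioi (0 : ℝ), star (g t) * Complex.exp (-(s * t))) := by
    rw [← integral_add (integrableOn_mul_exp_neg hg hs) (integrableOn_mul_exp_neg hi2 hs),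
      ← integral_const_mul]
    congr 1
    ext t
    rw [Complex.re_eq_add_conj, Complex.star_def]
    ring
  rw [e3, ← e1, ← e2]
  ring

theorem IsRHInf.exists_isImpulseResponse {m : ℕ} {G : Matrix (Fin m) (Fin m) (RatFunc ℝ)}
    (hG : IsRHInf G) : ∃ g, IsImpulseResponse G g := by
  choose g hg hgG using fun i j => exists_real_impulse_response (hG i j).1 (hG i j).2
  exact ⟨fun t => Matrix.of fun i j => g i j t, fun i j => ⟨hg i j, fun s hs => hgG i j s hs⟩⟩

/-! ### The frequency response -/

section

variable {m : ℕ} {G : Matrix (Fin m) (Fin m) (RatFunc ℝ)} {g : ℝ → Matrix (Fin m) (Fin m) ℝ}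

theorem IsImpulseResponse.continuous_transferValue (hg : IsImpulseResponse G g) :
    Continuous fun ω : ℝ => transferValue G ((jPoint ω : ℂ) : OnePoint ℂ) := by
  refine continuous_matrix fun i j => ?_
  simp only [hg.transferValue_jPoint]
  refine continuous_const.add ?_
  refine continuous_of_dominated (bound := fun t => ‖g t i j‖) (fun ω => ?_)
    (fun ω => ae_of_all _ fun t => ?_) (hg i j).1.norm (ae_of_all _ fun t => by fun_prop)
  · exact (hg i j).1.ofReal.1.mul (Continuous.aestronglyMeasurable (by fun_prop))
  · rw [norm_mul, Complex.norm_exp, Complex.norm_real]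
    simp

/-- The frequency response tends to the feedthrough, by the Riemann-Lebesgue lemma. -/
theorem IsImpulseResponse.tendsto_transferValue (hg : IsImpulseResponse G g) :
    Tendsto (fun ω : ℝ => transferValue G ((jPoint ω : ℂ) : OnePoint ℂ)) atTop
      (𝓝 (transferValue G ∞)) := by
  refine tendsto_pi_nhds.2 fun i => tendsto_pi_nhds.2 fun j => ?_
  simp only [hg.transferValue_jPoint]
  have h1 := (Real.tendsto_integral_exp_smul_cocompact
    (Set.indicator (Set.Ioi (0 : ℝ)) fun t => ((g t i j : ℝ) : ℂ))).mono_left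
    atTop_le_cocompact
  have h2 : Tendsto (fun ω : ℝ => ω * (2 * Real.pi)⁻¹) atTop atTop :=
    tendsto_id.atTop_mul_const (by positivity)
  have h3 := (h1.comp h2).const_add (feedthrough G i j : ℂ)
  rw [add_zero] at h3
  refine h3.congr fun ω => ?_
  congr 1
  rw [Function.comp_apply, ← integral_indicator measurableSet_Ioi]
  congr 1
  ext t
  simp only [Set.indicator_apply]
  split_ifs
  · rw [Circle.smul_def, Real.fourierChar_apply, smul_eq_mul, mul_comm]
    congr 2
    push_cast
    have : (Real.pi : ℂ) ≠ 0 := by exact_mod_cast Real.pi_ne_zero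
    field_simp
  · simp

end

/-! ### Trigonometric inputs with prescribed complex power -/

section

variable {m : ℕ} {G : Matrix (Fin m) (Fin m) (RatFunc ℝ)}

/-- A trigonometric signal with positive frequencies is a power signal: each of its terms is
periodic. -/
theorem isPowerSignal_expSum {s : Finset ℝ} (hs : ∀ ω ∈ s, 0 < ω) (c : ℝ → Fin m → ℂ) :
    IsPowerSignal fun t i => (expSum s (fun ω => c ω i) t).re := by
  refine ⟨0, s.card, fun k => 2 * Real.pi / (s.equivFin.symm k : ℝ),
    fun k t i => (c (s.equivFin.symm k) i *
      Complex.exp ((s.equivFin.symm k : ℝ) * t * Complex.I)).re, MemLp.zero, fun k => ?_, ?_⟩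
  · have hk := hs _ (s.equivFin.symm k).2
    have hk' : ((s.equivFin.symm k : ℝ) : ℂ) ≠ 0 := by exact_mod_cast hk.ne'
    refine ⟨by positivity, fun t => ?_, ?_⟩
    · ext i
      refine congrArg (fun z => (c (s.equivFin.symm k) i * z).re) ?_
      refine (congrArg Complex.exp ?_).trans (Complex.exp_periodic _)
      push_cast
      field_simp
    · refine MemLp.of_bound (Continuous.aestronglyMeasurable (by fun_prop))
        (∑ i, ‖c (s.equivFin.symm k) i‖) (ae_of_all _ fun t => ?_)
      refine (pi_norm_le_iff_of_nonneg (Finset.sum_nonneg fun _ _ => norm_nonneg _)).2 fun i => ?_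
      refine ((Complex.abs_re_le_norm _).trans_eq ?_).trans (Finset.single_le_sum
        (f := fun i => ‖c (s.equivFin.symm k) i‖) (fun _ _ => norm_nonneg _) (Finset.mem_univ i))
      rw [norm_mul, Complex.norm_exp]
      simp
  · ext t i
    rw [Pi.zero_apply, zero_add, Finset.sum_apply, expSum, Complex.re_sum, ← s.sum_coe_sort]
    exact (Equiv.sum_comp s.equivFin.symm fun ω : s =>
      (c ω i * Complex.exp ((ω : ℝ) * t * Complex.I)).re).symm

theorem trigPower_mem_complexPowers (hG : IsRHInf G) {s : Finset ℝ} (hs : ∀ ω ∈ s, 0 < ω)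
    {c : ℝ → Fin m → ℂ} (hc : ∀ i, (c 0 i).im = 0) (hE : trigEnergy s c = 1) :
    trigPower G s c ∈ complexPowers G := by
  obtain ⟨g, hg⟩ := hG.exists_isImpulseResponse
  have hs' : ∀ ω ∈ s, 0 ≤ ω := fun ω hω => (hs ω hω).le
  choose a ha using fun i => exists_windowBound_re_expSum s (fun ω => c ω i)
  refine ⟨fun t i => (expSum s (fun ω => c ω i) t).re, fun t i => (expSum s (fun ω => c ω i) t).im,
    fun t i => (expSum s
      (fun ω => (transferValue G ((jPoint ω : ℂ) : OnePoint ℂ) *ᵥ c ω) i) t).re,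
    isPowerSignal_expSum hs c, ?_, ae_of_all _ fun t => ?_, ⟨g, hg, ?_⟩,
    hasTimeAverage_trig_re G hs' hc,
    hasTimeAverage_trig_im G hs' hc (hg.im_transferValue_zero hc)⟩
  · rw [← hE]
    exact hasTimeAverage_trig_energy hs' hc
  · refine tendsto_pi_nhds.2 fun i => ?_
    refine (tendsto_truncHilbert_re_expSum hs' (c := fun ω => c ω i) (hc i) t).congr' ?_
    filter_upwards [eventually_truncation] with q hq
    exact (setIntegral_hilbert_apply ha hq.1 q.2 t i).symm
  · filter_upwards [isResponse_apply hg ha] with t ht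
    ext i
    rw [ht i]
    exact (hg.response_expSum s c i t).symm

/-- A frequency `jω`, `ω ∈ [0, ∞]`, is a limit of positive finite frequencies, so that a value in
the numerical range there is approximated at infinitely many of them. -/
theorem exists_freq_near (hG : IsRHInf G) {σ : OnePoint ℂ} (hσ : σ ∈ nonnegFrequencies)
    (x : Fin m → ℂ) {δ : ℝ} (hδ : 0 < δ) (F : Finset ℝ) :
    ∃ ω : ℝ, 0 < ω ∧ ω ∉ F ∧
      ‖(star x ⬝ᵥ (transferValue G ((jPoint ω : ℂ) : OnePoint ℂ) *ᵥ x)) -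
        star x ⬝ᵥ (transferValue G σ *ᵥ x)‖ < δ := by
  obtain ⟨g, hg⟩ := hG.exists_isImpulseResponse
  have hcont : Continuous fun M : Matrix (Fin m) (Fin m) ℂ => star x ⬝ᵥ (M *ᵥ x) := by fun_prop
  obtain ⟨l, hl, hpos, hF, hlim⟩ : ∃ l : Filter ℝ, l.NeBot ∧ (∀ᶠ ω in l, 0 < ω) ∧
      (∀ᶠ ω in l, ω ∉ F) ∧ Tendsto (fun ω : ℝ => transferValue G ((jPoint ω : ℂ) : OnePoint ℂ)) l
        (𝓝 (transferValue G σ)) := by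
    rcases hσ with rfl | ⟨ω₀, h0, rfl⟩
    · refine ⟨atTop, inferInstance, eventually_gt_atTop 0, ?_, hg.tendsto_transferValue⟩
      have h := F.finite_toSet.compl_mem_cofinite
      exact (Filter.mem_of_superset (atTop_le_cofinite h) fun _ h => h)
    · refine ⟨𝓝[>] ω₀, inferInstance, ?_, ?_,
        (hg.continuous_transferValue.tendsto ω₀).mono_left nhdsWithin_le_nhds⟩
      · filter_upwards [self_mem_nhdsWithin] with ω hω using h0.trans_lt hω
      · have h : ((F.erase ω₀ : Finset ℝ) : Set ℝ)ᶜ ∈ 𝓝 ω₀ :=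
          (F.erase ω₀).finite_toSet.isClosed.isOpen_compl.mem_nhds (by simp)
        filter_upwards [self_mem_nhdsWithin, nhdsWithin_le_nhds h] with ω h1 h2 h3
        exact h2 (Finset.mem_coe.2 (Finset.mem_erase.2 ⟨(Set.mem_Ioi.1 h1).ne', h3⟩))
  have h := ((hcont.tendsto _).comp hlim).eventually (Metric.ball_mem_nhds _ hδ)
  obtain ⟨ω, h1, h2, h3⟩ := (hpos.and (hF.and h)).exists
  exact ⟨ω, h1, h2, mem_ball_iff_norm.1 h3⟩

/-- Finitely many choices with infinitely many options each can be made injectively. -/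
theorem exists_injOn_of_forall_finset {ι α : Type*} [Nonempty α] (t : Finset ι) (P : ι → α → Prop)
    (h : ∀ k ∈ t, ∀ F : Finset α, ∃ a, a ∉ F ∧ P k a) :
    ∃ ν : ι → α, Set.InjOn ν t ∧ ∀ k ∈ t, P k (ν k) := by
  classical
  induction t using Finset.induction_on with
  | empty => exact ⟨fun _ => Classical.arbitrary α, by simp, by simp⟩
  | insert k t hk ih =>
    obtain ⟨ν, hν, hP⟩ := ih fun i hi => h i (Finset.mem_insert_of_mem hi)
    obtain ⟨a, ha, hPa⟩ := h k (Finset.mem_insert_self k t) (t.image ν)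
    have hupd : ∀ i ∈ t, Function.update ν k a i = ν i := fun i hi =>
      Function.update_of_ne (ne_of_mem_of_not_mem hi hk) _ _
    refine ⟨Function.update ν k a, ?_, fun i hi => ?_⟩
    · rw [Finset.coe_insert, Set.injOn_insert (by simpa using hk)]
      refine ⟨hν.congr fun i hi => (hupd i hi).symm, ?_⟩
      rintro ⟨i, hi, h0⟩
      rw [hupd i hi, Function.update_self] at h0
      exact ha (h0 ▸ Finset.mem_image_of_mem ν hi)
    · rcases Finset.mem_insert.1 hi with rfl | hi
      · rwa [Function.update_self]
      · rw [hupd i hi]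
        exact hP i hi

/-- Every convex combination of values in the numerical ranges is a limit of complex powers: it
is approximated by the power of a sum of sinusoids at distinct positive frequencies, whose mutual
powers vanish. -/
theorem convexHull_subset_closure_complexPowers (hG : IsRHInf G) :
    convexHull ℝ (⋃ s ∈ nonnegFrequencies, numRange (transferValue G s)) ⊆
      closure (complexPowers G) := by
  classical
  intro z hz
  rw [mem_convexHull_iff_exists_fintype] at hz
  obtain ⟨ι, hι, w, q, hw, hw1, hq, rfl⟩ := hz
  simp only [Set.mem_iUnion, exists_prop] at hq
  choose σ hσ x hx hqx using hq
  refine Metric.mem_closure_iff.2 fun δ hδ => ?_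
  obtain ⟨ν, hν, hP⟩ := exists_injOn_of_forall_finset (Finset.univ : Finset ι)
    (fun k ω => 0 < ω ∧ ‖(star (x k) ⬝ᵥ (transferValue G ((jPoint ω : ℂ) : OnePoint ℂ) *ᵥ x k)) -
        star (x k) ⬝ᵥ (transferValue G (σ k) *ᵥ x k)‖ < δ) (fun k _ F => by
      obtain ⟨ω, h1, h2, h3⟩ := exists_freq_near hG (hσ k) (x k) hδ F
      exact ⟨ω, h2, h1, h3⟩)
  have hνi : Function.Injective ν := Set.injOn_univ.1 (by simpa using hν)
  -- the power of a sinusoid with amplitude vector `c` is half of `star c ⬝ᵥ G(jω) *ᵥ c`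
  set c : ℝ → Fin m → ℂ := fun ω =>
    ∑ k, if ν k = ω then ((√(2 * w k) : ℝ) : ℂ) • x k else 0 with hc
  have hcν : ∀ k, c (ν k) = ((√(2 * w k) : ℝ) : ℂ) • x k := by
    intro k
    rw [hc]
    simp only [hνi.eq_iff, Finset.sum_ite_eq', Finset.mem_univ, if_true]
  have hc0 : ∀ i, (c 0 i).im = 0 := by
    intro i
    have : c 0 = 0 := Finset.sum_eq_zero fun k _ => if_neg (hP k (Finset.mem_univ k)).1.ne'
    rw [this]
    rfl
  have hwt : ∀ k, freqWeight (ν k) = 1 / 2 := fun k =>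
    if_neg (hP k (Finset.mem_univ k)).1.ne'
  have hsq : ∀ k, ((√(2 * w k) : ℝ) : ℂ) * ((√(2 * w k) : ℝ) : ℂ) = 2 * w k := by
    intro k
    rw [← Complex.ofReal_mul, Real.mul_self_sqrt (mul_nonneg zero_le_two (hw k))]
    push_cast
    rfl
  have hE : trigEnergy (Finset.univ.image ν) c = 1 := by
    rw [trigEnergy, Finset.sum_image hνi.injOn, ← hw1]
    refine Finset.sum_congr rfl fun k _ => ?_
    have h1 : ∑ i, ‖x k i‖ ^ 2 = 1 := by
      have := hx k
      rw [star_dotProduct_self_eq] at this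
      exact_mod_cast this
    rw [hwt, hcν]
    simp only [Pi.smul_apply, smul_eq_mul, norm_mul, mul_pow, ← Finset.mul_sum, h1]
    rw [Complex.norm_real, Real.norm_eq_abs, sq_abs,
      Real.sq_sqrt (mul_nonneg zero_le_two (hw k))]
    ring
  have hPow : trigPower G (Finset.univ.image ν) c = ∑ k, w k •
      (star (x k) ⬝ᵥ (transferValue G ((jPoint (ν k) : ℂ) : OnePoint ℂ) *ᵥ x k)) := by
    rw [trigPower, Finset.sum_image hνi.injOn]
    refine Finset.sum_congr rfl fun k _ => ?_
    rw [hwt, hcν, Matrix.mulVec_smul, star_smul, smul_dotProduct, dotProduct_smul, smul_smul,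
      Complex.star_def, Complex.conj_ofReal, hsq, Complex.real_smul, smul_eq_mul]
    push_cast
    ring
  refine ⟨_, trigPower_mem_complexPowers hG (s := Finset.univ.image ν) (fun ω hω => ?_) hc0 hE, ?_⟩
  · obtain ⟨k, hk, rfl⟩ := Finset.mem_image.1 hω
    exact (hP k hk).1
  · rw [dist_comm, dist_eq_norm, hPow, ← Finset.sum_sub_distrib]
    have hle : ∀ k, ‖w k • (star (x k) ⬝ᵥ (transferValue G ((jPoint (ν k) : ℂ) : OnePoint ℂ) *ᵥ x k))
        - w k • q k‖ = w k * ‖(star (x k) ⬝ᵥ (transferValue G ((jPoint (ν k) : ℂ) : OnePoint ℂ) *ᵥ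
          x k)) - star (x k) ⬝ᵥ (transferValue G (σ k) *ᵥ x k)‖ := by
      intro k
      rw [hqx k, ← smul_sub, norm_smul, Real.norm_of_nonneg (hw k)]
    refine (norm_sum_le _ _).trans_lt ?_
    rw [Finset.sum_congr rfl fun k _ => hle k]
    obtain ⟨k, -, hk⟩ := Finset.exists_lt_of_sum_lt (s := Finset.univ) (f := fun _ : ι => (0 : ℝ))
      (g := w) (by rw [hw1]; simp)
    calc _ < ∑ k, w k * δ := Finset.sum_lt_sum
          (fun k _ => mul_le_mul_of_nonneg_left (hP k (Finset.mem_univ k)).2.le (hw k))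
          ⟨k, Finset.mem_univ k, mul_lt_mul_of_pos_left (hP k (Finset.mem_univ k)).2 hk⟩
      _ = δ := by rw [← Finset.sum_mul, hw1, one_mul]

theorem closure_complexPowers (hG : IsRHInf G) :
    closure (complexPowers G) =
      closure (convexHull ℝ (⋃ s ∈ nonnegFrequencies, numRange (transferValue G s))) :=
  (closure_minimal complexPowers_subset isClosed_closure).antisymm
    (closure_minimal (convexHull_subset_closure_complexPowers hG) isClosed_closure)

end

end

theorem mainTheorem10 {m : ℕ} (G : Matrix (Fin m) (Fin m) (RatFunc ℝ)) (hG : IsRHInf G)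
    (Φ : OnePoint ℂ → Multiset ℝ) (hΦ : IsSemiSectorial G Φ) :
    closure (complexPowers G) =
      closure (convexHull ℝ (⋃ s ∈ nonnegFrequencies, numRange (transferValue G s))) ∧
    ∀ c : ℝ,
      Set.Icc (minPhase Φ) (maxPhase Φ) ⊆ Set.Ioc (c : EReal) ((c + 2 * Real.pi : ℝ) : EReal) →
      minPhase Φ = (⨅ S ∈ {S : ℂ | S ∈ complexPowers G ∧ S ≠ 0}, (argFrom c S : EReal)) ∧
      maxPhase Φ = (⨆ S ∈ {S : ℂ | S ∈ complexPowers G ∧ S ≠ 0}, (argFrom c S : EReal)) := by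
  obtain ⟨-, hresp, α, β, hαβ, hI⟩ := hΦ
  exact ⟨closure_complexPowers hG, fun c hc =>
    phase_sector_of_closure_eq hresp.2.2 hαβ hI (closure_complexPowers hG) hc⟩
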